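/- Let $F$ be a number field with ring of integers $\mathcal O_F$, adele ring $\mathbb A$ and absolute discriminant $\Delta_F$; let $r\ge 1$ and $G=GL_r$. Let $p:[0,r]\to\mathbb R$ be a concave function with $p(0)=p(r)=0$ (for instance a normalized convex polygon, in the convention in which the successive slopes of a convex polygon decrease). For $g\in G(\mathbb A)$ let $E_g=\{x\in F^r: x\in g_v\mathcal O_v^r\text{ for all finite }v\}$, with the hermitian metrics $\rho_{g,v}(x,y)=\langle g_v^{-1}x,g_v^{-1}y\rangle$ at the infinite places $v$, and let $\deg g=\deg(E_g,\rho_g)$ be its Arakelov degree. For a parabolic subgroup $Q$ of $G$ over $F$ (standard or not), the stabilizer of a flag $0=W_0\subset W_1\subset\dots\subset W_s=F^r$, let $p_Q^g:[0,r]\to\mathbb R$ be the function that takes the value $\deg(E_g\cap W_i,\rho_g)-\dim W_i\cdot\frac{\deg g}{r}$ at $\dim W_i$ $(0\le i\le s)$ and is affine in between. Put $\overline p^g=\sup_Q p_Q^g$. For a standard parabolic subgroup $P=P_I$ (block upper triangular matrices, for a partition $I=(d_1,\dots,d_s)$ of $r$; $|P|=s$, $r_i=d_1+\dots+d_i$)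 with unipotent radical $N$, write $q>_Pp$ if $q(r_i)>p(r_i)$ for $1\le i\le|P|-1$. For $\phi:G(F)\backslash G(\mathbb A)\to\mathbb C$ let $$\Lambda_p\phi(g)=\sum_{P}(-1)^{|P|-1}\sum_{\delta\in P(F)\backslash G(F)}\phi_P(\delta g)\,\mathbf 1(p_P^{\delta g}>_Pp),\qquad \phi_P(g)=\int_{N(F)\backslash N(\mathbb A)}\phi(ng)\,dn,$$ where $P$ runs over the standard parabolic subgroups and $dn$ is the invariant measure of total mass $1$. For a subgroup $Z$ of the centre $Z_{G(\mathbb A)}$ of $G(\mathbb A)$ let $$\big(Z\,G(F)\backslash G(\mathbb A)\big)_p=\{g\in Z\,G(F)\backslash G(\mathbb A):\Lambda_p\mathbf 1(g)=1\},$$ and for $T>0$ let $$\mathcal M_{F,r}^{\le p}[T]=\{g\in G(F)\backslash G(\mathbb A):\deg g=-\log T,\ \overline p^g\le p\}$$ (so for $T=\Delta_F^{r/2}$ the condition is $\deg g=-\frac r2\log\Delta_F$). Let $A_{G(\mathbb A)}\cong\mathbb R_{>0}$ be the split component of $Z_{G(\mathbb A)}$: the scalar matrices with component $1$ at the finite places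 and the same $t>0$ at all infinite places. Then: 1. For every $g$, the function $\overline p^g$ is concave on $[0,r]$ and is itself one of the $p_Q^g$, hence the largest of them. For every $g$ and $P$ only finitely many $\delta\in P(F)\backslash G(F)$ satisfy $p_P^{\delta g}>_Pp$. 2. $\Lambda_p\mathbf 1(g)=\mathbf 1(\overline p^g\le p)$ for all $g\in G(\mathbb A)$, and $\Lambda_p\mathbf 1$ is invariant under $Z_{G(\mathbb A)}G(F)$. 3. For every $T>0$, in particular for $T=\Delta_F^{r/2}$, the map $G(F)g\mapsto A_{G(\mathbb A)}G(F)g$ is a homeomorphism $$\mathcal M_{F,r}^{\le p}[T]\;\simeq\;\big(A_{G(\mathbb A)}G(F)\backslash G(\mathbb A)\big)_p ,$$ and the map $G(F)g\mapsto Z_{G(\mathbb A)}G(F)g$ is a topological quotient map from $\mathcal M_{F,r}^{\le p}[T]$ onto $\big(Z_{G(\mathbb A)}G(F)\backslash G(\mathbb A)\big)_p$ whose fibres are the orbits of the group of $z\in Z_{G(\mathbb A)}$ with $\deg z=0$ (equivalently, with idelic norm $|\det z|_{\mathbb A}=1$). 4. Both truncated domains, $\big(A_{G(\mathbb A)}G(F)\backslash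 G(\mathbb A)\big)_p$ and $\big(Z_{G(\mathbb A)}G(F)\backslash G(\mathbb A)\big)_p$, are compact. -/

import Mathlib

open scoped NumberField Topology
open NumberField IsDedekindDomain MeasureTheory

namespace GeoTrunc

noncomputable section

/-! ### Adelic groups and their quotients -/

/-- The ring of adeles of the number field `F`. -/
abbrev Adele (F : Type*) [Field F] [NumberField F] : Type _ := AdeleRing (𝓞 F) F

/-- `GL_r(𝔸)`, with its usual (unit group) topology. -/
abbrev GA (F : Type*) [Field F] [NumberField F] (r : ℕ) : Type _ :=
  Matrix.GeneralLinearGroup (Fin r) (Adele F)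

/-- The space `H \ G` of cosets `H g`; it carries the quotient topology. -/
abbrev Cosets {G : Type*} [Group G] (H : Subgroup G) : Type _ :=
  Quotient (QuotientGroup.rightRel H)

/-- The class `H g` of `g` in `H \ G`. -/
abbrev cls {G : Type*} [Group G] (H : Subgroup G) (g : G) : Cosets H :=
  Quotient.mk (QuotientGroup.rightRel H) g

/-- The diagonal embedding `GL_r(F) → GL_r(𝔸)`. -/
def diag (F : Type*) [Field F] [NumberField F] (r : ℕ) :
    Matrix.GeneralLinearGroup (Fin r) F →* GA F r :=
  Matrix.GeneralLinearGroup.map (algebraMap F (Adele F))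

/-- `G(F) = GL_r(F)` as a subgroup of `G(𝔸) = GL_r(𝔸)`. -/
def rationalPoints (F : Type*) [Field F] [NumberField F] (r : ℕ) : Subgroup (GA F r) :=
  (diag F r).range

/-- The projection from the adeles to the finite adeles. -/
def toFinite (F : Type*) [Field F] [NumberField F] :
    Adele F →+* FiniteAdeleRing (𝓞 F) F :=
  RingHom.snd (InfiniteAdeleRing F) (FiniteAdeleRing (𝓞 F) F)

/-- The projection from the adeles to the completion at the infinite place `v`, followed by
the embedding of that completion into `ℂ`. -/
def toInfinite {F : Type*} [Field F] [NumberField F] (v : InfinitePlace F) : Adele F →+* ℂ :=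
  (InfinitePlace.Completion.extensionEmbedding v).comp
    ((Pi.evalRingHom (fun w : InfinitePlace F => w.Completion) v).comp
      (RingHom.fst (InfiniteAdeleRing F) (FiniteAdeleRing (𝓞 F) F)))

/-- The finite part `g_f` of `g ∈ GL_r(𝔸)`. -/
def finPart {F : Type*} [Field F] [NumberField F] {r : ℕ} (g : GA F r) :
    Matrix.GeneralLinearGroup (Fin r) (FiniteAdeleRing (𝓞 F) F) :=
  Matrix.GeneralLinearGroup.map (toFinite F) g

/-- The component `g_v` of `g ∈ GL_r(𝔸)` at the infinite place `v`, as a complex matrix. -/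
def infPart {F : Type*} [Field F] [NumberField F] {r : ℕ} (g : GA F r) (v : InfinitePlace F) :
    Matrix.GeneralLinearGroup (Fin r) ℂ :=
  Matrix.GeneralLinearGroup.map (toInfinite v) g

/-- The split component `A_{G(𝔸)} ≅ ℝ_{>0}` of the centre of `GL_r(𝔸)`: the scalar matrices whose
component is `1` at all finite places and the same positive real number `t` at all infinite
places. -/
def splitCenter (F : Type*) [Field F] [NumberField F] (r : ℕ) : Subgroup (GA F r) where
  carrier := {a | finPart a = 1 ∧ ∃ t : ℝ, 0 < t ∧ ∀ v : InfinitePlace F,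
    (infPart a v : Matrix (Fin r) (Fin r) ℂ) = (t : ℂ) • 1}
  one_mem' := ⟨map_one _, 1, one_pos, fun v => by simp [infPart]⟩
  mul_mem' := by
    rintro a b ⟨ha, s, hs, hav⟩ ⟨hb, t, ht, hbv⟩
    refine ⟨?_, s * t, mul_pos hs ht, fun v => ?_⟩
    · have : finPart (a * b) = finPart a * finPart b := map_mul _ _ _
      rw [this, ha, hb, one_mul]
    · have : infPart (a * b) v = infPart a v * infPart b v := map_mul _ _ _
      rw [this, Units.val_mul, hav, hbv]
      rw [smul_mul_smul_comm, one_mul, Complex.ofReal_mul]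
  inv_mem' := by
    rintro a ⟨ha, t, ht, hav⟩
    refine ⟨?_, t⁻¹, inv_pos.mpr ht, fun v => ?_⟩
    · have : finPart a⁻¹ = (finPart a)⁻¹ := map_inv _ _
      rw [this, ha, inv_one]
    · have h1 : infPart a⁻¹ v = (infPart a v)⁻¹ := map_inv _ _
      have h2 : (infPart a v : Matrix (Fin r) (Fin r) ℂ) * ((t⁻¹ : ℝ) : ℂ) • 1 = 1 := by
        rw [hav]
        have : (t : ℂ) ≠ 0 := by exact_mod_cast ht.ne'
        rw [smul_mul_smul_comm, one_mul, Complex.ofReal_inv, mul_inv_cancel₀ this, one_smul]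
      rw [h1]
      exact Units.inv_eq_of_mul_eq_one_right h2

/-! ### The metrized lattice of an adelic matrix, and its degree -/

/-- The rank `r` vector sheaf `E_g` on `Spec 𝓞_F` attached to `g`, realised in its generic fibre
`F^r`: the vectors `x ∈ F^r` with `x ∈ g_v 𝓞_v^r` for all finite places `v`. -/
def sheaf {F : Type*} [Field F] [NumberField F] {r : ℕ} (g : GA F r) :
    Submodule (𝓞 F) (Fin r → F) where
  carrier := {x | ∀ (i : Fin r) (v : HeightOneSpectrum (𝓞 F)),
    ((((finPart g)⁻¹ : Matrix.GeneralLinearGroup (Fin r) (FiniteAdeleRing (𝓞 F) F)) :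
      Matrix (Fin r) (Fin r) (FiniteAdeleRing (𝓞 F) F)).mulVec
        (fun j => algebraMap F (FiniteAdeleRing (𝓞 F) F) (x j)) i) v
      ∈ v.adicCompletionIntegers F}
  zero_mem' := by
    intro i v
    have : (fun j => algebraMap F (FiniteAdeleRing (𝓞 F) F) ((0 : Fin r → F) j)) = 0 := by
      ext1 j
      simp
    rw [this, Matrix.mulVec_zero]
    exact zero_mem _
  add_mem' := by
    intro a b ha hb i v
    have : (fun j => algebraMap F (FiniteAdeleRing (𝓞 F) F) ((a + b) j))
        = (fun j => algebraMap F (FiniteAdeleRing (𝓞 F) F) (a j))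
          + fun j => algebraMap F (FiniteAdeleRing (𝓞 F) F) (b j) := by
      ext1 j
      simp
    rw [this, Matrix.mulVec_add]
    exact add_mem (ha i v) (hb i v)
  smul_mem' := by
    intro c a ha i v
    have : (fun j => algebraMap F (FiniteAdeleRing (𝓞 F) F) ((c • a) j))
        = algebraMap F (FiniteAdeleRing (𝓞 F) F) (c : F) •
          fun j => algebraMap F (FiniteAdeleRing (𝓞 F) F) (a j) := by
      ext1 j
      simp [Algebra.smul_def]
    rw [this, Matrix.mulVec_smul]
    exact mul_mem (HeightOneSpectrum.coe_mem_adicCompletionIntegers v c) (ha i v)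

/-- The hermitian inner product `⟨x, y⟩ = ⟨g_v⁻¹ x, g_v⁻¹ y⟩_{std}` on `F^r` at the infinite place
`v`: the standard one, transported by `g_v`. -/
def metric {F : Type*} [Field F] [NumberField F] {r : ℕ} (g : GA F r) (v : InfinitePlace F)
    (x y : Fin r → F) : ℂ :=
  star ((((infPart g v)⁻¹ : Matrix.GeneralLinearGroup (Fin r) ℂ) :
      Matrix (Fin r) (Fin r) ℂ).mulVec (fun j => v.embedding (x j))) ⬝ᵥ
    ((((infPart g v)⁻¹ : Matrix.GeneralLinearGroup (Fin r) ℂ) :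
      Matrix (Fin r) (Fin r) ℂ).mulVec (fun j => v.embedding (y j)))

/-- A maximal `F`-linearly independent family of vectors in the `𝓞_F`-lattice `L`. -/
def maxFamily {F : Type*} [Field F] [NumberField F] {r : ℕ} (L : Submodule (𝓞 F) (Fin r → F)) :
    Fin (Module.finrank F (Submodule.span F (L : Set (Fin r → F)))) → (Fin r → F) :=
  (Submodule.exists_fun_fin_finrank_span_eq F (L : Set (Fin r → F))).choose

/-- The Arakelov degree of an `𝓞_F`-lattice `L ⊆ F^r` with hermitian inner products `ρ_v` at the
infinite places:
`log #(L / (𝓞_F s₁ + ⋯ + 𝓞_F s_k)) - ∑_v ε_v ½ log det (ρ_v(s_i, s_j))`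
for any maximal `F`-linearly independent family `s₁, …, s_k` in `L`, where `ε_v = 1` for real and
`ε_v = 2` for complex `v`. (It does not depend on the family.) -/
def arakelovDegree {F : Type*} [Field F] [NumberField F] {r : ℕ}
    (L : Submodule (𝓞 F) (Fin r → F))
    (ρ : InfinitePlace F → (Fin r → F) → (Fin r → F) → ℂ) : ℝ :=
  Real.log ((Submodule.span (𝓞 F) (Set.range (maxFamily L))).toAddSubgroup.relIndex
      L.toAddSubgroup : ℝ)
    - ∑ v : InfinitePlace F, (v.mult : ℝ) * (1 / 2 * Real.log
        ‖(Matrix.of fun i j => ρ v (maxFamily L i) (maxFamily L j)).det‖)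

/-- The degree of the sublattice `E_g ∩ W` of `E_g`, with the restricted metric, for a subspace
`W` of the generic fibre `F^r`. -/
def subDegree {F : Type*} [Field F] [NumberField F] {r : ℕ} (g : GA F r)
    (W : Submodule F (Fin r → F)) : ℝ :=
  arakelovDegree (sheaf g ⊓ W.restrictScalars (𝓞 F)) (metric g)

/-- `deg g = deg (E_g, ρ_g)`. -/
def degree {F : Type*} [Field F] [NumberField F] {r : ℕ} (g : GA F r) : ℝ :=
  arakelovDegree (sheaf g) (metric g)

/-! ### Parabolic subgroups and polygons -/

/-- A parabolic subgroup `Q` of `GL_r` over `F`, standard or not, given by the flag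
`0 = W₀ ⊂ W₁ ⊂ ⋯ ⊂ W_s = F^r` whose stabiliser it is. -/
structure Parabolic (F : Type*) [Field F] (r : ℕ) where
  /-- the flag -/
  flag : LTSeries (Submodule F (Fin r → F))
  head_eq : flag.head = ⊥
  last_eq : flag.last = ⊤

/-- The rank `r_i` of the `i`-th step of the filtration of `E_g` induced by `Q`. -/
def Parabolic.rk {F : Type*} [Field F] {r : ℕ} (Q : Parabolic F r)
    (i : Fin (Q.flag.length + 1)) : ℝ :=
  Module.finrank F (Q.flag i)

/-- The number `deg (E_i^{g;Q}, ρ_i^{g;Q}) - r_i · deg (E_g, ρ_g) / r`. -/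
def Parabolic.height {F : Type*} [Field F] [NumberField F] {r : ℕ} (Q : Parabolic F r)
    (g : GA F r) (i : Fin (Q.flag.length + 1)) : ℝ :=
  subDegree g (Q.flag i) - Q.rk i * (degree g / r)

/-- The polygon `p_Q^g : [0, r] → ℝ`: the function that is affine on every interval
`[r_i, r_{i+1}]` and takes the value `deg E_i^{g;Q} - r_i · deg E_g / r` at `r_i`
(in particular `0` at `0` and at `r`). -/
def Parabolic.polygon {F : Type*} [Field F] [NumberField F] {r : ℕ} (Q : Parabolic F r)
    (g : GA F r) (x : ℝ) : ℝ :=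
  ∑ i : Fin Q.flag.length,
    (Q.height g i.succ - Q.height g i.castSucc) / (Q.rk i.succ - Q.rk i.castSucc) *
      max 0 (min (x - Q.rk i.castSucc) (Q.rk i.succ - Q.rk i.castSucc))

/-- The canonical polygon `p̄^g`, the largest of all the polygons `p_Q^g`. -/
def canonicalPolygon {F : Type*} [Field F] [NumberField F] {r : ℕ} (g : GA F r) (x : ℝ) : ℝ :=
  ⨆ Q : Parabolic F r, Q.polygon g x

/-- `p̄^g ≤ p`, as functions on `[0, r]`. -/
def CanonicalLE {F : Type*} [Field F] [NumberField F] {r : ℕ} (p : ℝ → ℝ) (g : GA F r) : Prop :=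
  ∀ x ∈ Set.Icc (0 : ℝ) r, canonicalPolygon g x ≤ p x

/-- `p : [0, r] → ℝ` is convex, in the convention where the successive slopes of a convex polygon
decrease (so `p` is a concave function), and normalized by `p(0) = p(r) = 0`. All such functions
are allowed, not only the piecewise affine ones. -/
structure IsNormalizedConvex (r : ℕ) (p : ℝ → ℝ) : Prop where
  concave : ConcaveOn ℝ (Set.Icc (0 : ℝ) r) p
  map_zero : p 0 = 0
  map_rank : p r = 0

/-- The subspace of `F^r` spanned by the first `k` coordinate vectors. -/
def coordSubspace (F : Type*) [Field F] (r k : ℕ) : Submodule F (Fin r → F) where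
  carrier := {x | ∀ j : Fin r, k ≤ j → x j = 0}
  zero_mem' := fun _ _ => rfl
  add_mem' := by
    intro a b ha hb j hj
    simp [ha j hj, hb j hj]
  smul_mem' := by
    intro c a ha j hj
    simp [ha j hj]

/-- The flag of the standard parabolic subgroup `P_I` for the partition
`I = (d₁, …, d_s)` of `r`: its steps are spanned by the first `r_i = d₁ + ⋯ + d_i` coordinate
vectors. -/
def standard (F : Type*) [Field F] {r : ℕ} (I : Composition r) : Parabolic F r where
  flag :=
    { length := I.length
      toFun := fun i => coordSubspace F r (I.sizeUpTo i)
      step := by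
        intro i
        have hlt : I.sizeUpTo i < I.sizeUpTo (i + 1) := I.sizeUpTo_strict_mono i.2
        change coordSubspace F r (I.sizeUpTo i) < coordSubspace F r (I.sizeUpTo (i + 1))
        refine SetLike.lt_iff_le_and_exists.mpr ⟨?_, ?_⟩
        · intro x hx j hj
          exact hx j (hlt.le.trans hj)
        · have hr : I.sizeUpTo i < r := hlt.trans_le (I.sizeUpTo_le _)
          refine ⟨Pi.single ⟨I.sizeUpTo i, hr⟩ 1, fun j hj => ?_, fun h => ?_⟩
          · refine Pi.single_eq_of_ne (fun hij => ?_) 1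
            subst hij
            exact absurd hj (not_le.mpr hlt)
          · have := h ⟨I.sizeUpTo i, hr⟩ (by simp)
            simp at this }
  head_eq := by
    refine (Submodule.eq_bot_iff _).mpr fun x hx => ?_
    ext j
    exact hx j (by simp)
  last_eq := by
    refine (Submodule.eq_top_iff').mpr fun x j hj => ?_
    have h : I.sizeUpTo I.length ≤ j := hj
    rw [I.sizeUpTo_length] at h
    exact absurd j.2 (by omega)

/-- The `R`-points of the standard parabolic subgroup `P_I`: the block upper triangular
matrices. -/
def parabolicPoints {r : ℕ} (I : Composition r) (R : Type*) [CommRing R] :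
    Subgroup (Matrix.GeneralLinearGroup (Fin r) R) where
  carrier := {g | (g : Matrix (Fin r) (Fin r) R).BlockTriangular I.index}
  one_mem' := Matrix.blockTriangular_one
  mul_mem' := by
    intro a b ha hb
    exact Matrix.BlockTriangular.mul ha hb
  inv_mem' := by
    intro a ha
    have := Matrix.blockTriangular_inv_of_blockTriangular (M := (a : Matrix (Fin r) (Fin r) R)) ha
    simpa using this

/-- The `R`-points of the unipotent radical `N_I` of `P_I`: the block upper triangular matrices
whose diagonal blocks are identity matrices. -/
def unipotentPoints {r : ℕ} (I : Composition r) (R : Type*) [CommRing R] :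
    Subgroup (Matrix.GeneralLinearGroup (Fin r) R) where
  carrier := {g | ∀ i j, I.index j ≤ I.index i →
    (g : Matrix (Fin r) (Fin r) R) i j = (1 : Matrix (Fin r) (Fin r) R) i j}
  one_mem' := fun _ _ _ => rfl
  mul_mem' := by
    intro a b ha hb i j hij
    rw [Units.val_mul, Matrix.mul_apply, Finset.sum_eq_single i]
    · rw [ha i i le_rfl, Matrix.one_apply_eq, one_mul, hb i j hij]
    · intro k _ hk
      rcases le_or_gt (I.index k) (I.index i) with h | h
      · rw [ha i k h, Matrix.one_apply_ne (Ne.symm hk), zero_mul]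
      · rw [hb k j (hij.trans h.le), Matrix.one_apply_ne, mul_zero]
        rintro rfl
        exact absurd h (not_lt.mpr hij)
    · exact fun h => absurd (Finset.mem_univ _) h
  inv_mem' := by
    intro a ha i j hij
    have hT : a ∈ parabolicPoints I R := by
      intro k l hkl
      rw [ha k l hkl.le, Matrix.one_apply_ne]
      rintro rfl
      exact lt_irrefl _ hkl
    have hT' : ((a⁻¹ : Matrix.GeneralLinearGroup (Fin r) R) :
        Matrix (Fin r) (Fin r) R).BlockTriangular I.index := (parabolicPoints I R).inv_mem hT
    have h1 : ((a : Matrix (Fin r) (Fin r) R) *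
        ((a⁻¹ : Matrix.GeneralLinearGroup (Fin r) R) : Matrix (Fin r) (Fin r) R)) i j
          = (1 : Matrix (Fin r) (Fin r) R) i j := by
      rw [Units.mul_inv]
    rw [← h1, Matrix.mul_apply, Finset.sum_eq_single i]
    · rw [ha i i le_rfl, Matrix.one_apply_eq, one_mul]
    · intro k _ hk
      rcases le_or_gt (I.index k) (I.index i) with h | h
      · rw [ha i k h, Matrix.one_apply_ne (Ne.symm hk), zero_mul]
      · rw [hT' (lt_of_le_of_lt hij h), mul_zero]
    · exact fun h => absurd (Finset.mem_univ _) h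

/-- `q >_P p`: one has `q(r_i) > p(r_i)` for `i = 1, …, |P| - 1`, where `P = P_I`. -/
def Bigger {r : ℕ} (I : Composition r) (q p : ℝ → ℝ) : Prop :=
  ∀ i : ℕ, 0 < i → i < I.length → p (I.sizeUpTo i) < q (I.sizeUpTo i)

/-! ### Constant terms and the truncation operator -/

/-- `N_I(F)` as a subgroup of `N_I(𝔸)`. -/
def unipotentRational (F : Type*) [Field F] [NumberField F] {r : ℕ} (I : Composition r) :
    Subgroup (unipotentPoints I (Adele F)) :=
  ((unipotentPoints I F).map (diag F r)).subgroupOf (unipotentPoints I (Adele F))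

/-- The space `N_I(F) \ N_I(𝔸)`, with the quotient topology and its Borel sets. -/
abbrev UnipotentQuotient (F : Type*) [Field F] [NumberField F] {r : ℕ} (I : Composition r) :
    Type _ :=
  Cosets (unipotentRational F I)

instance (F : Type*) [Field F] [NumberField F] {r : ℕ} (I : Composition r) :
    MeasurableSpace (UnipotentQuotient F I) :=
  borel _

/-- Right translation by `n ∈ N_I(𝔸)` on `N_I(F) \ N_I(𝔸)`. -/
def rightTranslate {F : Type*} [Field F] [NumberField F] {r : ℕ} {I : Composition r}
    (n : unipotentPoints I (Adele F)) : UnipotentQuotient F I → UnipotentQuotient F I :=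
  Quotient.map (fun m => m * n) (by
    intro a b hab
    have h := QuotientGroup.rightRel_apply.mp hab
    refine QuotientGroup.rightRel_apply.mpr ?_
    simpa [mul_assoc] using h)

/-- The `N_I(𝔸)`-invariant Borel measures on `N_I(F) \ N_I(𝔸)` of total mass `1`. -/
def IsNormalizedInvariant {F : Type*} [Field F] [NumberField F] {r : ℕ} {I : Composition r}
    (μ : Measure (UnipotentQuotient F I)) : Prop :=
  IsProbabilityMeasure μ ∧ ∀ n, μ.map (rightTranslate n) = μ

open Classical in
/-- The measure `dn` on `N_I(F) \ N_I(𝔸)`: the unique invariant measure of total mass `1`. -/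
def unipotentMeasure (F : Type*) [Field F] [NumberField F] {r : ℕ} (I : Composition r) :
    Measure (UnipotentQuotient F I) :=
  if h : ∃ μ : Measure (UnipotentQuotient F I), IsNormalizedInvariant μ then h.choose else 0

/-- The constant term `φ_P(g) = ∫_{N(F) \ N(𝔸)} φ(n g) dn` along `P = P_I` of a function `φ` on
`G(F) \ G(𝔸)`. -/
def constantTerm {F : Type*} [Field F] [NumberField F] {r : ℕ} (I : Composition r)
    (φ : Cosets (rationalPoints F r) → ℂ) (g : GA F r) : ℂ :=
  ∫ x : UnipotentQuotient F I,
    Quotient.lift (fun n : unipotentPoints I (Adele F) =>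
      φ (cls (rationalPoints F r) ((n : GA F r) * g))) (by
        intro a b hab
        obtain ⟨u, -, hu⟩ := Subgroup.mem_subgroupOf.mp (QuotientGroup.rightRel_apply.mp hab)
        refine congrArg φ (Quotient.sound (QuotientGroup.rightRel_apply.mpr ⟨u, ?_⟩))
        rw [hu]
        simp [mul_assoc]) x
    ∂(unipotentMeasure F I)

open Classical in
/-- The characteristic function `𝟏(p_P^g >_P p)` for `P = P_I`. -/
def indBigger {F : Type*} [Field F] [NumberField F] {r : ℕ} (I : Composition r) (p : ℝ → ℝ)
    (g : GA F r) : ℂ :=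
  if Bigger I ((standard F I).polygon g) p then 1 else 0

/-- The geometrically oriented truncation
`Λ_p φ(g) = ∑_P (-1)^{dim (A_P / Z_G)} ∑_{δ ∈ P(F) \ G(F)} φ_P(δ g) 𝟏(p_P^{δ g} >_P p)`,
where `P = P_I` runs through the standard parabolic subgroups and
`dim (A_P / Z_G) = |P| - 1`. -/
def truncation {F : Type*} [Field F] [NumberField F] {r : ℕ} (p : ℝ → ℝ)
    (φ : Cosets (rationalPoints F r) → ℂ) (g : GA F r) : ℂ :=
  ∑ I : Composition r, (-1) ^ (I.length - 1) *
    ∑ᶠ δ : Cosets (parabolicPoints I F),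
      constantTerm I φ (diag F r δ.out * g) * indBigger I p (diag F r δ.out * g)

/-! ### The truncated domains and the moduli spaces -/

/-- The truncated domain `(Z G(F) \ G(𝔸))_p = {g ∈ Z G(F) \ G(𝔸) : Λ_p 𝟏(g) = 1}`, for a subgroup
`Z` of the centre of `G(𝔸)`. -/
def truncatedDomain {F : Type*} [Field F] [NumberField F] {r : ℕ} (p : ℝ → ℝ)
    (Z : Subgroup (GA F r)) : Set (Cosets (Z ⊔ rationalPoints F r)) :=
  {x | ∃ g : GA F r, cls (Z ⊔ rationalPoints F r) g = x ∧ truncation p (fun _ => 1) g = 1}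

/-- The moduli space
`𝓜_{F,r}^{≤ p}[T] = {g ∈ GL_r(F) \ GL_r(𝔸) : deg g = - log T, p̄^g ≤ p}`;
the case of interest is `T = Δ_F^{r/2}`, where `deg g = - (r/2) log Δ_F`. -/
def moduliSpace (F : Type*) [Field F] [NumberField F] (r : ℕ) (p : ℝ → ℝ) (T : ℝ) :
    Set (Cosets (rationalPoints F r)) :=
  {x | ∃ g : GA F r, cls (rationalPoints F r) g = x ∧ degree g = -Real.log T ∧ CanonicalLE p g}

end

end GeoTrunc

/-! Everything is expressed through the function W ↦ deg(E_g ∩ W) on the subspaces of F^r. By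
`arakelovDegree_eq_covolume`, this is a constant times dim W minus the logarithm of the covolume of
the lattice E_g ∩ W in a euclidean space. Two facts about lattices carry the proof. Gram
determinants are log-submodular, so the degree is supermodular (`subDegree_add_le`). By Minkowski's
theorem, a lattice of bounded covolume without short vectors is spanned by bounded vectors
(`exists_bound_span`, `span_bounded_eq`), so only finitely many W have degree above a given bound
(`finite_le_subDegree`).

The height h(W) = deg(E_g ∩ W) - dim W · deg g / r inherits both properties (`isHeight_ht`). The
Harder-Narasimhan argument then applies. A flag built from steps of greatest slope has a concave
polygon lying above every point (dim W, h(W)), hence above every p_Q^g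
(`IsHeight.exists_flag_slopes`). As p is concave, the condition on the canonical polygon becomes
h(W) ≤ p(dim W) for all W (`canonicalLE_iff`).

Constant terms of 1 are 1, because N(F) \ N(𝔸) carries an invariant probability measure
(`constantTerm_one`). The pairs (P, δ) are the chains of proper nonzero subspaces, and the condition
on (P, δ) says that every member of the chain lies in the finite set S of W with h(W) > p(dim W).
Thus Λ_p 1(g) is the sum of (-1)^|C| over the chains C in S, which is 1 if S is empty. Otherwise let
W₀ maximise h - p ∘ dim, which is supermodular because p is concave. Then W ∩ W₀ lies in S for every
W in S (`exists_absorbing`), so the order complex of S is contractible. Concretely, a sign-reversing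
involution on chains makes the sum vanish (`sum_chains_eq_zero`).

A central z changes deg(E_g ∩ W) by dim W · deg z / r (`subDegree_center_mul`), so heights do not
change. On the split component the degree is a nonzero multiple of the logarithm of the parameter,
so each A-orbit contains exactly one point of prescribed degree, depending continuously on the
orbit; this gives the homeomorphism.

For compactness, fixed degree together with h ≤ p excludes short vectors, so E_g contains an F-basis
of bounded vectors. Moving it to the standard basis by some γ in GL_r(F) puts γg in a fixed compact
set (`exists_compact_reduction`). The conditions are closed because E_g is locally constant in g, so
that degrees are continuous (`continuous_subDegree`). -/

namespace GeoTrunc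

/-! ### Gram determinants and geometry of numbers -/

section Gram

open scoped RealInnerProductSpace

variable {E : Type*} [NormedAddCommGroup E] [InnerProductSpace ℝ E]
  {ι κ : Type*} [Fintype ι] [Fintype κ]

open Classical in
/-- The Gram determinant of a finite family of vectors. -/
noncomputable def gramDet (v : ι → E) : ℝ := (Matrix.gram ℝ v).det

theorem gramDet_def [DecidableEq ι] (v : ι → E) : gramDet v = (Matrix.gram ℝ v).det := by
  rw [gramDet]
  congr!

theorem gramDet_nonneg (v : ι → E) : 0 ≤ gramDet v := by
  classical
  rw [gramDet_def]
  exact (Matrix.posSemidef_gram ℝ v).det_nonneg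

theorem gramDet_pos {v : ι → E} (hv : LinearIndependent ℝ v) : 0 < gramDet v := by
  classical
  rw [gramDet_def]
  exact (Matrix.posDef_gram_of_linearIndependent hv).det_pos

variable [DecidableEq ι] [DecidableEq κ]

theorem linearIndependent_of_gramDet_ne_zero {v : ι → E} (h : gramDet v ≠ 0) :
    LinearIndependent ℝ v :=
  Matrix.linearIndependent_of_det_gram_ne_zero (by rwa [← gramDet_def])

omit [DecidableEq ι] [DecidableEq κ] in
theorem gramDet_comp_equiv (e : κ ≃ ι) (v : ι → E) : gramDet (v ∘ e) = gramDet v := by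
  classical
  rw [gramDet_def]
  change ((Matrix.gram ℝ v).submatrix e e).det = _
  rw [Matrix.det_submatrix_equiv_self, gramDet_def]

theorem gramDet_linearCombination (A : Matrix ι ι ℝ) (v : ι → E) :
    gramDet (fun i => ∑ j, A i j • v j) = A.det ^ 2 * gramDet v := by
  have : Matrix.gram ℝ (fun i => ∑ j, A i j • v j) = A * Matrix.gram ℝ v * A.transpose := by
    ext i k
    simp only [Matrix.gram_apply, Matrix.mul_apply, Matrix.transpose_apply, sum_inner, inner_sum,
      inner_smul_left, inner_smul_right, Finset.sum_mul, Finset.mul_sum, conj_trivial]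
    refine Finset.sum_congr rfl fun x _ => Finset.sum_congr rfl fun y _ => by ring
  rw [gramDet_def, this, Matrix.det_mul, Matrix.det_mul, Matrix.det_transpose, gramDet_def]
  ring

/-- Base times height, squared. Writing x as its projection onto the span plus an orthogonal
remainder factors the Gram matrix into a unipotent block matrix and a block triangular one. -/
theorem gramDet_sum_unit (v : ι → E) (x : E) :
    gramDet (Sum.elim v fun _ : Unit => x) =
      Metric.infDist x (Submodule.span ℝ (Set.range v)) ^ 2 * gramDet v := by
  set U := Submodule.span ℝ (Set.range v)
  have : FiniteDimensional ℝ U := FiniteDimensional.span_of_finite ℝ (Set.finite_range v)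
  have hd : Metric.infDist x U = ‖x - U.starProjection x‖ := by
    rw [Submodule.starProjection_minimal, Metric.infDist_eq_iInf]
    simp [dist_eq_norm]
  obtain ⟨c, hc⟩ := (Submodule.mem_span_range_iff_exists_fun ℝ).1
    (U.starProjection_apply_mem x)
  set y := x - U.starProjection x with hy
  have hxy : x = y + ∑ i, c i • v i := by rw [hc, hy]; abel
  have hyv : ∀ i, ⟪y, v i⟫ = 0 := fun i =>
    U.starProjection_inner_eq_zero x _ (Submodule.subset_span ⟨i, rfl⟩)
  have hyx : ⟪y, x⟫ = ‖y‖ ^ 2 := by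
    rw [hxy, inner_add_right, inner_sum]
    simp [inner_smul_right, hyv]
  have hM : Matrix.gram ℝ (Sum.elim v fun _ : Unit => x) =
      Matrix.fromBlocks 1 0 (Matrix.of fun (_ : Unit) i => c i) 1 *
      Matrix.fromBlocks (Matrix.gram ℝ v) (Matrix.of fun i (_ : Unit) => ⟪v i, x⟫) 0
        (Matrix.of fun (_ _ : Unit) => ‖y‖ ^ 2) := by
    rw [Matrix.fromBlocks_multiply]
    ext (i | i) (j | j)
    · simp
    · simp
    · simp only [Matrix.gram_apply, Sum.elim_inl, Sum.elim_inr, Matrix.fromBlocks_apply₂₁]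
      conv_lhs => rw [hxy]
      simp [inner_add_left, hyv, sum_inner, inner_smul_left, Matrix.mul_apply]
    · simp only [Matrix.gram_apply, Sum.elim_inr, Matrix.fromBlocks_apply₂₂]
      nth_rewrite 1 [hxy]
      simp [inner_add_left, hyx, sum_inner, inner_smul_left, Matrix.mul_apply, add_comm]
  rw [gramDet_def, hM, Matrix.det_mul, Matrix.det_fromBlocks_zero₁₂, Matrix.det_fromBlocks_zero₂₁, hd,
    gramDet_def]
  simp [mul_comm]

omit [Fintype ι] in
theorem gramDet_insert (v : ι → E) (S : Finset ι) {i : ι} (hi : i ∉ S) :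
    gramDet (fun j : (insert i S : Finset ι) => v j) =
      Metric.infDist (v i) (Submodule.span ℝ (v '' S)) ^ 2 * gramDet (fun j : S => v j) := by
  let e : S ⊕ Unit ≃ (insert i S : Finset ι) :=
    (Equiv.optionEquivSumPUnit _).symm.trans (Finset.subtypeInsertEquivOption hi).symm
  rw [← gramDet_comp_equiv e]
  have h1 : (fun j : (insert i S : Finset ι) => v j) ∘ e =
      Sum.elim (fun j : S => v j) fun _ => v i := by
    ext (j | j) <;> simp [e, Finset.subtypeInsertEquivOption]
  rw [h1, gramDet_sum_unit]
  congr 5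
  ext y
  simp

omit [Fintype ι] in
-- The distance from v i to a larger span is smaller. This is the inductive step for submodularity.
theorem gramDet_insert_mul_le (v : ι → E) {S T : Finset ι} (hTS : T ⊆ S) {i : ι} (hi : i ∉ S) :
    gramDet (fun j : (insert i S : Finset ι) => v j) * gramDet (fun j : T => v j) ≤
      gramDet (fun j : (insert i T : Finset ι) => v j) * gramDet (fun j : S => v j) := by
  rw [gramDet_insert v S hi, gramDet_insert v T (fun h => hi (hTS h))]
  have : Metric.infDist (v i) (Submodule.span ℝ (v '' S)) ≤
      Metric.infDist (v i) (Submodule.span ℝ (v '' T)) :=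
    Metric.infDist_le_infDist_of_subset
      (Submodule.span_mono (Set.image_mono (Finset.coe_subset.2 hTS))) ⟨0, zero_mem _⟩
  have h2 := pow_le_pow_left₀ Metric.infDist_nonneg this 2
  calc _ = Metric.infDist (v i) (Submodule.span ℝ (v '' S)) ^ 2 *
        (gramDet (fun j : S => v j) * gramDet (fun j : T => v j)) := by ring
    _ ≤ Metric.infDist (v i) (Submodule.span ℝ (v '' T)) ^ 2 *
        (gramDet (fun j : S => v j) * gramDet (fun j : T => v j)) :=
      mul_le_mul_of_nonneg_right h2 (mul_nonneg (gramDet_nonneg _) (gramDet_nonneg _))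
    _ = _ := by ring

omit [Fintype ι] in
/-- The Gram determinant is log-submodular in the index set. -/
theorem gramDet_union_mul_le {v : ι → E} (hv : LinearIndependent ℝ v) (S T R : Finset ι)
    (hTS : T ⊆ S) (hR : Disjoint R S) :
    gramDet (fun j : (R ∪ S : Finset ι) => v j) * gramDet (fun j : T => v j) ≤
      gramDet (fun j : (R ∪ T : Finset ι) => v j) * gramDet (fun j : S => v j) := by
  have hpos : ∀ A : Finset ι, 0 < gramDet (fun j : A => v j) := fun A =>
    gramDet_pos (hv.comp _ Subtype.val_injective)
  induction R using Finset.induction_on with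
  | empty =>
    rw [Finset.empty_union, Finset.empty_union]
    exact (mul_comm _ _).le
  | insert i R hiR ih =>
    rw [Finset.disjoint_insert_left] at hR
    have h1 := ih hR.2
    have h2 := gramDet_insert_mul_le v (S := R ∪ S) (T := R ∪ T)
      (Finset.union_subset_union_right hTS) (i := i) (by simp [hiR, hR.1])
    rw [Finset.insert_union, Finset.insert_union]
    have h3 := mul_le_mul h2 h1 (mul_pos (hpos _) (hpos _)).le
      (mul_pos (hpos _) (hpos _)).le
    have h4 := mul_pos (hpos (R ∪ S)) (hpos (R ∪ T))
    nlinarith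

/-- Minkowski's theorem on linear forms. The preimage of the open cube of half-side R has volume
(2R)^n / |det M|; the factor 2 in `hRn` makes this 2^(n+1), strictly above the threshold 2^n. -/
theorem exists_ne_zero_abs_mulVec_le {n : ℕ} {M : Matrix (Fin n) (Fin n) ℝ} (hM0 : M.det ≠ 0)
    {R : ℝ} (hR0 : 0 < R) (hRn : R ^ n = 2 * |M.det|) :
    ∃ m : Fin n → ℤ, m ≠ 0 ∧ ∀ k, |M.mulVec (fun i => (m i : ℝ)) k| ≤ R := by
  let f : (Fin n → ℝ) →ₗ[ℝ] (Fin n → ℝ) := Matrix.toLin' M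
  have hf : LinearMap.det f = M.det := LinearMap.det_toLin' M
  let s : Set (Fin n → ℝ) := f ⁻¹' (Set.univ.pi fun _ => Set.Ioo (-R) R)
  have hs : volume s = ENNReal.ofReal |M.det⁻¹| * (ENNReal.ofReal (2 * R)) ^ n := by
    rw [Measure.addHaar_preimage_linearMap _ (by rwa [hf]), hf, Real.volume_pi_Ioo]
    simp [two_mul]
  have : Countable (Submodule.span ℤ (Set.range (Pi.basisFun ℝ (Fin n)))).toAddSubgroup :=
    inferInstanceAs (Countable (Submodule.span ℤ (Set.range (Pi.basisFun ℝ (Fin n)))))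
  have hpos : 0 < |M.det| := abs_pos.2 hM0
  have h1 : (Matrix.of ⇑(Pi.basisFun ℝ (Fin n))).det = 1 := by
    rw [← Matrix.det_one (n := Fin n) (R := ℝ)]
    congr 1
    ext i j
    simp [Matrix.one_apply, Pi.single_apply, eq_comm]
  have h3 : |M.det|⁻¹ * (2 ^ n * (2 * |M.det|)) = 2 ^ (n + 1) := by
    field_simp
    ring
  have hvol : volume (ZSpan.fundamentalDomain (Pi.basisFun ℝ (Fin n))) *
      2 ^ Module.finrank ℝ (Fin n → ℝ) < volume s := by
    rw [hs, ZSpan.volume_fundamentalDomain, h1, abs_one, ENNReal.ofReal_one, one_mul,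
      Module.finrank_fin_fun, ← ENNReal.ofReal_pow (by positivity),
      ← ENNReal.ofReal_mul (abs_nonneg _), mul_pow, hRn, abs_inv, h3, ← ENNReal.ofReal_ofNat,
      ← ENNReal.ofReal_pow (by norm_num)]
    exact (ENNReal.ofReal_lt_ofReal_iff (by positivity)).2
      (pow_lt_pow_right₀ (by norm_num) (Nat.lt_succ_self n))
  obtain ⟨x, hx0, hxs⟩ := exists_ne_zero_mem_lattice_of_measure_mul_two_pow_lt_measure
    (μ := volume) (s := s) (ZSpan.isAddFundamentalDomain' (Pi.basisFun ℝ (Fin n)) volume)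
    (fun x hx => by
      simp only [s, Set.mem_preimage, Set.mem_univ_pi, map_neg, Pi.neg_apply, Set.mem_Ioo] at hx ⊢
      exact fun i => ⟨by linarith [(hx i).2], by linarith [(hx i).1]⟩)
    ((convex_pi fun i _ => convex_Ioo _ _).linear_preimage f) hvol
  have hxm : ∀ i, ∃ m : ℤ, (m : ℝ) = (x : Fin n → ℝ) i := by
    intro i
    have h := (Pi.basisFun ℝ (Fin n)).mem_span_iff_repr_mem ℤ (x : Fin n → ℝ)
    simpa using h.1 x.2 i
  choose m hm using hxm
  have hmx : (fun i => (m i : ℝ)) = (x : Fin n → ℝ) := funext hm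
  refine ⟨m, fun h => hx0 ?_, fun k => ?_⟩
  · ext i
    rw [← hm i, h]
    simp
  · have h2 := hxs k (Set.mem_univ k)
    rw [hmx]
    exact abs_le.2 ⟨h2.1.le, h2.2.le⟩

/-- Minkowski's theorem: a lattice of rank `n` and Gram determinant `D` contains a nonzero vector
of norm at most a constant times `D ^ (1 / 2n)`. -/
theorem exists_ne_zero_norm_pow_le {n : ℕ} (hn : 0 < n) {v : Fin n → E}
    (hv : LinearIndependent ℝ v) :
    ∃ m : Fin n → ℤ, m ≠ 0 ∧
      ‖∑ i, (m i : ℝ) • v i‖ ^ n ≤ (n : ℝ) ^ n * (2 * Real.sqrt (gramDet v)) := by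
  set S := Submodule.span ℝ (Set.range v)
  have : FiniteDimensional ℝ S := FiniteDimensional.span_of_finite ℝ (Set.finite_range v)
  have hfr : Module.finrank ℝ S = n := by
    rw [finrank_span_eq_card hv, Fintype.card_fin]
  -- In an orthonormal basis of the real span, the Gram determinant is the square of an ordinary
  -- determinant and the previous lemma applies.
  let b : OrthonormalBasis (Fin n) ℝ S := (stdOrthonormalBasis ℝ S).reindex (finCongr hfr)
  let w : Fin n → S := fun i => ⟨v i, Submodule.subset_span ⟨i, rfl⟩⟩
  let M : Matrix (Fin n) (Fin n) ℝ := Matrix.of fun i j => b.repr (w j) i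
  have hM : M.det ^ 2 = gramDet v := by
    have h1 : Matrix.gram ℝ v = Matrix.gram ℝ w := by
      ext i j
      simp [w]
    rw [gramDet_def, h1, Matrix.gram_eq_conjTranspose_mul b w, Matrix.det_mul,
      Matrix.det_conjTranspose, star_trivial, sq]
  have hMa : |M.det| = Real.sqrt (gramDet v) := by rw [← hM, Real.sqrt_sq_eq_abs]
  have hD : 0 < Real.sqrt (gramDet v) := Real.sqrt_pos.2 (gramDet_pos hv)
  have hM0 : M.det ≠ 0 := by
    intro h
    rw [h, abs_zero] at hMa
    exact hD.ne hMa
  have hnorm : ∀ y : Fin n → ℝ, ‖∑ i, y i • v i‖ ^ 2 = ∑ k, (M.mulVec y k) ^ 2 := by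
    intro y
    have h1 : ∑ i, y i • v i = ((∑ i, y i • w i : S) : E) := by simp [w]
    rw [h1, ← Submodule.coe_norm, ← b.repr.norm_map, EuclideanSpace.norm_sq_eq]
    refine Finset.sum_congr rfl fun k _ => ?_
    simp [Matrix.mulVec, dotProduct, M, mul_comm]
  clear_value M
  have hn0 : (n : ℝ) ≠ 0 := by positivity
  generalize Real.sqrt (gramDet v) = d at hMa hD ⊢
  obtain ⟨R, hR0, hRn⟩ : ∃ R : ℝ, 0 < R ∧ R ^ n = 2 * d :=
    ⟨(2 * d) ^ ((n : ℝ)⁻¹), by positivity, by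
      rw [← Real.rpow_natCast, ← Real.rpow_mul (by positivity), inv_mul_cancel₀ hn0,
        Real.rpow_one]⟩
  obtain ⟨m, hm0, hm⟩ := exists_ne_zero_abs_mulVec_le hM0 hR0 (hRn.trans (by rw [hMa]))
  refine ⟨m, hm0, ?_⟩
  have h1 : ‖∑ i, (m i : ℝ) • v i‖ ^ 2 ≤ (n * R) ^ 2 := by
    rw [hnorm]
    calc _ ≤ ∑ k : Fin n, R ^ 2 := by
          refine Finset.sum_le_sum fun k _ => ?_
          rw [sq_le_sq, abs_of_pos hR0]
          exact hm k
      _ = n * R ^ 2 := by simp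
      _ ≤ (n * R) ^ 2 := by
          rw [mul_pow]
          have : (1 : ℝ) ≤ n := by exact_mod_cast hn
          exact mul_le_mul_of_nonneg_right (by nlinarith) (sq_nonneg R)
  have h2 : ‖∑ i, (m i : ℝ) • v i‖ ≤ n * R :=
    (pow_le_pow_iff_left₀ (norm_nonneg _) (by positivity) two_ne_zero).1 h1
  rw [← hRn, ← mul_pow]
  exact pow_le_pow_left₀ (norm_nonneg _) h2 n

/-- A lattice with bounded Gram determinant and no short vectors is spanned, over `ℝ`, by
vectors of bounded norm. -/
theorem exists_bound_span (n : ℕ) {c : ℝ} (hc : 0 < c) (D : ℝ) : ∃ B : ℝ,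
    ∀ v : Fin n → E, LinearIndependent ℝ v → gramDet v ≤ D →
      (∀ m : Fin n → ℤ, m ≠ 0 → c ≤ ‖∑ i, (m i : ℝ) • v i‖) →
      ∀ i, v i ∈ Submodule.span ℝ
        {x | ∃ m : Fin n → ℤ, x = ∑ i, (m i : ℝ) • v i ∧ ‖x‖ ≤ B} := by
  rcases Nat.eq_zero_or_pos n with rfl | hn
  · exact ⟨0, fun _ _ _ _ i => i.elim0⟩
  set K : ℝ := (n : ℝ) ^ n * (2 * Real.sqrt D) with hK
  have hK0 : 0 ≤ K := by positivity
  -- The summand c gives B ≥ c. The other one is chosen so that c^n B exceeds K c, contradicting the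
  -- inequality c^n ≤ K c / B reached at the end.
  set B : ℝ := c + (K + 1) * c / c ^ n with hB
  have hcB : c ≤ B := by
    rw [hB]
    have : 0 ≤ (K + 1) * c / c ^ n := by positivity
    linarith
  have hB0 : 0 < B := hc.trans_le hcB
  refine ⟨B, fun v hv hD hmin => ?_⟩
  set U := Submodule.span ℝ {x | ∃ m : Fin n → ℤ, x = ∑ i, (m i : ℝ) • v i ∧ ‖x‖ ≤ B} with hU
  -- If the vectors of norm at most B span only U, contract the space by t = B / c along a unit
  -- vector e orthogonal to U. Lattice vectors in U do not move. The others had norm greater than B,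
  -- so they keep norm at least B / t = c. The contracted lattice still has no vector shorter than
  -- c, but its covolume has dropped by the factor t, which contradicts Minkowski's bound.
  by_contra! hex
  obtain ⟨i₀, hi₀⟩ := hex
  set S := Submodule.span ℝ (Set.range v) with hS
  have : FiniteDimensional ℝ S := FiniteDimensional.span_of_finite ℝ (Set.finite_range v)
  have hvS : ∀ i, v i ∈ S := fun i => Submodule.subset_span ⟨i, rfl⟩
  have hUS : U ≤ S := by
    refine Submodule.span_le.2 ?_
    rintro _ ⟨m, rfl, -⟩
    exact Submodule.sum_mem _ fun i _ => S.smul_mem _ (hvS i)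
  have : FiniteDimensional ℝ U := Submodule.finiteDimensional_of_le hUS
  set e₀ := v i₀ - U.starProjection (v i₀) with he₀
  have he₀0 : e₀ ≠ 0 := fun h => hi₀ (by
    rw [sub_eq_zero.1 h]
    exact U.starProjection_apply_mem _)
  have he₀S : e₀ ∈ S := S.sub_mem (hvS _) (hUS (U.starProjection_apply_mem _))
  have he₀U : ∀ u ∈ U, ⟪e₀, u⟫ = 0 := fun u hu => U.starProjection_inner_eq_zero _ u hu
  set e := (‖e₀‖⁻¹ : ℝ) • e₀ with he
  have hen : ‖e‖ = 1 := by
    rw [he, norm_smul, norm_inv, norm_norm, inv_mul_cancel₀ (norm_ne_zero_iff.2 he₀0)]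
  have heS : e ∈ S := S.smul_mem _ he₀S
  have heU : ∀ u ∈ U, ⟪e, u⟫ = 0 := fun u hu => by
    rw [he, inner_smul_left, he₀U u hu, mul_zero]
  obtain ⟨a, ha⟩ := (Submodule.mem_span_range_iff_exists_fun ℝ).1 heS
  set t := B / c with ht
  have ht1 : 1 ≤ t := (one_le_div hc).2 hcB
  have ht0 : 0 < t := one_pos.trans_le ht1
  set κ := 1 - 1 / t with hκ
  set A : Matrix (Fin n) (Fin n) ℝ := 1 - (Matrix.of fun i (_ : Unit) => κ * ⟪e, v i⟫) *
    (Matrix.of fun (_ : Unit) j => a j) with hA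
  set v' : Fin n → E := fun i => v i - (κ * ⟪e, v i⟫) • e with hv'
  have hv'A : v' = fun i => ∑ j, A i j • v j := by
    ext i
    simp only [hv', hA, Matrix.sub_apply, Matrix.mul_apply, Matrix.of_apply, Finset.univ_unique,
      Finset.sum_singleton, sub_smul, Finset.sum_sub_distrib, Matrix.one_apply, ite_smul, one_smul,
      zero_smul, Finset.sum_ite_eq, Finset.mem_univ, if_true]
    rw [Finset.sum_congr rfl fun x _ => mul_smul (κ * ⟪e, v i⟫) (a x) (v x), ← Finset.smul_sum, ha]
  -- The contraction is x ↦ x - κ⟨e, x⟩e, and e is the combination of the v j with coefficients a j.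
  -- So A is a rank one perturbation of 1, with determinant 1 - κ⟨e, e⟩.
  have hdet : A.det = 1 / t := by
    rw [hA, Matrix.det_one_sub_mul_comm, Matrix.det_unique]
    simp only [Matrix.sub_apply, Matrix.one_apply_eq, Matrix.mul_apply, Matrix.of_apply]
    have h1 : ∑ j, a j * (κ * ⟪e, v j⟫) = κ * ⟪e, e⟫ := by
      nth_rewrite 3 [← ha]
      rw [inner_sum, Finset.mul_sum]
      refine Finset.sum_congr rfl fun j _ => ?_
      rw [inner_smul_right]
      ring
    rw [h1, real_inner_self_eq_norm_sq, hen, hκ]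
    ring
  have hgd : gramDet v' = (1 / t) ^ 2 * gramDet v := by
    rw [hv'A, gramDet_linearCombination, hdet]
  have hv'i : LinearIndependent ℝ v' := by
    refine linearIndependent_of_gramDet_ne_zero ?_
    rw [hgd]
    exact (mul_pos (by positivity) (gramDet_pos hv)).ne'
  obtain ⟨m, hm0, hm⟩ := exists_ne_zero_norm_pow_le hn hv'i
  set x := ∑ i, (m i : ℝ) • v i with hx
  have hx' : ∑ i, (m i : ℝ) • v' i = x - (κ * ⟪e, x⟫) • e := by
    simp only [hv', smul_sub, Finset.sum_sub_distrib, hx, inner_sum, inner_smul_right,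
      Finset.mul_sum, Finset.sum_smul, smul_smul]
    congr 1
    refine Finset.sum_congr rfl fun i _ => ?_
    congr 1
    ring
  have hlow : c ≤ ‖∑ i, (m i : ℝ) • v' i‖ := by
    rw [hx']
    rcases le_or_gt ‖x‖ B with h | h
    · rw [heU x (Submodule.subset_span ⟨m, hx, h⟩), mul_zero, zero_smul, sub_zero]
      exact hmin m hm0
    · have h1 : ‖x - (κ * ⟪e, x⟫) • e‖ ^ 2 = ‖x‖ ^ 2 - (1 - (1 / t) ^ 2) * ⟪e, x⟫ ^ 2 := by
        rw [norm_sub_sq_real, inner_smul_right, norm_smul, hen, real_inner_comm, mul_one,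
          Real.norm_eq_abs, sq_abs, hκ]
        ring
      have h2 : ⟪e, x⟫ ^ 2 ≤ ‖x‖ ^ 2 := by
        have := abs_real_inner_le_norm e x
        rw [hen, one_mul] at this
        exact sq_le_sq' (by linarith [neg_abs_le ⟪e, x⟫]) ((le_abs_self _).trans this)
      have h3 : 0 ≤ 1 - (1 / t) ^ 2 := by
        have : 1 / t ≤ 1 := (div_le_one ht0).2 ht1
        have : 0 < 1 / t := by positivity
        nlinarith
      have h4 : (‖x‖ / t) ^ 2 ≤ ‖x - (κ * ⟪e, x⟫) • e‖ ^ 2 := by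
        rw [h1]
        have := mul_le_mul_of_nonneg_left h2 h3
        have h5 : (‖x‖ / t) ^ 2 = (1 / t) ^ 2 * ‖x‖ ^ 2 := by ring
        rw [h5]
        linarith
      have h5 := (pow_le_pow_iff_left₀ (by positivity) (norm_nonneg _) two_ne_zero).1 h4
      have h6 : c = B / t := by
        rw [ht]
        field_simp
      rw [h6]
      exact (div_le_div_of_nonneg_right h.le ht0.le).trans h5
  have h1 := (pow_le_pow_left₀ hc.le hlow n).trans hm
  have h2 : Real.sqrt (gramDet v') ≤ Real.sqrt D / t := by
    rw [hgd, Real.sqrt_mul (sq_nonneg _), Real.sqrt_sq (by positivity), one_div, div_eq_inv_mul]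
    exact mul_le_mul_of_nonneg_left (Real.sqrt_le_sqrt hD) (by positivity)
  have h3 : c ^ n ≤ K * c / B := by
    calc c ^ n ≤ (n : ℝ) ^ n * (2 * Real.sqrt (gramDet v')) := h1
      _ ≤ (n : ℝ) ^ n * (2 * (Real.sqrt D / t)) := by gcongr
      _ = K * c / B := by rw [hK, ht]; field_simp
  rw [le_div_iff₀ hB0] at h3
  have h4 : c ^ n * B = c ^ n * c + (K + 1) * c := by
    rw [hB]
    field_simp
  rw [h4] at h3
  have : 0 < c ^ n * c := by positivity
  nlinarith

end Gram

end GeoTrunc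

namespace GeoTrunc

/-! ### The euclidean lattice of an adelic matrix -/

section Embedding

open scoped RealInnerProductSpace Matrix

variable {F : Type*} [Field F] [NumberField F] {r : ℕ}

/-- The coordinates of `g_v⁻¹ x` at the infinite place `v`. -/
noncomputable def infCoord (g : GA F r) (v : InfinitePlace F) (x : Fin r → F) : Fin r → ℂ :=
  (((infPart g v)⁻¹ : Matrix.GeneralLinearGroup (Fin r) ℂ) :
      Matrix (Fin r) (Fin r) ℂ).mulVec (fun j => v.embedding (x j))

theorem metric_eq (g : GA F r) (v : InfinitePlace F) (x y : Fin r → F) :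
    metric g v x y = ∑ i, star (infCoord g v x i) * infCoord g v y i := rfl

theorem toInfinite_algebraMap (v : InfinitePlace F) (x : F) :
    toInfinite v (algebraMap F (Adele F) x) = v.embedding x :=
  InfinitePlace.Completion.extensionEmbedding_coe v _

theorem star_toInfinite {v : InfinitePlace F} (hv : v.IsReal) (a : Adele F) :
    star (toInfinite v a) = toInfinite v a := by
  change star (InfinitePlace.Completion.extensionEmbedding v (a.1 v)) =
    InfinitePlace.Completion.extensionEmbedding v (a.1 v)
  rw [← InfinitePlace.Completion.extensionEmbeddingOfIsReal_apply hv]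
  exact Complex.conj_ofReal _

theorem infPart_inv_apply (g : GA F r) (v : InfinitePlace F) (i j : Fin r) :
    (((infPart g v)⁻¹ : Matrix.GeneralLinearGroup (Fin r) ℂ) : Matrix (Fin r) (Fin r) ℂ) i j =
      toInfinite v ((g⁻¹ : GA F r).val i j) := by
  rw [infPart, ← map_inv]
  rfl

theorem infCoord_eq_toInfinite (g : GA F r) (v : InfinitePlace F) (x : Fin r → F) (i : Fin r) :
    infCoord g v x i =
      toInfinite v ((g⁻¹ : GA F r).val.mulVec (fun j => algebraMap F (Adele F) (x j)) i) := by
  simp only [infCoord, Matrix.mulVec, dotProduct, map_sum, map_mul, toInfinite_algebraMap]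
  exact Finset.sum_congr rfl fun j _ => by rw [infPart_inv_apply]

theorem star_metric {v : InfinitePlace F} (hv : v.IsReal) (g : GA F r) (x y : Fin r → F) :
    star (metric g v x y) = metric g v x y := by
  rw [metric_eq, star_sum]
  refine Finset.sum_congr rfl fun i _ => ?_
  rw [infCoord_eq_toInfinite, infCoord_eq_toInfinite, star_mul', star_star, star_toInfinite hv,
    star_toInfinite hv]

theorem infCoord_add (g : GA F r) (v : InfinitePlace F) (x y : Fin r → F) :
    infCoord g v (x + y) = infCoord g v x + infCoord g v y := by
  rw [infCoord, infCoord, infCoord, ← Matrix.mulVec_add]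
  congr 1
  ext j
  simp

theorem infCoord_smul (g : GA F r) (v : InfinitePlace F) (c : F) (x : Fin r → F) :
    infCoord g v (c • x) = v.embedding c • infCoord g v x := by
  rw [infCoord, infCoord, ← Matrix.mulVec_smul]
  congr 1
  ext j
  simp

theorem metric_smul_smul (g : GA F r) (v : InfinitePlace F) (c d : F) (x y : Fin r → F) :
    metric g v (c • x) (d • y) = star (v.embedding c) * v.embedding d * metric g v x y := by
  rw [metric_eq, metric_eq, infCoord_smul, infCoord_smul, Finset.mul_sum]
  refine Finset.sum_congr rfl fun i _ => ?_
  simp only [Pi.smul_apply, smul_eq_mul, star_mul']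
  ring

/-- The embedding of `F^r` into a euclidean space given by the hermitian metrics `ρ_g`. -/
noncomputable def euclid (g : GA F r) :
    (Fin r → F) →+ EuclideanSpace ℂ (InfinitePlace F × Fin r) where
  -- With the weight √mult, the squared norm is a sum over all complex embeddings of F. This makes
  -- the covolume produce the multiplicities ε_v of the degree.
  toFun x := WithLp.toLp 2 fun p => (Real.sqrt p.1.mult : ℂ) * infCoord g p.1 x p.2
  map_zero' := by
    ext p
    simp [infCoord, ← Pi.zero_def]
  map_add' x y := by
    ext p
    simp [infCoord_add, mul_add]

theorem inner_euclid (g : GA F r) (x y : Fin r → F) :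
    ⟪euclid g x, euclid g y⟫ = ∑ v : InfinitePlace F, (v.mult : ℝ) * (metric g v x y).re := by
  rw [PiLp.inner_apply, Fintype.sum_prod_type]
  refine Finset.sum_congr rfl fun v _ => ?_
  rw [metric_eq, Complex.re_sum, Finset.mul_sum]
  refine Finset.sum_congr rfl fun i _ => ?_
  have h : (Real.sqrt v.mult : ℂ) * Real.sqrt v.mult = (v.mult : ℝ) := by
    rw [← Complex.ofReal_mul, Real.mul_self_sqrt (by positivity)]
  simp only [euclid, AddMonoidHom.coe_mk, ZeroHom.coe_mk, Complex.inner, map_mul,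
    Complex.conj_ofReal]
  rw [show (Real.sqrt v.mult : ℂ) * infCoord g v y i *
      ((Real.sqrt v.mult : ℂ) * (starRingEnd ℂ) (infCoord g v x i)) =
      ((v.mult : ℝ) : ℂ) * (star (infCoord g v x i) * infCoord g v y i) by
    rw [← h]; simp only [RCLike.star_def]; ring]
  exact Complex.re_ofReal_mul _ _

theorem norm_euclid_sq (g : GA F r) (x : Fin r → F) :
    ‖euclid g x‖ ^ 2 = ∑ v : InfinitePlace F, (v.mult : ℝ) * (metric g v x x).re := by
  rw [← inner_euclid, real_inner_self_eq_norm_sq]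

theorem metric_self (g : GA F r) (v : InfinitePlace F) (x : Fin r → F) :
    metric g v x x = ((∑ i, ‖infCoord g v x i‖ ^ 2 : ℝ) : ℂ) := by
  rw [metric_eq, Complex.ofReal_sum]
  refine Finset.sum_congr rfl fun i _ => ?_
  rw [Complex.ofReal_pow, ← Complex.conj_mul']
  rfl

variable {κ : Type*} [Fintype κ] [DecidableEq κ]

/-- The Gram matrix of a family of vectors at the infinite place `v`. -/
noncomputable def metricMatrix (g : GA F r) (s : κ → Fin r → F) (v : InfinitePlace F) :
    Matrix κ κ ℂ :=
  Matrix.of fun i j => metric g v (s i) (s j)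

omit [Fintype κ] [DecidableEq κ] in
theorem metricMatrix_eq_gram (g : GA F r) (s : κ → Fin r → F) (v : InfinitePlace F) :
    metricMatrix g s v = Matrix.gram ℂ fun i => WithLp.toLp 2 (infCoord g v (s i)) := by
  ext i j
  simp [metricMatrix, metric_eq, PiLp.inner_apply, mul_comm]

omit [Fintype κ] [DecidableEq κ] in
-- Linear independence survives the field extension F → ℂ given by v, and g_v⁻¹ is injective.
theorem linearIndependent_infCoord (g : GA F r) (v : InfinitePlace F) {s : κ → Fin r → F}
    (hs : LinearIndependent F s) : LinearIndependent ℂ fun i => infCoord g v (s i) := by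
  let _ := v.embedding.toAlgebra
  have h1 : LinearIndependent ℂ fun i => algebraMap F ℂ ∘ s i :=
    linearIndependent_algebraMap_comp_iff.2 hs
  have h2 := h1.map' (Matrix.GeneralLinearGroup.toLin (infPart g v)⁻¹).1
    (LinearMap.ker_eq_bot.2 ?_)
  · convert! h2 using 1
  · have h3 : Function.LeftInverse
        (Matrix.GeneralLinearGroup.toLin (infPart g v)).1
        (Matrix.GeneralLinearGroup.toLin (infPart g v)⁻¹).1 := fun x => by
      change ((Matrix.GeneralLinearGroup.toLin (infPart g v)).1 *
        (Matrix.GeneralLinearGroup.toLin (infPart g v)⁻¹).1) x = x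
      rw [← Units.val_mul, ← map_mul, mul_inv_cancel, map_one]
      rfl
    exact h3.injective

theorem det_metricMatrix_ne_zero (g : GA F r) (v : InfinitePlace F) {s : κ → Fin r → F}
    (hs : LinearIndependent F s) : (metricMatrix g s v).det ≠ 0 := by
  rw [metricMatrix_eq_gram, Matrix.det_gram_ne_zero_iff_linearIndependent]
  exact (linearIndependent_infCoord g v hs).map'
    (WithLp.linearEquiv 2 ℂ (Fin r → ℂ)).symm.toLinearMap (LinearEquiv.ker _)

end Embedding

/-! ### Covolumes of free 𝓞_F-lattices -/

section Covolume

open scoped RealInnerProductSpace Matrix Kronecker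

variable (F : Type*) [Field F] [NumberField F]

/-- A `ℤ`-basis of the ring of integers, indexed by the complex embeddings. -/
noncomputable def intBasis (σ : F →+* ℂ) : F := integralBasis F (equivReindex F σ)

theorem linearIndependent_intBasis : LinearIndependent ℚ (intBasis F) :=
  (integralBasis F).linearIndependent.comp _ (equivReindex F).injective

theorem span_range_intBasis : Submodule.span ℚ (Set.range (intBasis F)) = ⊤ := by
  have : Set.range (intBasis F) = Set.range (integralBasis F) :=
    (equivReindex F).surjective.range_comp (integralBasis F)
  rw [this, Module.Basis.span_eq]

theorem mem_span_intBasis {x : F} :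
    x ∈ Submodule.span ℤ (Set.range (intBasis F)) ↔ x ∈ (algebraMap (𝓞 F) F).range := by
  have : Set.range (intBasis F) = Set.range (integralBasis F) :=
    (equivReindex F).surjective.range_comp (integralBasis F)
  rw [this, NumberField.mem_span_integralBasis]

open Classical in
/-- The square of the determinant of the embeddings of an integral basis, i.e. the absolute
discriminant. -/
noncomputable def discConst : ℝ := ‖(basisMatrix F).det‖ ^ 2

theorem discConst_pos : 0 < discConst F := by
  classical
  have := norm_pos_iff.2 (det_of_basisMatrix_non_zero F)
  rw [discConst]
  convert! pow_pos this 2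

variable {F} {r : ℕ} {κ : Type*} [Fintype κ] [DecidableEq κ]

open Classical in
/-- The Gram matrix at the infinite place under `σ`, conjugated if necessary. -/
noncomputable def embMatrix (g : GA F r) (s : κ → Fin r → F) (σ : F →+* ℂ) : Matrix κ κ ℂ :=
  if σ = (InfinitePlace.mk σ).embedding then metricMatrix g s (InfinitePlace.mk σ)
  else (metricMatrix g s (InfinitePlace.mk σ)).map star

theorem norm_det_embMatrix (g : GA F r) (s : κ → Fin r → F) (σ : F →+* ℂ) :
    ‖(embMatrix g s σ).det‖ = ‖(metricMatrix g s (InfinitePlace.mk σ)).det‖ := by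
  rw [embMatrix]
  split_ifs
  · rfl
  · have : (metricMatrix g s (InfinitePlace.mk σ)).map star =
        (starRingEnd ℂ).mapMatrix (metricMatrix g s (InfinitePlace.mk σ)) := rfl
    rw [this, ← RingHom.map_det, RCLike.norm_conj]

open Classical in
-- The embeddings above v are `v.embedding` and its conjugate, which coincide exactly when v is
-- real. This converts sums over embeddings into sums over places with multiplicity.
theorem sum_embedding_fiber (v : InfinitePlace F) (f : (F →+* ℂ) → ℂ)
    (hf : v.IsReal → star (f v.embedding) = f v.embedding)
    (hf' : v.IsComplex → f (ComplexEmbedding.conjugate v.embedding) = star (f v.embedding)) :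
    ∑ σ with InfinitePlace.mk σ = v, f σ = (((v.mult : ℝ) * (f v.embedding).re : ℝ) : ℂ) := by
  have hfil : (Finset.univ.filter fun σ : F →+* ℂ => InfinitePlace.mk σ = v) =
      {v.embedding, ComplexEmbedding.conjugate v.embedding} := by
    ext σ
    simp only [Finset.mem_filter, Finset.mem_univ, true_and, Finset.mem_insert,
      Finset.mem_singleton]
    rw [← InfinitePlace.mk_embedding v, InfinitePlace.mk_eq_iff, InfinitePlace.mk_embedding]
    refine or_congr Iff.rfl ⟨fun h => ?_, fun h => ?_⟩
    · rw [← h, ComplexEmbedding.involutive_conjugate]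
    · rw [h, ComplexEmbedding.involutive_conjugate]
  rw [hfil]
  rcases v.isReal_or_isComplex with hv | hv
  · rw [InfinitePlace.conjugate_embedding_eq_of_isReal hv, Finset.pair_eq_singleton,
      Finset.sum_singleton, hv.mult_eq_one, Nat.cast_one, one_mul]
    exact (Complex.conj_eq_iff_re.1 (hf hv)).symm
  · have hne : v.embedding ≠ ComplexEmbedding.conjugate v.embedding := fun h =>
      (InfinitePlace.isComplex_iff.1 hv) h.symm
    rw [Finset.sum_pair hne, hf' hv, hv.mult_eq_two]
    have := Complex.add_conj (f v.embedding)
    rw [RCLike.star_def, this]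
    simp

/-- The Gram determinant of the `ℤ`-basis `ω_σ s_i` of the lattice `⊕ 𝓞 s_i`. -/
theorem gramDet_intBasis_smul (g : GA F r) (s : κ → Fin r → F) :
    gramDet (fun p : (F →+* ℂ) × κ => euclid g (intBasis F p.1 • s p.2)) =
      discConst F ^ Fintype.card κ *
        ∏ v : InfinitePlace F, ‖(metricMatrix g s v).det‖ ^ v.mult := by
  classical
  let N : Matrix (F →+* ℂ) (F →+* ℂ) ℂ := (basisMatrix F).transpose
  have hN : ∀ σ a, N σ a = σ (intBasis F a) := fun σ a => by
    simp [N, intBasis, canonicalEmbedding.latticeBasis_apply, canonicalEmbedding.apply_at]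
  let P : Matrix ((F →+* ℂ) × κ) ((F →+* ℂ) × κ) ℂ := N ⊗ₖ (1 : Matrix κ κ ℂ)
  let Rb : Matrix ((F →+* ℂ) × κ) ((F →+* ℂ) × κ) ℂ :=
    (Matrix.blockDiagonal (embMatrix g s)).submatrix (Equiv.prodComm _ _) (Equiv.prodComm _ _)
  -- The Gram matrix factors as P* R P, where P holds the embeddings of the integral basis and R is
  -- block diagonal with one hermitian Gram matrix per embedding. Determinants give the discriminant
  -- power and the product over places.
  have hG : (Matrix.gram ℝ fun p : (F →+* ℂ) × κ =>
      euclid g (intBasis F p.1 • s p.2)).map Complex.ofRealHom = P.conjTranspose * Rb * P := by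
    ext ⟨a, i⟩ ⟨b, l⟩
    have hsum : (P.conjTranspose * Rb * P) (a, i) (b, l) =
        ∑ σ, star (σ (intBasis F a)) * σ (intBasis F b) * embMatrix g s σ i l := by
      simp only [Matrix.mul_apply, Fintype.sum_prod_type, Matrix.conjTranspose_apply,
        Finset.sum_mul, P, Rb, Matrix.kroneckerMap_apply, Matrix.submatrix_apply,
        Equiv.prodComm_apply, Prod.swap_prod_mk, Matrix.blockDiagonal_apply, Matrix.one_apply, hN]
      simp only [mul_ite, mul_one, mul_zero, ite_mul, zero_mul, apply_ite star, star_zero,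
        Finset.sum_ite_eq', Finset.mem_univ, if_true, Finset.sum_ite_irrel, Finset.sum_const_zero]
      refine Finset.sum_congr rfl fun σ _ => ?_
      ring
    rw [hsum, Matrix.map_apply, Matrix.gram_apply, inner_euclid, map_sum,
      ← Finset.sum_fiberwise Finset.univ InfinitePlace.mk]
    refine Finset.sum_congr rfl fun v _ => ?_
    have hemb : embMatrix g s v.embedding = metricMatrix g s v := by
      rw [embMatrix, InfinitePlace.mk_embedding, if_pos rfl]
    rw [sum_embedding_fiber v]
    · rw [hemb]
      change (((v.mult : ℝ) * (metric g v _ _).re : ℝ) : ℂ) = _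
      rw [metric_smul_smul]
      rfl
    · intro hv
      have h := star_metric hv g (intBasis F a • s i) (intBasis F b • s l)
      rw [metric_smul_smul] at h
      rw [hemb]
      exact h
    · intro hv
      have hne : ComplexEmbedding.conjugate v.embedding ≠ v.embedding := fun h =>
        (InfinitePlace.isComplex_iff.1 hv) h
      have hemb' : embMatrix g s (ComplexEmbedding.conjugate v.embedding) =
          (metricMatrix g s v).map star := by
        rw [embMatrix, InfinitePlace.mk_conjugate_eq, InfinitePlace.mk_embedding, if_neg hne]
      rw [hemb, hemb']
      simp [ComplexEmbedding.conjugate_coe_eq]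
  have hdet : ((gramDet fun p : (F →+* ℂ) × κ => euclid g (intBasis F p.1 • s p.2) : ℝ) : ℂ) =
      (P.conjTranspose * Rb * P).det := by
    rw [← hG]
    rw [gramDet_def]
    exact RingHom.map_det Complex.ofRealHom _
  have h0 := gramDet_nonneg fun p : (F →+* ℂ) × κ => euclid g (intBasis F p.1 • s p.2)
  have h1 := congrArg norm hdet
  rw [Complex.norm_real, Real.norm_of_nonneg h0] at h1
  rw [h1, Matrix.det_mul, Matrix.det_mul, Matrix.det_conjTranspose, norm_mul, norm_mul, norm_star,
    Matrix.det_kronecker, Matrix.det_one, one_pow, mul_one, Matrix.det_transpose,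
    Matrix.det_submatrix_equiv_self, Matrix.det_blockDiagonal, norm_prod, norm_pow, discConst]
  have h2 : ∏ σ, ‖(embMatrix g s σ).det‖ =
      ∏ v : InfinitePlace F, ‖(metricMatrix g s v).det‖ ^ v.mult := by
    rw [← Finset.prod_fiberwise Finset.univ InfinitePlace.mk]
    refine Finset.prod_congr rfl fun v _ => ?_
    rw [← InfinitePlace.card_filter_mk_eq v, ← Finset.prod_const]
    refine Finset.prod_congr rfl fun σ hσ => ?_
    rw [norm_det_embMatrix, (Finset.mem_filter.1 hσ).2]
  rw [h2]
  have h3 : ∀ D : DecidableEq (F →+* ℂ), @Matrix.det _ D _ _ _ (basisMatrix F) =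
      (basisMatrix F).det := fun D => by congr!
  rw [← pow_mul, h3]
  ring

end Covolume

end GeoTrunc

namespace GeoTrunc

/-! ### The degree as the logarithm of a covolume -/

section Degree

/-- The two bases differ by an integral matrix whose determinant is, up to sign, the index. -/
theorem gramDet_eq_relIndex_sq_mul {V E : Type*} [AddCommGroup V] [NormedAddCommGroup E]
    [InnerProductSpace ℝ E] (j : V →+ E) {ι : Type*} [Fintype ι] {β β' : ι → V}
    (hβ : LinearIndependent ℤ β) (hβ' : LinearIndependent ℤ β')
    (h : Submodule.span ℤ (Set.range β') ≤ Submodule.span ℤ (Set.range β)) :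
    gramDet (fun i => j (β' i)) =
      ((Submodule.span ℤ (Set.range β')).toAddSubgroup.relIndex
        (Submodule.span ℤ (Set.range β)).toAddSubgroup : ℝ) ^ 2 * gramDet (fun i => j (β i)) := by
  classical
  let b := Module.Basis.span hβ
  have hmem : ∀ i, β' i ∈ Submodule.span ℤ (Set.range β) := fun i =>
    h (Submodule.subset_span ⟨i, rfl⟩)
  let A : Matrix ι ι ℤ := Matrix.of fun i k => b.repr ⟨β' i, hmem i⟩ k
  have hA : ∀ i, β' i = ∑ k, A i k • β k := fun i => by
    have h1 := congrArg Subtype.val (b.sum_repr ⟨β' i, hmem i⟩)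
    refine h1.symm.trans ?_
    rw [Submodule.coe_sum]
    refine Finset.sum_congr rfl fun k _ => ?_
    rw [Submodule.coe_smul, Module.Basis.coe_span_apply]
    rfl
  have hidx : (Submodule.span ℤ (Set.range β')).toAddSubgroup.relIndex
      (Submodule.span ℤ (Set.range β)).toAddSubgroup = A.det.natAbs := by
    have hdet : b.det (fun i => ⟨β' i, hmem i⟩) = A.det := by
      rw [Module.Basis.det_apply, ← Matrix.det_transpose]
      rfl
    refine (AddSubgroup.relIndex_eq_natAbs_det (Submodule.span ℤ (Set.range β')).toAddSubgroup
      (Submodule.span ℤ (Set.range β)).toAddSubgroup h (Module.Basis.span hβ') b).trans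
      (congrArg Int.natAbs (Eq.trans ?_ hdet))
    exact congrArg b.det (funext fun i => Subtype.ext (Module.Basis.coe_span_apply hβ' i))
  have h2 : (fun i => j (β' i)) =
      fun i => ∑ k, (A.map (Int.castRingHom ℝ)) i k • j (β k) := by
    ext1 i
    rw [hA i, map_sum]
    refine Finset.sum_congr rfl fun k _ => ?_
    rw [map_zsmul, Matrix.map_apply, eq_intCast, Int.cast_smul_eq_zsmul]
  rw [h2, gramDet_linearCombination, hidx, ← RingHom.mapMatrix_apply, ← RingHom.map_det]
  simp [Nat.cast_natAbs]

variable {F : Type*} [Field F] [NumberField F] {r : ℕ}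

/-- `β` is a `ℤ`-basis of the lattice `L`. -/
def IsIntBasis {ι : Type*} (β : ι → Fin r → F) (L : Submodule (𝓞 F) (Fin r → F)) : Prop :=
  LinearIndependent ℤ β ∧ Submodule.span ℤ (Set.range β) = L.restrictScalars ℤ

theorem isIntBasis_smul {κ : Type*} {s : κ → Fin r → F} (hs : LinearIndependent F s) :
    IsIntBasis (fun p : (F →+* ℂ) × κ => intBasis F p.1 • s p.2)
      (Submodule.span (𝓞 F) (Set.range s)) := by
  constructor
  · rw [LinearIndependent.iff_fractionRing ℤ ℚ]
    exact linearIndependent_smul (linearIndependent_intBasis F) hs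
  · let ω : (F →+* ℂ) → 𝓞 F := fun σ => RingOfIntegers.basis F (equivReindex F σ)
    have hω : ∀ σ, (ω σ : F) = intBasis F σ := fun σ => by
      rw [intBasis, integralBasis_apply]
    have hspan : Submodule.span ℤ (Set.range ω) = ⊤ := by
      have : Set.range ω = Set.range (RingOfIntegers.basis F) :=
        (equivReindex F).surjective.range_comp (RingOfIntegers.basis F)
      rw [this, Module.Basis.span_eq]
    rw [← Submodule.span_smul_of_span_eq_top hspan]
    congr 1
    ext x
    simp only [Set.mem_range, Prod.exists, Set.mem_smul, exists_exists_eq_and]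
    refine exists_congr fun σ => exists_congr fun i => ?_
    rw [← hω, ← algebraMap_smul F (ω σ) (s i)]

/-- Since L is stable under 𝓞_F, which spans F over ℚ, the ℚ-span of L is already its F-span. -/
theorem IsIntBasis.finrank_eq_card {ι : Type*} [Fintype ι] {β : ι → Fin r → F}
    {L : Submodule (𝓞 F) (Fin r → F)} (hβ : IsIntBasis β L) :
    Fintype.card ι = Module.finrank ℚ (Submodule.span F (L : Set (Fin r → F))) := by
  have h1 : LinearIndependent ℚ β := (LinearIndependent.iff_fractionRing ℤ ℚ).1 hβ.1
  rw [← finrank_span_eq_card h1]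
  have h2 : Submodule.span ℚ (Set.range β) =
      (Submodule.span F (L : Set (Fin r → F))).restrictScalars ℚ := by
    apply le_antisymm
    · rw [Submodule.span_le]
      rintro _ ⟨i, rfl⟩
      refine Submodule.subset_span ?_
      have : β i ∈ L.restrictScalars ℤ := hβ.2 ▸ Submodule.subset_span ⟨i, rfl⟩
      exact this
    · have hL : ∀ x ∈ L, x ∈ Submodule.span ℚ (Set.range β) := fun x hx => by
        have : x ∈ Submodule.span ℤ (Set.range β) := by rw [hβ.2]; exact hx
        exact Submodule.span_le_restrictScalars ℤ ℚ _ this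
      have h3 := Submodule.span_smul_of_span_eq_top (span_range_intBasis F)
        (L : Set (Fin r → F))
      rw [← h3, Submodule.span_le]
      rintro _ ⟨_, ⟨σ, rfl⟩, x, hx, rfl⟩
      obtain ⟨c, hc⟩ := (mem_span_intBasis F).1 (Submodule.subset_span ⟨σ, rfl⟩)
      refine hL _ ?_
      change intBasis F σ • x ∈ L
      rw [← hc, algebraMap_smul]
      exact L.smul_mem c hx
  rw [h2]
  rfl

theorem exists_isIntBasis {L : Submodule (𝓞 F) (Fin r → F)} (hL : L.FG) {ι : Type*} [Fintype ι]
    (hι : Fintype.card ι = Module.finrank ℚ (Submodule.span F (L : Set (Fin r → F)))) :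
    ∃ β : ι → Fin r → F, IsIntBasis β L := by
  have h1 : Module.Finite (𝓞 F) L := Module.Finite.iff_fg.2 hL
  have h2 : Module.Finite ℤ (L.restrictScalars ℤ) :=
    (Module.Finite.trans (𝓞 F) L : Module.Finite ℤ L)
  have h3 : Module.Free ℤ (L.restrictScalars ℤ) := Module.free_of_finite_type_torsion_free'
  let b := Module.Free.chooseBasis ℤ (L.restrictScalars ℤ)
  have hb : IsIntBasis (fun i => (b i : Fin r → F)) L := by
    constructor
    · exact b.linearIndependent.map' (L.restrictScalars ℤ).subtype (Submodule.ker_subtype _)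
    · have h4 := congrArg (Submodule.map (L.restrictScalars ℤ).subtype) b.span_eq
      rw [Submodule.map_top, Submodule.range_subtype, Submodule.map_span, ← Set.range_comp] at h4
      exact h4
  have e : ι ≃ Module.Free.ChooseBasisIndex ℤ (L.restrictScalars ℤ) :=
    Fintype.equivOfCardEq (hι.trans hb.finrank_eq_card.symm)
  refine ⟨fun i => b (e i), hb.1.comp e e.injective, ?_⟩
  exact (congrArg (Submodule.span ℤ)
    (e.surjective.range_comp fun i => (b i : Fin r → F))).trans hb.2

theorem finrank_rat_eq (W : Submodule F (Fin r → F)) :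
    Module.finrank ℚ W = Fintype.card (F →+* ℂ) * Module.finrank F W := by
  rw [Embeddings.card F ℂ, Module.finrank_mul_finrank]

omit [NumberField F] in
theorem relIndex_eq_of_span {L : Submodule (𝓞 F) (Fin r → F)} {M : Submodule (𝓞 F) (Fin r → F)}
    {N N' : Submodule ℤ (Fin r → F)} (h : N = L.restrictScalars ℤ)
    (h' : N' = M.restrictScalars ℤ) :
    N'.toAddSubgroup.relIndex N.toAddSubgroup =
      M.toAddSubgroup.relIndex L.toAddSubgroup := by
  rw [h, h']
  rfl

/-- All later statements on real linear independence under `euclid` rest on this positivity, which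
comes from the explicit determinant. -/
theorem IsIntBasis.linearIndependent_euclid {κ : Type*} [Fintype κ] {s : κ → Fin r → F}
    (g : GA F r) (hs : LinearIndependent F s) :
    0 < gramDet (fun p : (F →+* ℂ) × κ => euclid g (intBasis F p.1 • s p.2)) := by
  classical
  rw [gramDet_intBasis_smul]
  exact mul_pos (pow_pos (discConst_pos F) _) (Finset.prod_pos fun v _ =>
    pow_pos (norm_pos_iff.2 (det_metricMatrix_ne_zero g v hs)) _)

/-- The degree does not depend on the maximal family: it is given by the covolume. -/
theorem log_relIndex_sub {L : Submodule (𝓞 F) (Fin r → F)} {κ : Type*} [Fintype κ]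
    [DecidableEq κ] {s : κ → Fin r → F} (g : GA F r) (hs : LinearIndependent F s)
    (hsL : ∀ i, s i ∈ L) (hspan : Submodule.span F (Set.range s) = Submodule.span F L)
    {ι : Type*} [Fintype ι] {β : ι → Fin r → F} (hβ : IsIntBasis β L) :
    0 < gramDet (fun i => euclid g (β i)) ∧
    (Submodule.span (𝓞 F) (Set.range s)).toAddSubgroup.relIndex L.toAddSubgroup ≠ 0 ∧
    Real.log ((Submodule.span (𝓞 F) (Set.range s)).toAddSubgroup.relIndex L.toAddSubgroup : ℝ)
      - ∑ v : InfinitePlace F, (v.mult : ℝ) * (1 / 2 * Real.log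
        ‖(Matrix.of fun i j => metric g v (s i) (s j)).det‖) =
    1 / 2 * (Fintype.card κ * Real.log (discConst F)) -
      1 / 2 * Real.log (gramDet fun i => euclid g (β i)) := by
  have hω := isIntBasis_smul hs
  have hcard : Fintype.card ι = Fintype.card ((F →+* ℂ) × κ) := by
    rw [hβ.finrank_eq_card, ← hspan, finrank_rat_eq, finrank_span_eq_card hs, Fintype.card_prod]
  let e : ((F →+* ℂ) × κ) ≃ ι := Fintype.equivOfCardEq hcard.symm
  have hβe : IsIntBasis (β ∘ e) L := by
    refine ⟨hβ.1.comp e e.injective, ?_⟩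
    rw [e.surjective.range_comp, hβ.2]
  have hle : Submodule.span ℤ (Set.range fun p : (F →+* ℂ) × κ => intBasis F p.1 • s p.2) ≤
      Submodule.span ℤ (Set.range (β ∘ e)) := by
    rw [hω.2, hβe.2]
    have : Submodule.span (𝓞 F) (Set.range s) ≤ L := by
      rw [Submodule.span_le]
      rintro _ ⟨i, rfl⟩
      exact hsL i
    exact this
  have h1 := gramDet_eq_relIndex_sq_mul (euclid g) hβe.1 hω.1 hle
  rw [relIndex_eq_of_span hβe.2 hω.2,
    show (fun i => euclid g ((β ∘ e) i)) = (fun i => euclid g (β i)) ∘ e from rfl,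
    gramDet_comp_equiv] at h1
  have hpos := IsIntBasis.linearIndependent_euclid g hs
  have hpos' := hpos
  -- A positive product has nonzero factors. Since `relIndex` is 0 for infinite index, this also
  -- shows that the index is finite.
  rw [h1] at hpos'
  have hg0 : gramDet (fun i => euclid g (β i)) ≠ 0 := fun h => by simp [h] at hpos'
  have hi0 : (Submodule.span (𝓞 F) (Set.range s)).toAddSubgroup.relIndex L.toAddSubgroup ≠ 0 :=
    fun h => by simp [h] at hpos'
  have hi0' : ((Submodule.span (𝓞 F) (Set.range s)).toAddSubgroup.relIndex L.toAddSubgroup : ℝ)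
    ≠ 0 := by exact_mod_cast hi0
  refine ⟨(gramDet_nonneg _).lt_of_ne' hg0, hi0, ?_⟩
  rw [gramDet_intBasis_smul] at h1
  have h2 := congrArg Real.log h1
  have hne : ∀ v : InfinitePlace F, ‖(metricMatrix g s v).det‖ ^ v.mult ≠ 0 := fun v =>
    pow_ne_zero _ (norm_ne_zero_iff.2 (det_metricMatrix_ne_zero g v hs))
  rw [Real.log_mul (pow_ne_zero _ (discConst_pos F).ne') (Finset.prod_ne_zero_iff.2 fun v _ =>
    hne v), Real.log_mul (pow_ne_zero _ hi0') hg0, Real.log_pow, Real.log_pow,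
    Real.log_prod fun v _ => hne v] at h2
  simp only [Real.log_pow] at h2
  have h3 : ∑ v : InfinitePlace F, (v.mult : ℝ) * (1 / 2 * Real.log
        ‖(Matrix.of fun i j => metric g v (s i) (s j)).det‖) =
      1 / 2 * ∑ v : InfinitePlace F, (v.mult : ℝ) * Real.log ‖(metricMatrix g s v).det‖ := by
    rw [Finset.mul_sum]
    refine Finset.sum_congr rfl fun v _ => ?_
    rw [metricMatrix]
    ring
  rw [h3]
  push_cast at h2
  linarith

theorem maxFamily_spec (L : Submodule (𝓞 F) (Fin r → F)) :
    (∀ i, maxFamily L i ∈ L) ∧ Submodule.span F (Set.range (maxFamily L)) = Submodule.span F L ∧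
      LinearIndependent F (maxFamily L) :=
  (Submodule.exists_fun_fin_finrank_span_eq F (L : Set (Fin r → F))).choose_spec

theorem arakelovDegree_eq_covolume {L : Submodule (𝓞 F) (Fin r → F)} (g : GA F r)
    {ι : Type*} [Fintype ι] {β : ι → Fin r → F} (hβ : IsIntBasis β L) :
    0 < gramDet (fun i => euclid g (β i)) ∧ arakelovDegree L (metric g) =
      1 / 2 * (Module.finrank F (Submodule.span F (L : Set (Fin r → F))) *
        Real.log (discConst F)) - 1 / 2 * Real.log (gramDet fun i => euclid g (β i)) := by
  obtain ⟨h1, h2, h3⟩ := maxFamily_spec L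
  obtain ⟨h4, -, h5⟩ := log_relIndex_sub g h3 h1 h2 hβ
  refine ⟨h4, ?_⟩
  rw [arakelovDegree, h5, Fintype.card_fin]

theorem arakelovDegree_eq_family {L : Submodule (𝓞 F) (Fin r → F)} (hL : L.FG) (g : GA F r)
    {κ : Type*} [Fintype κ] [DecidableEq κ] {s : κ → Fin r → F}
    (hs : LinearIndependent F s) (hsL : ∀ i, s i ∈ L)
    (hspan : Submodule.span F (Set.range s) = Submodule.span F L) :
    (Submodule.span (𝓞 F) (Set.range s)).toAddSubgroup.relIndex L.toAddSubgroup ≠ 0 ∧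
    arakelovDegree L (metric g) =
    Real.log ((Submodule.span (𝓞 F) (Set.range s)).toAddSubgroup.relIndex L.toAddSubgroup : ℝ)
      - ∑ v : InfinitePlace F, (v.mult : ℝ) * (1 / 2 * Real.log ‖(metricMatrix g s v).det‖) := by
  obtain ⟨β, hβ⟩ := exists_isIntBasis hL
    (ι := Fin (Module.finrank ℚ (Submodule.span F (L : Set (Fin r → F))))) (by simp)
  obtain ⟨-, h1, h2⟩ := log_relIndex_sub g hs hsL hspan hβ
  refine ⟨h1, ?_⟩
  have h3 : Module.finrank F (Submodule.span F (L : Set (Fin r → F))) = Fintype.card κ := by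
    rw [← hspan, finrank_span_eq_card hs]
  rw [(arakelovDegree_eq_covolume g hβ).2, h3]
  exact h2.symm

end Degree

end GeoTrunc

namespace GeoTrunc

/-! ### Finite adeles: denominators and strong approximation -/

section FiniteAdeles

variable (F : Type*) [Field F] [NumberField F]

/-- The ring of finite adeles. -/
abbrev FinAdele : Type _ := FiniteAdeleRing (𝓞 F) F

/-- The subring of finite adeles that are integral at all finite places. -/
noncomputable def finInt : Subring (FinAdele F) where
  carrier := {a | ∀ v : HeightOneSpectrum (𝓞 F), a v ∈ v.adicCompletionIntegers F}
  mul_mem' ha hb v := mul_mem (ha v) (hb v)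
  one_mem' v := one_mem (v.adicCompletionIntegers F)
  add_mem' ha hb v := add_mem (ha v) (hb v)
  zero_mem' v := zero_mem (v.adicCompletionIntegers F)
  neg_mem' ha v := neg_mem (ha v)

variable {F}

omit [NumberField F] in
theorem coe_integer_mul (x y : 𝓞 F) : ((x * y : 𝓞 F) : F) = x * y := map_mul (algebraMap _ _) x y

theorem coe_local_sub (v : HeightOneSpectrum (𝓞 F)) (x y : F) :
    ((x - y : F) : v.adicCompletion F) = (x : v.adicCompletion F) - (y : v.adicCompletion F) :=
  map_sub (algebraMap F (v.adicCompletion F)) x y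

theorem algebraMap_mem_finInt {x : F} :
    algebraMap F (FinAdele F) x ∈ finInt F ↔ x ∈ (algebraMap (𝓞 F) F).range := by
  constructor
  · intro h
    refine HeightOneSpectrum.mem_integers_of_valuation_le_one (R := 𝓞 F) F x fun v => ?_
    have := h v
    rw [HeightOneSpectrum.mem_adicCompletionIntegers] at this
    rwa [← HeightOneSpectrum.valuedAdicCompletion_eq_valuation']
  · rintro ⟨y, rfl⟩ v
    exact HeightOneSpectrum.coe_mem_adicCompletionIntegers v y

theorem coe_mem_finInt (n : 𝓞 F) : algebraMap F (FinAdele F) (n : F) ∈ finInt F :=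
  algebraMap_mem_finInt.2 ⟨n, rfl⟩

theorem algebraMap_mul_inv {x : F} (hx : x ≠ 0) :
    algebraMap F (FinAdele F) x * algebraMap F (FinAdele F) x⁻¹ = 1 := by
  rw [← map_mul, mul_inv_cancel₀ hx, map_one]

theorem exists_den (a : FinAdele F) :
    ∃ n : 𝓞 F, n ≠ 0 ∧ algebraMap F (FinAdele F) (n : F) * a ∈ finInt F := by
  classical
  have hfin : {v : HeightOneSpectrum (𝓞 F) | a v ∉ v.adicCompletionIntegers F}.Finite := a.2
  choose b hb hb' using fun v : HeightOneSpectrum (𝓞 F) =>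
    HeightOneSpectrum.adicCompletion.mul_nonZeroDivisor_mem_adicCompletionIntegers v (a v)
  refine ⟨∏ v ∈ hfin.toFinset, b v, Finset.prod_ne_zero_iff.2 fun v _ =>
    nonZeroDivisors.ne_zero (hb v), fun v => ?_⟩
  by_cases hv : a v ∈ v.adicCompletionIntegers F
  · exact mul_mem (coe_mem_finInt _ v) hv
  · have h1 : v ∈ hfin.toFinset := hfin.mem_toFinset.2 hv
    rw [← Finset.prod_erase_mul _ _ h1, coe_integer_mul, map_mul, mul_assoc]
    refine mul_mem (coe_mem_finInt _ v) ?_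
    rw [mul_comm]
    exact hb' v

theorem exists_den_family {ι : Type*} [Finite ι] (a : ι → FinAdele F) :
    ∃ n : 𝓞 F, n ≠ 0 ∧ ∀ i, algebraMap F (FinAdele F) (n : F) * a i ∈ finInt F := by
  classical
  have := Fintype.ofFinite ι
  choose n hn hn' using fun i => exists_den (a i)
  refine ⟨∏ i, n i, Finset.prod_ne_zero_iff.2 fun i _ => hn i, fun i => ?_⟩
  rw [← Finset.prod_erase_mul _ _ (Finset.mem_univ i), coe_integer_mul, map_mul, mul_assoc]
  exact mul_mem (coe_mem_finInt _) (hn' i)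

/-- F is dense in the completion. An element z of F close to a is v-integral because a is, and z is
then congruent to an element of 𝓞_F modulo a power of v. -/
theorem exists_local_approx (v : HeightOneSpectrum (𝓞 F)) {a : v.adicCompletion F}
    (ha : a ∈ v.adicCompletionIntegers F) {n : 𝓞 F} (hn : n ≠ 0) : ∃ y : 𝓞 F,
      Valued.v (((y : F) : v.adicCompletion F) - a) ≤ v.valuation F (n : F) := by
  have hval : v.valuation F (n : F) ≠ 0 := by
    rw [Valuation.ne_zero_iff]
    exact_mod_cast hn
  let γ : (WithZero (Multiplicative ℤ))ˣ := Units.mk0 _ (hval)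
  have hopen : IsOpen {z : v.adicCompletion F |
      (((n : F)⁻¹ : F) : v.adicCompletion F) * (z - a) ∈ v.adicCompletionIntegers F} :=
    (Valued.isOpen_valuationSubring (v.adicCompletion F)).preimage
      (continuous_const.mul (continuous_sub_right (a)))
  obtain ⟨z, hz⟩ := (HeightOneSpectrum.denseRange_algebraMap (R := 𝓞 F) F v).exists_mem_open
    hopen ⟨a, by simp⟩
  have hz : Valued.v ((z : v.adicCompletion F) - a) ≤ v.valuation F (n : F) := by
    have h1 : Valued.v ((((n : F)⁻¹ : F) : v.adicCompletion F) *
      ((z : v.adicCompletion F) - a)) ≤ 1 := hz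
    rwa [map_mul, HeightOneSpectrum.valuedAdicCompletion_eq_valuation', map_inv₀,
      inv_mul_le_one₀ (zero_lt_iff.2 (hval))] at h1
  have hz1 : v.valuation F z ≤ 1 := by
    rw [← HeightOneSpectrum.valuedAdicCompletion_eq_valuation' (R := 𝓞 F)]
    have h1 := add_mem (show ((z : v.adicCompletion F) - a) ∈ v.adicCompletionIntegers F from
      (HeightOneSpectrum.mem_adicCompletionIntegers (𝓞 F) F v).2
        (hz.trans (v.valuation_le_one n))) ha
    rw [sub_add_cancel] at h1
    exact (HeightOneSpectrum.mem_adicCompletionIntegers (𝓞 F) F v).1 h1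
  obtain ⟨y, hy⟩ := v.exists_valuation_sub_lt_of_integer hz1 γ
  refine ⟨y, ?_⟩
  have h2 : ((y : F) : v.adicCompletion F) - a =
      (((y : F) - z : F) : v.adicCompletion F) + ((z : v.adicCompletion F) - a) := by
    rw [coe_local_sub]
    abel
  rw [h2]
  refine (Valuation.map_add _ _ _).trans (max_le ?_ hz)
  rw [HeightOneSpectrum.valuedAdicCompletion_eq_valuation']
  exact hy.le

/-- Only the finitely many places dividing n impose a condition beyond integrality, and there the
local approximations are combined by the Chinese remainder theorem. -/
theorem exists_approx_integral {a : FinAdele F} (ha : a ∈ finInt F) {n : 𝓞 F} (hn : n ≠ 0) :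
    ∃ x : 𝓞 F, algebraMap F (FinAdele F) (n : F)⁻¹ * (algebraMap F (FinAdele F) (x : F) - a) ∈
      finInt F := by
  classical
  have hval : ∀ v : HeightOneSpectrum (𝓞 F), v.valuation F (n : F) ≠ 0 := fun v => by
    rw [Valuation.ne_zero_iff]
    exact_mod_cast hn
  choose y hy using fun v => exists_local_approx v (ha v) hn
  have hfin : {v : HeightOneSpectrum (𝓞 F) | v.valuation F (n : F) < 1}.Finite := by
    have h1 := HeightOneSpectrum.Support.finite (𝓞 F) ((n : F)⁻¹)
    refine h1.subset fun v hv => ?_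
    rw [Set.mem_ofPred_eq] at hv
    rw [HeightOneSpectrum.Support, Set.mem_ofPred_eq, map_inv₀]
    exact (one_lt_inv₀ (zero_lt_iff.2 (hval v))).2 hv
  have hpow : ∀ v : HeightOneSpectrum (𝓞 F), ∃ e : ℕ, ∀ z : 𝓞 F, z ∈ v.asIdeal ^ e →
      v.valuation F (z : F) ≤ v.valuation F (n : F) := by
    intro v
    rw [v.valuation_of_algebraMap, v.intValuation_if_neg hn]
    refine ⟨(Associates.mk v.asIdeal).count (Associates.mk (Ideal.span {n})).factors,
      fun z hz => ?_⟩
    rw [v.valuation_of_algebraMap]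
    exact (v.intValuation_le_pow_iff_mem _ _).2 hz
  choose e he using hpow
  obtain ⟨x, hx⟩ := exists_forall_sub_mem_ideal (s := hfin.toFinset) (fun v => v.asIdeal) e
    (fun v _ => v.prime) (fun v _ w _ hvw h => hvw (HeightOneSpectrum.ext h)) (fun v => y v.1)
  refine ⟨x, fun v => ?_⟩
  have hmem : Valued.v (((x : F) : v.adicCompletion F) - a v) ≤ v.valuation F (n : F) := by
    by_cases hv : v.valuation F (n : F) < 1
    · have h2 : ((x : F) : v.adicCompletion F) - a v =
          (((x - y v : 𝓞 F) : F) : v.adicCompletion F) + (((y v : F) : v.adicCompletion F) - a v) := by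
        have h3 : ((x - y v : 𝓞 F) : F) = x - y v := map_sub (algebraMap _ _) x (y v)
        rw [h3, coe_local_sub]
        abel
      rw [h2]
      refine (Valuation.map_add _ _ _).trans (max_le ?_ (hy v))
      rw [HeightOneSpectrum.valuedAdicCompletion_eq_valuation']
      exact he v _ (hx v (hfin.mem_toFinset.2 hv))
    · have h1 : v.valuation F (n : F) = 1 := le_antisymm (v.valuation_le_one n) (not_lt.1 hv)
      rw [h1]
      exact (HeightOneSpectrum.mem_adicCompletionIntegers (𝓞 F) F v).1
        (sub_mem (coe_mem_finInt x v) (ha v))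
  rw [HeightOneSpectrum.mem_adicCompletionIntegers]
  change Valued.v (((n : F)⁻¹ : F) * (((x : F) : v.adicCompletion F) - a v)) ≤ 1
  rw [map_mul, HeightOneSpectrum.valuedAdicCompletion_eq_valuation', map_inv₀]
  exact inv_mul_le_one_of_le₀ hmem zero_le

/-- With m a denominator of a, approximate ma modulo mn by an integer and divide by m. -/
theorem exists_approx (a : FinAdele F) {n : 𝓞 F} (hn : n ≠ 0) :
    ∃ x : F, algebraMap F (FinAdele F) (n : F)⁻¹ * (algebraMap F (FinAdele F) x - a) ∈
      finInt F := by
  obtain ⟨m, hm, hma⟩ := exists_den a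
  obtain ⟨x, hx⟩ := exists_approx_integral hma (mul_ne_zero hm hn)
  have hm' : (m : F) ≠ 0 := by exact_mod_cast hm
  refine ⟨(m : F)⁻¹ * x, ?_⟩
  convert! hx using 1
  have h := algebraMap_mul_inv hm'
  rw [coe_integer_mul, mul_inv, map_mul, map_mul]
  linear_combination (algebraMap F (FinAdele F) (n : F)⁻¹ * a) * h

end FiniteAdeles

end GeoTrunc

namespace GeoTrunc

/-! ### The lattice E_g and its sublattices E_g ∩ W -/

section Sheaf

variable {F : Type*} [Field F] [NumberField F] {r : ℕ}

/-- The coordinates `g_f⁻¹ x` of a rational vector. -/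
noncomputable def finCoord (g : GA F r) (x : Fin r → F) : Fin r → FinAdele F :=
  (((finPart g)⁻¹ : Matrix.GeneralLinearGroup (Fin r) (FinAdele F)) :
    Matrix (Fin r) (Fin r) (FinAdele F)).mulVec (fun j => algebraMap F (FinAdele F) (x j))

theorem mem_sheaf {g : GA F r} {x : Fin r → F} :
    x ∈ sheaf g ↔ ∀ i, finCoord g x i ∈ finInt F := Iff.rfl

theorem finCoord_smul (g : GA F r) (c : F) (x : Fin r → F) :
    finCoord g (c • x) = algebraMap F (FinAdele F) c • finCoord g x := by
  rw [finCoord, finCoord, ← Matrix.mulVec_smul]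
  congr 1
  ext1 j
  simp

theorem finCoord_mul (g h : GA F r) (x : Fin r → F) :
    finCoord (g * h) x = (((finPart h)⁻¹ : Matrix.GeneralLinearGroup (Fin r) (FinAdele F)) :
      Matrix (Fin r) (Fin r) (FinAdele F)).mulVec (finCoord g x) := by
  have h1 : finPart (g * h) = finPart g * finPart h := map_mul _ _ _
  rw [finCoord, finCoord, h1, mul_inv_rev, Units.val_mul, Matrix.mulVec_mulVec]

theorem infCoord_mul (g h : GA F r) (v : InfinitePlace F) (x : Fin r → F) :
    infCoord (g * h) v x = (((infPart h v)⁻¹ : Matrix.GeneralLinearGroup (Fin r) ℂ) :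
      Matrix (Fin r) (Fin r) ℂ).mulVec (infCoord g v x) := by
  have h1 : infPart (g * h) v = infPart g v * infPart h v := map_mul _ _ _
  rw [infCoord, infCoord, h1, mul_inv_rev, Units.val_mul, Matrix.mulVec_mulVec]

theorem finPart_mulVec_finCoord (g : GA F r) (x : Fin r → F) :
    (finPart g : Matrix (Fin r) (Fin r) (FinAdele F)).mulVec (finCoord g x) =
      fun j => algebraMap F (FinAdele F) (x j) := by
  rw [finCoord, Matrix.mulVec_mulVec, Units.mul_inv, Matrix.one_mulVec]

theorem infPart_mulVec_infCoord (g : GA F r) (v : InfinitePlace F) (x : Fin r → F) :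
    (infPart g v : Matrix (Fin r) (Fin r) ℂ).mulVec (infCoord g v x) =
      fun j => v.embedding (x j) := by
  rw [infCoord, Matrix.mulVec_mulVec, Units.mul_inv, Matrix.one_mulVec]

theorem mulVec_map_comp {R S : Type*} [CommRing R] [CommRing S] (f : R →+* S)
    (γ : Matrix (Fin r) (Fin r) R) (x : Fin r → R) :
    (fun j => f (γ.mulVec x j)) = (γ.map f).mulVec fun j => f (x j) := by
  ext1 j
  simp [Matrix.mulVec, dotProduct]

theorem finPart_diag (γ : Matrix.GeneralLinearGroup (Fin r) F) :
    finPart (diag F r γ) = Matrix.GeneralLinearGroup.map (algebraMap F (FinAdele F)) γ := rfl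

theorem infPart_diag (γ : Matrix.GeneralLinearGroup (Fin r) F) (v : InfinitePlace F) :
    infPart (diag F r γ) v = Matrix.GeneralLinearGroup.map v.embedding γ := by
  ext i j
  exact toInfinite_algebraMap v _

theorem finCoord_diag_mul (γ : Matrix.GeneralLinearGroup (Fin r) F) (g : GA F r)
    (x : Fin r → F) :
    finCoord (diag F r γ * g) ((γ : Matrix (Fin r) (Fin r) F).mulVec x) = finCoord g x := by
  have h1 : finCoord (diag F r γ) ((γ : Matrix (Fin r) (Fin r) F).mulVec x) =
      fun j => algebraMap F (FinAdele F) (x j) := by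
    rw [finCoord, mulVec_map_comp, finPart_diag]
    refine (Matrix.mulVec_mulVec _ _ _).trans ?_
    have h2 := Units.inv_mul (Matrix.GeneralLinearGroup.map (algebraMap F (FinAdele F)) γ)
    refine (congrArg (fun M => Matrix.mulVec M _) h2).trans (Matrix.one_mulVec _)
  rw [finCoord_mul, h1, finCoord]

theorem infCoord_diag_mul (γ : Matrix.GeneralLinearGroup (Fin r) F) (g : GA F r)
    (v : InfinitePlace F) (x : Fin r → F) :
    infCoord (diag F r γ * g) v ((γ : Matrix (Fin r) (Fin r) F).mulVec x) = infCoord g v x := by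
  have h1 : infCoord (diag F r γ) v ((γ : Matrix (Fin r) (Fin r) F).mulVec x) =
      fun j => v.embedding (x j) := by
    rw [infCoord, mulVec_map_comp, infPart_diag]
    refine (Matrix.mulVec_mulVec _ _ _).trans ?_
    have h2 := Units.inv_mul (Matrix.GeneralLinearGroup.map v.embedding γ)
    refine (congrArg (fun M => Matrix.mulVec M _) h2).trans (Matrix.one_mulVec _)
  rw [infCoord_mul, h1, infCoord]

theorem euclid_diag_mul (γ : Matrix.GeneralLinearGroup (Fin r) F) (g : GA F r) (x : Fin r → F) :
    euclid (diag F r γ * g) ((γ : Matrix (Fin r) (Fin r) F).mulVec x) = euclid g x := by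
  ext p
  change (Real.sqrt p.1.mult : ℂ) * infCoord _ p.1 _ p.2 = _ * infCoord g p.1 x p.2
  rw [infCoord_diag_mul]

theorem mulVec_mem_sheaf {γ : Matrix.GeneralLinearGroup (Fin r) F} {g : GA F r}
    {x : Fin r → F} :
    (γ : Matrix (Fin r) (Fin r) F).mulVec x ∈ sheaf (diag F r γ * g) ↔ x ∈ sheaf g := by
  rw [mem_sheaf, mem_sheaf, finCoord_diag_mul]

theorem exists_den_sheaf (g : GA F r) :
    ∃ n : 𝓞 F, n ≠ 0 ∧ ∀ x ∈ sheaf g, ∀ i, (n : F) * x i ∈ (algebraMap (𝓞 F) F).range := by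
  obtain ⟨n, hn, h⟩ := exists_den_family fun p : Fin r × Fin r =>
    (finPart g : Matrix (Fin r) (Fin r) (FinAdele F)) p.1 p.2
  refine ⟨n, hn, fun x hx i => ?_⟩
  rw [← algebraMap_mem_finInt, map_mul, ← congrFun (finPart_mulVec_finCoord g x) i,
    Matrix.mulVec, dotProduct, Finset.mul_sum]
  refine sum_mem fun j _ => ?_
  rw [← mul_assoc]
  exact mul_mem (h (i, j)) (mem_sheaf.1 hx j)

theorem exists_smul_mem_sheaf (g : GA F r) (x : Fin r → F) :
    ∃ n : 𝓞 F, n ≠ 0 ∧ n • x ∈ sheaf g := by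
  obtain ⟨n, hn, h⟩ := exists_den_family (finCoord g x)
  refine ⟨n, hn, mem_sheaf.2 fun i => ?_⟩
  have : n • x = (n : F) • x := rfl
  rw [this, finCoord_smul]
  exact h i

/-- A common denominator n of the entries of g_f gives E_g ⊆ n⁻¹𝓞^r, and 𝓞_F is noetherian. -/
theorem sheaf_fg (g : GA F r) : (sheaf g).FG := by
  obtain ⟨n, hn, h⟩ := exists_den_sheaf g
  have hn' : (n : F) ≠ 0 := by exact_mod_cast hn
  let φ : (Fin r → 𝓞 F) →ₗ[𝓞 F] (Fin r → F) :=
    LinearMap.pi fun i => ((n : F)⁻¹ • (Algebra.linearMap (𝓞 F) F)) ∘ₗ LinearMap.proj i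
  have hfg : (LinearMap.range φ).FG := by
    rw [LinearMap.range_eq_map]
    exact Submodule.FG.map _ Module.Finite.fg_top
  refine Submodule.FG.of_le hfg fun x hx => ?_
  choose y hy using h x hx
  refine ⟨y, ?_⟩
  ext i
  change (n : F)⁻¹ * algebraMap (𝓞 F) F (y i) = x i
  rw [hy, inv_mul_cancel_left₀ hn']

/-- The lattice `E_g ∩ W`. -/
noncomputable def latt (g : GA F r) (W : Submodule F (Fin r → F)) : Submodule (𝓞 F) (Fin r → F) :=
  sheaf g ⊓ W.restrictScalars (𝓞 F)

theorem mem_latt {g : GA F r} {W : Submodule F (Fin r → F)} {x : Fin r → F} :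
    x ∈ latt g W ↔ x ∈ sheaf g ∧ x ∈ W := Iff.rfl

theorem latt_mono (g : GA F r) {W W' : Submodule F (Fin r → F)} (h : W ≤ W') :
    latt g W ≤ latt g W' := fun _ hx => ⟨hx.1, h hx.2⟩

theorem latt_fg (g : GA F r) (W : Submodule F (Fin r → F)) : (latt g W).FG :=
  Submodule.FG.of_le (sheaf_fg g) inf_le_left

theorem span_latt (g : GA F r) (W : Submodule F (Fin r → F)) :
    Submodule.span F (latt g W : Set (Fin r → F)) = W := by
  refine le_antisymm (Submodule.span_le.2 fun x hx => hx.2) fun x hx => ?_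
  obtain ⟨n, hn, h⟩ := exists_smul_mem_sheaf g x
  have hn' : (n : F) ≠ 0 := by exact_mod_cast hn
  have h1 : (n : F) • x ∈ Submodule.span F (latt g W : Set (Fin r → F)) :=
    Submodule.subset_span ⟨h, W.smul_mem _ hx⟩
  have := Submodule.smul_mem _ (n : F)⁻¹ h1
  rwa [inv_smul_smul₀ hn'] at this

theorem subDegree_eq_latt (g : GA F r) (W : Submodule F (Fin r → F)) :
    subDegree g W = arakelovDegree (latt g W) (metric g) := rfl

theorem subDegree_top (g : GA F r) : subDegree g ⊤ = degree g := by
  rw [subDegree, degree, Submodule.restrictScalars_top, inf_top_eq]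

theorem subDegree_eq {ι : Type*} [Fintype ι] {β : ι → Fin r → F} {g : GA F r}
    {W : Submodule F (Fin r → F)} (hβ : IsIntBasis β (latt g W)) :
    subDegree g W = 1 / 2 * (Module.finrank F W * Real.log (discConst F)) -
      1 / 2 * Real.log (gramDet fun i => euclid g (β i)) := by
  have := (arakelovDegree_eq_covolume g hβ).2
  rwa [span_latt] at this

theorem exists_latt_basis (g : GA F r) (W : Submodule F (Fin r → F)) {ι : Type*} [Fintype ι]
    (h : Fintype.card ι = Module.finrank ℚ W) : ∃ β : ι → Fin r → F, IsIntBasis β (latt g W) :=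
  exists_isIntBasis (latt_fg g W) (by rw [span_latt, h])

theorem subDegree_bot (g : GA F r) : subDegree g ⊥ = 0 := by
  obtain ⟨β, hβ⟩ := exists_latt_basis (ι := Fin 0) g ⊥
    (by rw [finrank_rat_eq, finrank_bot, mul_zero, Fintype.card_fin])
  rw [subDegree_eq hβ, gramDet_def]
  simp

/-- The linear automorphism of `F^r` given by an invertible matrix. -/
noncomputable def linAut (γ : Matrix.GeneralLinearGroup (Fin r) F) :
    (Fin r → F) ≃ₗ[F] (Fin r → F) :=
  Matrix.toLin'OfInv (M := γ.inv) (M' := (γ : Matrix (Fin r) (Fin r) F)) γ.inv_val γ.val_inv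

omit [NumberField F] in
theorem linAut_apply (γ : Matrix.GeneralLinearGroup (Fin r) F) (x : Fin r → F) :
    linAut γ x = (γ : Matrix (Fin r) (Fin r) F).mulVec x :=
  Matrix.toLin'_apply _ _

omit [NumberField F] in
theorem linAut_mul (γ δ : Matrix.GeneralLinearGroup (Fin r) F) (x : Fin r → F) :
    linAut (γ * δ) x = linAut γ (linAut δ x) := by
  rw [linAut_apply, linAut_apply, linAut_apply, Units.val_mul, Matrix.mulVec_mulVec]

/-- Multiplication by γ is an isometry from E_g ∩ W onto E_{γg} ∩ γW. -/
theorem subDegree_diag_mul (γ : Matrix.GeneralLinearGroup (Fin r) F) (g : GA F r)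
    (W : Submodule F (Fin r → F)) :
    subDegree (diag F r γ * g) (W.map (linAut γ).toLinearMap) = subDegree g W := by
  obtain ⟨β, hβ⟩ := exists_latt_basis (ι := Fin (Module.finrank ℚ W)) g W (by simp)
  have h1 : IsIntBasis (fun i => linAut γ (β i))
      (latt (diag F r γ * g) (W.map (linAut γ).toLinearMap)) := by
    refine ⟨hβ.1.map' ((linAut γ).toLinearMap.restrictScalars ℤ)
      (LinearMap.ker_eq_bot.2 (linAut γ).injective), ?_⟩
    have h2 : Set.range (fun i => linAut γ (β i)) =
        ((linAut γ).toLinearMap.restrictScalars ℤ) '' Set.range β := by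
      rw [← Set.range_comp]
      rfl
    rw [h2, Submodule.span_image, hβ.2]
    ext y
    simp only [Submodule.mem_map, Submodule.restrictScalars_mem, mem_latt]
    constructor
    · rintro ⟨x, hx, rfl⟩
      exact ⟨mulVec_mem_sheaf.2 hx.1, x, hx.2, rfl⟩
    · rintro ⟨hy, x, hx, rfl⟩
      exact ⟨x, ⟨mulVec_mem_sheaf.1 hy, hx⟩, rfl⟩
  rw [subDegree_eq h1, subDegree_eq hβ, (linAut γ).finrank_map_eq W]
  simp only [linAut_apply, euclid_diag_mul]

theorem degree_diag_mul (γ : Matrix.GeneralLinearGroup (Fin r) F) (g : GA F r) :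
    degree (diag F r γ * g) = degree g := by
  rw [← subDegree_top, ← subDegree_top, ← subDegree_diag_mul γ g ⊤, Submodule.map_top,
    LinearEquiv.range]

theorem norm_infCoord_le (g : GA F r) (v : InfinitePlace F) (x : Fin r → F) (i : Fin r) :
    ‖infCoord g v x i‖ ≤ ‖euclid g x‖ := by
  have h1 := PiLp.norm_apply_le (euclid g x) (v, i)
  refine le_trans ?_ h1
  change _ ≤ ‖(Real.sqrt v.mult : ℂ) * infCoord g v x i‖
  rw [norm_mul, Complex.norm_real, Real.norm_of_nonneg (Real.sqrt_nonneg _)]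
  refine le_mul_of_one_le_left (norm_nonneg _) ?_
  rw [Real.one_le_sqrt]
  exact_mod_cast v.one_le_mult

/-- After multiplication by a common denominator, the coordinates are algebraic integers with all
conjugates bounded, and there are finitely many of these. -/
theorem finite_sheaf_norm_le (g : GA F r) (B : ℝ) :
    {x | x ∈ sheaf g ∧ ‖euclid g x‖ ≤ B}.Finite := by
  obtain ⟨n, hn, h⟩ := exists_den_sheaf g
  have hn' : (n : F) ≠ 0 := by exact_mod_cast hn
  let C : ℝ := ∑ v : InfinitePlace F, ∑ i, ∑ j,
    v n * ‖(infPart g v : Matrix (Fin r) (Fin r) ℂ) i j‖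
  have hC : ∀ x, ‖euclid g x‖ ≤ B → ∀ (v : InfinitePlace F) i, v (n * x i) ≤ C * B := by
    intro x hx v i
    have hB : 0 ≤ B := (norm_nonneg _).trans hx
    rw [map_mul, ← InfinitePlace.norm_embedding_eq v (x i),
      ← congrFun (infPart_mulVec_infCoord g v x) i, Matrix.mulVec, dotProduct]
    calc v n * ‖∑ j, (infPart g v : Matrix (Fin r) (Fin r) ℂ) i j * infCoord g v x j‖
        ≤ v n * ∑ j, ‖(infPart g v : Matrix (Fin r) (Fin r) ℂ) i j‖ * B := by
          gcongr
          refine (norm_sum_le _ _).trans (Finset.sum_le_sum fun j _ => ?_)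
          rw [norm_mul]
          gcongr
          exact (norm_infCoord_le g v x j).trans hx
      _ = (∑ j, v n * ‖(infPart g v : Matrix (Fin r) (Fin r) ℂ) i j‖) * B := by
          rw [Finset.mul_sum, Finset.sum_mul]
          exact Finset.sum_congr rfl fun j _ => by ring
      _ ≤ C * B := by
          gcongr
          have hnn : ∀ (w : InfinitePlace F) i,
              0 ≤ ∑ j, w n * ‖(infPart g w : Matrix (Fin r) (Fin r) ℂ) i j‖ := fun w i =>
            Finset.sum_nonneg fun j _ => mul_nonneg (apply_nonneg _ _) (norm_nonneg _)
          exact (Finset.single_le_sum (fun i _ => hnn v i) (Finset.mem_univ i)).trans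
            (Finset.single_le_sum (f := fun w : InfinitePlace F => ∑ i, ∑ j,
              w n * ‖(infPart g w : Matrix (Fin r) (Fin r) ℂ) i j‖)
              (fun w _ => Finset.sum_nonneg fun i _ => hnn w i) (Finset.mem_univ v))
  have hfin := Set.Finite.pi' fun _ : Fin r => Embeddings.finite_of_norm_le F ℂ (C * B)
  refine Set.Finite.subset (hfin.preimage (f := fun x : Fin r → F => (n : F) • x)
    (fun x _ y _ hxy => smul_right_injective _ hn' hxy)) fun x hx => ?_
  intro i
  obtain ⟨y, hy⟩ := h x hx.1 i
  refine ⟨?_, fun φ => ?_⟩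
  · change IsIntegral ℤ ((n : F) * x i)
    rw [← hy]
    exact y.2
  · have := hC x hx.2 (InfinitePlace.mk φ) i
    rwa [InfinitePlace.apply] at this

end Sheaf

end GeoTrunc

namespace GeoTrunc

/-! ### Supermodularity and finiteness of degrees -/

section Lattices

variable {F : Type*} [Field F] [NumberField F] {r : ℕ}

/-- E_g ∩ W is saturated in E_g ∩ W', because W is an F-subspace. The quotient is therefore
torsion-free, hence free, and a basis of it can be lifted. -/
theorem exists_adapted_basis (g : GA F r) {W W' : Submodule F (Fin r → F)} (h : W ≤ W')
    {ι : Type*} {c : ι → Fin r → F} (hc : IsIntBasis c (latt g W)) :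
    ∃ (n : ℕ) (a : Fin n → Fin r → F), IsIntBasis (Sum.elim c a) (latt g W') := by
  let M : Submodule ℤ (Fin r → F) := (latt g W').restrictScalars ℤ
  let N₀ : Submodule ℤ (Fin r → F) := (latt g W).restrictScalars ℤ
  have hNM : N₀ ≤ M := latt_mono g h
  let N : Submodule ℤ M := N₀.comap M.subtype
  have h1 : Module.Finite (𝓞 F) (latt g W') := Module.Finite.iff_fg.2 (latt_fg g W')
  have h2 : Module.Finite ℤ M := (Module.Finite.trans (𝓞 F) (latt g W') : Module.Finite ℤ (latt g W'))
  have h3 : Module.IsTorsionFree ℤ (M ⧸ N) := by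
    refine .of_smul_eq_zero fun n x hx => ?_
    obtain ⟨x, rfl⟩ := Submodule.mkQ_surjective N x
    by_cases hn : n = 0
    · exact Or.inl hn
    refine Or.inr ((Submodule.Quotient.mk_eq_zero N).2 ?_)
    rw [← map_smul] at hx
    have h4 : n • x ∈ N := (Submodule.Quotient.mk_eq_zero N).1 hx
    refine (⟨x.2.1, ?_⟩ : (x : Fin r → F) ∈ latt g W)
    have h5 : (n : F) • (x : Fin r → F) ∈ W := by
      rw [Int.cast_smul_eq_zsmul]
      exact h4.2
    have h6 : (n : F) ≠ 0 := by exact_mod_cast hn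
    have := W.smul_mem (n : F)⁻¹ h5
    rwa [inv_smul_smul₀ h6] at this
  have h4 : Module.Free ℤ (M ⧸ N) := Module.free_of_finite_type_torsion_free'
  let b₀ : Module.Basis ι ℤ N := (Module.Basis.span hc.1).map
    ((LinearEquiv.ofEq _ _ hc.2).trans (Submodule.comapSubtypeEquivOfLe hNM).symm)
  let B := Module.Basis.sumQuot b₀ (Module.finBasis ℤ (M ⧸ N))
  refine ⟨_, fun j => (B (Sum.inr j) : Fin r → F), ?_⟩
  have h5 : Sum.elim c (fun j => (B (Sum.inr j) : Fin r → F)) = M.subtype ∘ B := by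
    ext1 (i | j)
    · change c i = ((B (Sum.inl i) : M) : Fin r → F)
      rw [Module.Basis.sumQuot_inl]
      exact (Module.Basis.coe_span_apply hc.1 i).symm
    · rfl
  rw [h5]
  refine ⟨B.linearIndependent.map' M.subtype M.ker_subtype, ?_⟩
  rw [Set.range_comp, Submodule.span_image, B.span_eq, Submodule.map_top, Submodule.range_subtype]

/-- A ℤ-basis of E_g is a ℚ-basis of F^r with nonzero Gram determinant. Its image is therefore
independent over ℝ, and rational coordinate vectors that are independent over ℚ stay so over ℝ. -/
theorem linearIndependent_euclid (g : GA F r) {ι : Type*} {v : ι → Fin r → F}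
    (hv : LinearIndependent ℤ v) : LinearIndependent ℝ fun i => euclid g (v i) := by
  rw [LinearIndependent.iff_fractionRing ℤ ℚ] at hv
  obtain ⟨β, hβ⟩ := exists_latt_basis (ι := Fin (Module.finrank ℚ (⊤ : Submodule F (Fin r → F))))
    g ⊤ (by simp)
  have h1 : LinearIndependent ℝ fun i => euclid g (β i) :=
    linearIndependent_of_gramDet_ne_zero (arakelovDegree_eq_covolume g hβ).1.ne'
  have h2 : LinearIndependent ℚ β := (LinearIndependent.iff_fractionRing ℤ ℚ).1 hβ.1
  have h3 : Submodule.span ℚ (Set.range β) = ⊤ := by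
    refine Submodule.eq_top_of_finrank_eq ?_
    rw [finrank_span_eq_card h2, Fintype.card_fin]
    exact (finrank_top ℚ (Fin r → F) : _)
  let b := Module.Basis.mk h2 h3.ge
  have h4 : LinearIndependent ℝ fun i => algebraMap ℚ ℝ ∘ b.equivFun (v i) :=
    linearIndependent_algebraMap_comp_iff.2 (hv.map' b.equivFun.toLinearMap (LinearEquiv.ker _))
  have h5 := h4.map' (Fintype.linearCombination ℝ fun i => euclid g (β i))
    (LinearMap.ker_eq_bot.2 (linearIndependent_iff_injective_fintypeLinearCombination.1 h1))
  convert! h5 using 1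
  ext1 i
  have h6 := b.sum_equivFun (v i)
  rw [Function.comp_apply, Fintype.linearCombination_apply]
  conv_lhs => rw [← h6, map_sum]
  refine Finset.sum_congr rfl fun j _ => ?_
  rw [Module.Basis.mk_apply, map_rat_smul (euclid g) (b.equivFun (v i) j)]
  exact (Rat.cast_smul_eq_qsmul ℝ _ _).symm

theorem euclid_ne_zero (g : GA F r) {x : Fin r → F} (hx : x ≠ 0) : euclid g x ≠ 0 := by
  have h1 : LinearIndependent ℤ fun _ : Unit => x := LinearIndependent.of_subsingleton () hx
  exact (linearIndependent_euclid g h1).ne_zero ()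

/-- Passing to a sublattice multiplies the Gram determinant by the square of the index, which is at
least 1. -/
theorem gramDet_le_of_mem {ι : Type*} [Fintype ι] (g : GA F r) {β β' : ι → Fin r → F}
    {L : Submodule (𝓞 F) (Fin r → F)} (hβ : IsIntBasis β L) (hβ' : LinearIndependent ℤ β')
    (h : ∀ i, β' i ∈ L) :
    gramDet (fun i => euclid g (β i)) ≤ gramDet (fun i => euclid g (β' i)) := by
  have h1 : Submodule.span ℤ (Set.range β') ≤ Submodule.span ℤ (Set.range β) := by
    rw [hβ.2, Submodule.span_le]
    rintro _ ⟨i, rfl⟩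
    exact h i
  have h2 := gramDet_eq_relIndex_sq_mul (euclid g) hβ.1 hβ' h1
  have h3 := gramDet_pos (linearIndependent_euclid g hβ')
  rw [h2] at h3 ⊢
  refine le_mul_of_one_le_left (gramDet_nonneg _) ?_
  have h4 : (Submodule.span ℤ (Set.range β')).toAddSubgroup.relIndex
      (Submodule.span ℤ (Set.range β)).toAddSubgroup ≠ 0 := by
    intro h5
    rw [h5] at h3
    simp at h3
  exact one_le_pow₀ (by exact_mod_cast Nat.one_le_iff_ne_zero.2 h4)

theorem gramDet_finset_image {E : Type*} [NormedAddCommGroup E] [InnerProductSpace ℝ E]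
    {ι κ : Type*} [Fintype κ] [DecidableEq ι] (v : ι → E) (f : κ → ι) (hf : Function.Injective f)
    (S : Finset ι) (hS : ∀ i, i ∈ S ↔ ∃ k, f k = i) :
    gramDet (fun j : S => v j) = gramDet fun k => v (f k) := by
  let e : κ ≃ S := Equiv.ofBijective (fun k => ⟨f k, (hS _).2 ⟨k, rfl⟩⟩)
    ⟨fun a b hab => hf (congrArg Subtype.val hab), fun ⟨i, hi⟩ => by
      obtain ⟨k, hk⟩ := (hS i).1 hi
      exact ⟨k, Subtype.ext hk⟩⟩
  exact (gramDet_comp_equiv e fun j : S => v j).symm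

/-- Submodularity of covolumes. -/
theorem gramDet_sumElim_mul_le {E : Type*} [NormedAddCommGroup E] [InnerProductSpace ℝ E]
    {ι κ μ : Type*} [Fintype ι] [Fintype κ] [Fintype μ] (c : ι → E) (a : κ → E) (b : μ → E)
    (h : LinearIndependent ℝ (Sum.elim (Sum.elim c a) b)) :
    gramDet (Sum.elim (Sum.elim c a) b) * gramDet c ≤
      gramDet (Sum.elim c b) * gramDet (Sum.elim c a) := by
  classical
  let S : Finset ((ι ⊕ κ) ⊕ μ) := Finset.univ.image Sum.inl
  let T : Finset ((ι ⊕ κ) ⊕ μ) := Finset.univ.image (Sum.inl ∘ Sum.inl)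
  let R : Finset ((ι ⊕ κ) ⊕ μ) := Finset.univ.image Sum.inr
  have hinj : Function.Injective
      (Sum.elim (Sum.inl ∘ Sum.inl) Sum.inr : ι ⊕ μ → (ι ⊕ κ) ⊕ μ) := by
    rintro (i | i) (j | j) hij <;> simp_all
  have h1 := gramDet_finset_image (Sum.elim (Sum.elim c a) b) id Function.injective_id (R ∪ S)
    (by intro i; rcases i with (i | i) | i <;> simp [R, S])
  have h2 := gramDet_finset_image (Sum.elim (Sum.elim c a) b) (Sum.inl ∘ Sum.inl)
    (Sum.inl_injective.comp Sum.inl_injective) T (by intro i; simp [T])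
  have h3 := gramDet_finset_image (Sum.elim (Sum.elim c a) b) _ hinj (R ∪ T)
    (by intro i; rcases i with (i | i) | i <;> simp [R, T])
  have h4 := gramDet_finset_image (Sum.elim (Sum.elim c a) b) Sum.inl Sum.inl_injective S
    (by intro i; simp [S])
  have h5 : (fun k => Sum.elim (Sum.elim c a) b
      ((Sum.elim (Sum.inl ∘ Sum.inl) Sum.inr : ι ⊕ μ → (ι ⊕ κ) ⊕ μ) k)) = Sum.elim c b := by
    ext1 (i | j) <;> rfl
  rw [h5] at h3
  have h6 := gramDet_union_mul_le h S T R
    (by intro i; rcases i with (i | i) | i <;> simp [S, T])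
    (by rw [Finset.disjoint_left]; intro i; rcases i with (i | i) | i <;> simp [R, S])
  rw [h1, h2, h3, h4] at h6
  exact h6

theorem log_gramDet_add_le {E : Type*} [NormedAddCommGroup E] [InnerProductSpace ℝ E]
    {ι κ μ : Type*} [Fintype ι] [Fintype κ] [Fintype μ] (c : ι → E) (a : κ → E) (b : μ → E)
    (h : LinearIndependent ℝ (Sum.elim (Sum.elim c a) b)) :
    Real.log (gramDet (Sum.elim (Sum.elim c a) b)) + Real.log (gramDet c) ≤
      Real.log (gramDet (Sum.elim c b)) + Real.log (gramDet (Sum.elim c a)) := by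
  have hca : LinearIndependent ℝ (Sum.elim c a) := h.comp Sum.inl Sum.inl_injective
  have hc : LinearIndependent ℝ c := hca.comp Sum.inl Sum.inl_injective
  have hcb : LinearIndependent ℝ (Sum.elim c b) := by
    have := h.comp (Sum.elim (Sum.inl ∘ Sum.inl) Sum.inr) ?_
    · convert! this using 1
      ext1 (i | j) <;> rfl
    · rintro (i | i) (j | j) hij <;> simp_all
  rw [← Real.log_mul (gramDet_pos h).ne' (gramDet_pos hc).ne',
    ← Real.log_mul (gramDet_pos hcb).ne' (gramDet_pos hca).ne']
  exact Real.log_le_log (mul_pos (gramDet_pos h) (gramDet_pos hc)) (gramDet_sumElim_mul_le c a b h)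

/-- A basis c of E_g ∩ W₁ ∩ W₂ extends by a to E_g ∩ W₁ and by b to E_g ∩ W₂. Then c, a, b together
form a basis of the sum of these lattices. That sum has finite index in E_g ∩ (W₁ + W₂), so it has
the larger covolume, and submodularity of Gram determinants bounds its covolume. The discriminant
terms cancel by the dimension formula. -/
theorem subDegree_add_le (g : GA F r) (W₁ W₂ : Submodule F (Fin r → F)) :
    subDegree g W₁ + subDegree g W₂ ≤ subDegree g (W₁ ⊓ W₂) + subDegree g (W₁ ⊔ W₂) := by
  obtain ⟨c, hc⟩ := exists_latt_basis (ι := Fin (Module.finrank ℚ (W₁ ⊓ W₂ : Submodule F _)))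
    g (W₁ ⊓ W₂) (by simp)
  obtain ⟨na, a, ha⟩ := exists_adapted_basis g inf_le_left hc
  obtain ⟨nb, b, hb⟩ := exists_adapted_basis g inf_le_right hc
  have hcspan : ∀ i, c i ∈ latt g (W₁ ⊓ W₂) := fun i => by
    change c i ∈ (latt g (W₁ ⊓ W₂)).restrictScalars ℤ
    rw [← hc.2]
    exact Submodule.subset_span ⟨i, rfl⟩
  have haL : ∀ i, Sum.elim c a i ∈ latt g W₁ := fun i => by
    change _ ∈ (latt g W₁).restrictScalars ℤ
    rw [← ha.2]
    exact Submodule.subset_span ⟨i, rfl⟩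
  have hbL : ∀ i, Sum.elim c b i ∈ latt g W₂ := fun i => by
    change _ ∈ (latt g W₂).restrictScalars ℤ
    rw [← hb.2]
    exact Submodule.subset_span ⟨i, rfl⟩
  have hbLI : LinearIndependent ℤ b := hb.1.comp Sum.inr Sum.inr_injective
  have hdisj : Disjoint (Submodule.span ℤ (Set.range c)) (Submodule.span ℤ (Set.range b)) :=
    (linearIndependent_sum.1 hb.1).2.2
  have hLI : LinearIndependent ℤ (Sum.elim (Sum.elim c a) b) := by
    refine ha.1.sum_type hbLI ?_
    rw [Submodule.disjoint_def] at hdisj ⊢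
    intro x hx hxb
    refine hdisj x ?_ hxb
    rw [hc.2]
    rw [ha.2] at hx
    have hx2 : x ∈ latt g W₂ := by
      change x ∈ (latt g W₂).restrictScalars ℤ
      refine (Submodule.span_le.2 ?_ : Submodule.span ℤ (Set.range b) ≤ _) hxb
      rintro _ ⟨i, rfl⟩
      exact hbL (Sum.inr i)
    exact ⟨hx.1, hx.2, hx2.2⟩
  have h1 := hc.finrank_eq_card
  have h2 := ha.finrank_eq_card
  have h3 := hb.finrank_eq_card
  rw [span_latt] at h1 h2 h3
  rw [Fintype.card_sum] at h2 h3
  have h4 := Submodule.finrank_sup_add_finrank_inf_eq W₁ W₂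
  obtain ⟨β, hβ⟩ := exists_latt_basis (ι := (Fin (Module.finrank ℚ (W₁ ⊓ W₂ : Submodule F _)) ⊕ Fin na) ⊕ Fin nb) g (W₁ ⊔ W₂) (by
    rw [Fintype.card_sum, Fintype.card_sum]
    have e1 := finrank_rat_eq (W₁ ⊓ W₂)
    have e2 := finrank_rat_eq W₁
    have e3 := finrank_rat_eq W₂
    have e4 := finrank_rat_eq (W₁ ⊔ W₂)
    have h5 := congrArg (Fintype.card (F →+* ℂ) * ·) h4
    simp only [mul_add] at h5
    omega)
  have h5 := gramDet_le_of_mem g hβ hLI (fun i => by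
    rcases i with i | i
    · exact latt_mono g le_sup_left (haL i)
    · exact latt_mono g le_sup_right (hbL (Sum.inr i)))
  have h6 := Real.log_le_log (arakelovDegree_eq_covolume g hβ).1 h5
  have helim : ∀ {ι κ : Type} (x : ι → Fin r → F) (y : κ → Fin r → F),
      (fun i => euclid g (Sum.elim x y i)) =
        Sum.elim (fun i => euclid g (x i)) fun i => euclid g (y i) := fun x y => by
    ext1 (i | i) <;> rfl
  have h7 := linearIndependent_euclid g hLI
  rw [helim, helim] at h6 h7
  have h8 := log_gramDet_add_le _ _ _ h7
  rw [subDegree_eq hc, subDegree_eq ha, subDegree_eq hb, subDegree_eq hβ, helim, helim]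
  have h9 : (Module.finrank F ↥(W₁ ⊔ W₂) : ℝ) + Module.finrank F ↥(W₁ ⊓ W₂) =
      Module.finrank F W₁ + Module.finrank F W₂ := by exact_mod_cast h4
  have h10 : (Module.finrank F ↥(W₁ ⊔ W₂) : ℝ) * Real.log (discConst F) +
      Module.finrank F ↥(W₁ ⊓ W₂) * Real.log (discConst F) =
      Module.finrank F W₁ * Real.log (discConst F) +
        Module.finrank F W₂ * Real.log (discConst F) := by
    rw [← add_mul, ← add_mul, h9]
  linarith

/-- The bound depends on k, c and D only; this uniformity in g is needed for compactness.
`exists_bound_span` gives the assertion for real spans, and it descends to F because independent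
lattice vectors stay independent over ℝ, so that dimensions can be compared. -/
theorem span_bounded_eq (k : ℕ) {c : ℝ} (hc : 0 < c) (D : ℝ) : ∃ B : ℝ, ∀ (g : GA F r)
    (W : Submodule F (Fin r → F)), Module.finrank F W = k →
      (∀ x ∈ latt g W, x ≠ 0 → c ≤ ‖euclid g x‖) → D ≤ subDegree g W →
      Submodule.span F {x | x ∈ latt g W ∧ ‖euclid g x‖ ≤ B} = W := by
  let n := Fintype.card (F →+* ℂ) * k
  -- The exponential is the bound on the Gram determinant that amounts to degree at least D in rank
  -- k.
  obtain ⟨B, hB⟩ := exists_bound_span (E := EuclideanSpace ℂ (InfinitePlace F × Fin r)) n hc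
    (Real.exp (k * Real.log (discConst F) - 2 * D))
  refine ⟨B, fun g W hk hmin hD => ?_⟩
  have hn : Module.finrank ℚ W = n := by rw [finrank_rat_eq, hk]
  obtain ⟨β, hβ⟩ := exists_latt_basis (ι := Fin n) g W (by rw [Fintype.card_fin, hn])
  have hβL : ∀ m : Fin n → ℤ, ∑ i, m i • β i ∈ latt g W := fun m => by
    change _ ∈ (latt g W).restrictScalars ℤ
    rw [← hβ.2]
    exact sum_mem fun i _ => Submodule.smul_mem _ _ (Submodule.subset_span ⟨i, rfl⟩)
  have hsum : ∀ m : Fin n → ℤ,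
      ∑ i, (m i : ℝ) • euclid g (β i) = euclid g (∑ i, m i • β i) := fun m => by
    rw [map_sum]
    refine Finset.sum_congr rfl fun i _ => ?_
    rw [map_zsmul, Int.cast_smul_eq_zsmul]
  have hLI := linearIndependent_euclid g hβ.1
  have hgd : gramDet (fun i => euclid g (β i)) ≤
      Real.exp (k * Real.log (discConst F) - 2 * D) := by
    have h1 := (arakelovDegree_eq_covolume g hβ).1
    rw [← Real.log_le_iff_le_exp h1]
    rw [subDegree_eq hβ, hk] at hD
    linarith
  have h1 := hB _ hLI hgd fun m hm => by
    rw [hsum]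
    refine hmin _ (hβL m) fun h0 => hm ?_
    ext i
    exact Fintype.linearIndependent_iff.1 hβ.1 m h0 i
  set S := {x | x ∈ latt g W ∧ ‖euclid g x‖ ≤ B} with hS
  have hle : Submodule.span F S ≤ W := Submodule.span_le.2 fun x hx => hx.1.2
  obtain ⟨β', hβ'⟩ := exists_latt_basis
    (ι := Fin (Module.finrank ℚ (Submodule.span F S))) g (Submodule.span F S) (by simp)
  have h2 : Submodule.span ℝ (Set.range fun i => euclid g (β i)) ≤
      Submodule.span ℝ (Set.range fun i => euclid g (β' i)) := by
    rw [Submodule.span_le]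
    rintro _ ⟨i, rfl⟩
    refine (Submodule.span_le.2 ?_ : Submodule.span ℝ _ ≤ _) (h1 i)
    rintro _ ⟨m, rfl, hm⟩
    rw [hsum] at hm ⊢
    have h3 : ∑ i, m i • β i ∈ latt g (Submodule.span F S) :=
      ⟨(hβL m).1, Submodule.subset_span ⟨hβL m, hm⟩⟩
    change _ ∈ (latt g (Submodule.span F S)).restrictScalars ℤ at h3
    rw [← hβ'.2] at h3
    obtain ⟨l, hl⟩ := (Submodule.mem_span_range_iff_exists_fun ℤ).1 h3
    rw [← hl, map_sum]
    refine sum_mem fun j _ => ?_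
    rw [map_zsmul, ← Int.cast_smul_eq_zsmul ℝ]
    exact Submodule.smul_mem _ _ (Submodule.subset_span ⟨j, rfl⟩)
  have h3 := Submodule.finrank_mono h2
  rw [finrank_span_eq_card hLI, finrank_span_eq_card (linearIndependent_euclid g hβ'.1),
    Fintype.card_fin, Fintype.card_fin, ← hn, finrank_rat_eq, finrank_rat_eq] at h3
  refine Submodule.eq_of_le_of_finrank_le hle ?_
  exact Nat.le_of_mul_le_mul_left h3 Fintype.card_pos

theorem exists_min_norm (g : GA F r) : ∃ c : ℝ, 0 < c ∧
    ∀ x ∈ sheaf g, x ≠ 0 → c ≤ ‖euclid g x‖ := by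
  have hfin := ((finite_sheaf_norm_le g 1).subset
    (fun x hx => hx.1 : {x | (x ∈ sheaf g ∧ ‖euclid g x‖ ≤ 1) ∧ x ≠ 0} ⊆ _))
  rcases Set.eq_empty_or_nonempty {x | (x ∈ sheaf g ∧ ‖euclid g x‖ ≤ 1) ∧ x ≠ 0} with h | h
  · refine ⟨1, one_pos, fun x hx hx0 => ?_⟩
    by_contra hlt
    exact (Set.eq_empty_iff_forall_notMem.1 h x) ⟨⟨hx, (not_le.1 hlt).le⟩, hx0⟩
  · obtain ⟨y, hy, hmin⟩ := Set.exists_min_image _ (fun x => ‖euclid g x‖) hfin h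
    refine ⟨‖euclid g y‖, norm_pos_iff.2 (euclid_ne_zero g hy.2), fun x hx hx0 => ?_⟩
    rcases le_total ‖euclid g x‖ 1 with h1 | h1
    · exact hmin x ⟨⟨hx, h1⟩, hx0⟩
    · exact hy.1.2.trans h1

/-- Such a W is spanned by its lattice vectors of norm at most B, a subset of a finite set. -/
theorem finite_le_subDegree (g : GA F r) (D : ℝ) :
    {W : Submodule F (Fin r → F) | D ≤ subDegree g W}.Finite := by
  obtain ⟨c, hc, hmin⟩ := exists_min_norm g
  have h1 : ∀ k : ℕ, {W : Submodule F (Fin r → F) |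
      Module.finrank F W = k ∧ D ≤ subDegree g W}.Finite := by
    intro k
    obtain ⟨B, hB⟩ := span_bounded_eq (F := F) (r := r) k hc D
    have hfin := (finite_sheaf_norm_le g B).finite_subsets.image fun S => Submodule.span F S
    refine hfin.subset fun W hW => ?_
    exact ⟨{x | x ∈ latt g W ∧ ‖euclid g x‖ ≤ B}, fun x hx => ⟨hx.1.1, hx.2⟩,
      hB g W hW.1 (fun x hx => hmin x hx.1) hW.2⟩
  refine ((Set.finite_Iic r).biUnion fun k _ => h1 k).subset fun W hW => ?_
  refine Set.mem_biUnion (x := Module.finrank F W) ?_ ⟨rfl, hW⟩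
  have := Submodule.finrank_le W
  rwa [Module.finrank_fin_fun] at this

end Lattices

end GeoTrunc

namespace GeoTrunc

/-! ### Continuity of the degree -/

section Continuity

variable {F : Type*} [Field F] [NumberField F] {r : ℕ}

theorem isOpen_finInt : IsOpen (finInt F : Set (FinAdele F)) :=
  RestrictedProduct.isOpen_forall_mem fun v : HeightOneSpectrum (𝓞 F) =>
    Valued.isOpen_valuationSubring (v.adicCompletion F)

theorem continuous_toFinite : Continuous (toFinite F) := continuous_snd

theorem continuous_toInfinite (v : InfinitePlace F) : Continuous (toInfinite v) :=
  (InfinitePlace.Completion.isometry_extensionEmbedding v).continuous.comp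
    ((continuous_apply v).comp continuous_fst)

theorem continuous_entry (i j : Fin r) : Continuous fun g : GA F r => g.val i j :=
  Units.continuous_val.matrix_elem i j

theorem continuous_entry_inv (i j : Fin r) : Continuous fun g : GA F r => (g⁻¹).val i j :=
  (continuous_entry i j).comp continuous_inv

/-- The matrices whose finite part lies in `GL_r` of the integral finite adeles. -/
def finIntegral (F : Type*) [Field F] [NumberField F] (r : ℕ) : Set (GA F r) :=
  {u | ∀ i j, toFinite F (u.val i j) ∈ finInt F ∧ toFinite F ((u⁻¹).val i j) ∈ finInt F}

theorem isOpen_finIntegral : IsOpen (finIntegral F r) := by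
  simp only [finIntegral, Set.ofPred_forall]
  refine isOpen_iInter_of_finite fun i => isOpen_iInter_of_finite fun j => ?_
  exact (isOpen_finInt.preimage (continuous_toFinite.comp (continuous_entry i j))).inter
    (isOpen_finInt.preimage (continuous_toFinite.comp (continuous_entry_inv i j)))

theorem finPart_inv_apply (g : GA F r) (i j : Fin r) :
    (((finPart g)⁻¹ : Matrix.GeneralLinearGroup (Fin r) (FinAdele F)) :
      Matrix (Fin r) (Fin r) (FinAdele F)) i j = toFinite F ((g⁻¹).val i j) := by
  rw [finPart, ← map_inv]
  rfl

theorem one_mem_finIntegral : (1 : GA F r) ∈ finIntegral F r := by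
  have h : ∀ i j, toFinite F ((1 : Matrix (Fin r) (Fin r) (Adele F)) i j) ∈ finInt F := by
    intro i j
    rw [Matrix.one_apply]
    split_ifs
    · rw [map_one]
      exact one_mem _
    · rw [map_zero]
      exact zero_mem _
  intro i j
  rw [inv_one]
  exact ⟨h i j, h i j⟩

theorem inv_mem_finIntegral {u : GA F r} (hu : u ∈ finIntegral F r) : u⁻¹ ∈ finIntegral F r :=
  fun i j => ⟨(hu i j).2, by rw [inv_inv]; exact (hu i j).1⟩

theorem sheaf_le_mul (g : GA F r) {u : GA F r} (hu : u ∈ finIntegral F r) :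
    sheaf g ≤ sheaf (g * u) := by
  intro x hx
  rw [mem_sheaf] at hx ⊢
  intro i
  rw [finCoord_mul, Matrix.mulVec, dotProduct]
  refine sum_mem fun j _ => mul_mem ?_ (hx j)
  rw [finPart_inv_apply]
  exact (hu i j).2

theorem sheaf_mul_eq (g : GA F r) {u : GA F r} (hu : u ∈ finIntegral F r) :
    sheaf (g * u) = sheaf g := by
  refine le_antisymm ?_ (sheaf_le_mul g hu)
  have := sheaf_le_mul (g * u) (inv_mem_finIntegral hu)
  rwa [mul_inv_cancel_right] at this

/-- E_g depends only on the coset of g modulo the matrices that are integral, with integral inverse,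
at all finite places, and this coset is open. -/
theorem eventually_sheaf_eq (g : GA F r) : ∀ᶠ h in 𝓝 g, sheaf h = sheaf g := by
  have h1 : IsOpen {h | g⁻¹ * h ∈ finIntegral F r} :=
    isOpen_finIntegral.preimage (continuous_const_mul g⁻¹)
  refine Filter.mem_of_superset (h1.mem_nhds ?_) fun h hh => ?_
  · rw [Set.mem_ofPred_eq, inv_mul_cancel]
    exact one_mem_finIntegral
  · have := sheaf_mul_eq g hh
    rwa [mul_inv_cancel_left] at this

theorem continuous_infCoord (v : InfinitePlace F) (x : Fin r → F) (i : Fin r) :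
    Continuous fun g : GA F r => infCoord g v x i := by
  simp only [infCoord_eq_toInfinite, Matrix.mulVec, dotProduct]
  exact (continuous_toInfinite v).comp
    (continuous_finsetSum _ fun j _ => (continuous_entry_inv i j).mul continuous_const)

theorem continuous_det_metricMatrix {κ : Type*} [Fintype κ] [DecidableEq κ]
    (s : κ → Fin r → F) (v : InfinitePlace F) :
    Continuous fun g : GA F r => (metricMatrix g s v).det := by
  refine Continuous.matrix_det (continuous_matrix fun i j => ?_)
  change Continuous fun g => metric g v (s i) (s j)
  simp only [metric_eq]
  exact continuous_finsetSum _ fun k _ =>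
    (continuous_infCoord v (s i) k).star.mul (continuous_infCoord v (s j) k)

/-- Near g the lattice, hence the family and the index in the definition of the degree, is constant.
Only the hermitian determinants vary, and they are continuous and nonzero. -/
theorem continuous_subDegree (W : Submodule F (Fin r → F)) :
    Continuous fun g : GA F r => subDegree g W := by
  rw [continuous_iff_continuousAt]
  intro g
  have h1 : ∀ᶠ h in 𝓝 g, arakelovDegree (latt g W) (metric h) = subDegree h W := by
    filter_upwards [eventually_sheaf_eq g] with h hh
    rw [subDegree_eq_latt, latt, latt, hh]
  refine ContinuousAt.congr ?_ h1
  refine continuousAt_const.sub (tendsto_finsetSum _ fun v _ => ?_)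
  refine tendsto_const_nhds.mul (tendsto_const_nhds.mul ?_)
  refine ContinuousAt.log ?_ ?_
  · exact (continuous_det_metricMatrix (maxFamily (latt g W)) v).norm.continuousAt
  · exact norm_ne_zero_iff.2 (det_metricMatrix_ne_zero g v (maxFamily_spec (latt g W)).2.2)

theorem continuous_degree : Continuous (degree : GA F r → ℝ) := by
  have h : (degree : GA F r → ℝ) = fun g => subDegree g ⊤ :=
    funext fun g => (subDegree_top g).symm
  rw [h]
  exact continuous_subDegree ⊤

end Continuity

/-! ### Index of a lattice scaled by an idele -/

section Scaling

variable {F : Type*} [Field F] [NumberField F] {r : ℕ}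

omit [NumberField F] in
theorem span_singles_le_iff {k : ℕ} (s : Fin k → Fin r → F) (x : Fin r → F) :
    x ∈ Submodule.span (𝓞 F) (Set.range s) ↔ ∃ y : Fin k → 𝓞 F, ∑ i, (y i : F) • s i = x :=
  Submodule.mem_span_range_iff_exists_fun (𝓞 F)

/-- Comparison of two lattices in `W` that differ by an integral idele which is congruent to `1`
modulo the exponent of the quotient by a free sublattice. -/
theorem relIndex_latt_scale {g g' : GA F r} {a b : FinAdele F} (hab : a * b = 1)
    (ha : a ∈ finInt F) (hg' : ∀ x, finCoord g' x = b • finCoord g x) {n : 𝓞 F} (hn : n ≠ 0)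
    (han : algebraMap F (FinAdele F) (n : F)⁻¹ * (1 - a) ∈ finInt F)
    {W : Submodule F (Fin r → F)} {k : ℕ} {s : Fin k → Fin r → F} (hs : LinearIndependent F s)
    (hsL : ∀ i, s i ∈ latt g W)
    (hns : ∀ x ∈ latt g W, n • x ∈ Submodule.span (𝓞 F) (Set.range s)) :
    latt g' W ≤ latt g W ∧
    (latt g' W).toAddSubgroup.relIndex (latt g W).toAddSubgroup =
      (AddSubgroup.comap (algebraMap F (FinAdele F)).toAddMonoidHom
        ((finInt F).toAddSubgroup.comap (AddMonoidHom.mulLeft b)) |>.comap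
        (algebraMap (𝓞 F) F).toAddMonoidHom).index ^ k := by
  have hn' : (n : F) ≠ 0 := by exact_mod_cast hn
  set e := algebraMap F (FinAdele F) with he
  have hnn : e (n : F) * e (n : F)⁻¹ = 1 := algebraMap_mul_inv hn'
  set I : AddSubgroup (𝓞 F) := (AddSubgroup.comap e.toAddMonoidHom
        ((finInt F).toAddSubgroup.comap (AddMonoidHom.mulLeft b)) |>.comap
        (algebraMap (𝓞 F) F).toAddMonoidHom) with hI
  have memI : ∀ y : 𝓞 F, y ∈ I ↔ b * e (y : F) ∈ finInt F := fun y => Iff.rfl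
  have hmem' : ∀ x, x ∈ latt g' W ↔ (∀ i, b * finCoord g x i ∈ finInt F) ∧ x ∈ W := by
    intro x
    rw [mem_latt, mem_sheaf]
    simp only [hg', Pi.smul_apply, smul_eq_mul]
  have hle : latt g' W ≤ latt g W := by
    intro x hx
    rw [hmem'] at hx
    refine ⟨mem_sheaf.2 fun i => ?_, hx.2⟩
    have := mul_mem ha (hx.1 i)
    rwa [← mul_assoc, hab, one_mul] at this
  refine ⟨hle, ?_⟩
  have hfc : ∀ (c : F) (x : Fin r → F) i, finCoord g (c • x) i = e c * finCoord g x i :=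
    fun c x i => by rw [finCoord_smul]; rfl
  -- an integer close to `b`
  obtain ⟨γ, hγ⟩ := exists_approx b (one_ne_zero (α := 𝓞 F))
  have hγ' : e γ - b ∈ finInt F := by simpa using hγ
  -- Write L, L' for the two lattices, N for the span of s, and I for the ideal of integers
  -- divisible by a. If x is in L', then γx is in L, so the coordinates w = γy of nγx are integral.
  -- Since γ - b is integral, by is integral too, that is, y lies in I.
  have hNI : ∀ x ∈ latt g' W, ∀ y : Fin k → 𝓞 F, ∑ i, (y i : F) • s i = n • x →
      ∀ i, y i ∈ I := by
    intro x hx y hy i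
    have hγx : γ • x ∈ latt g W := by
      refine ⟨mem_sheaf.2 fun j => ?_, W.smul_mem _ hx.2⟩
      rw [hfc]
      have h1 := add_mem (((hmem' x).1 hx).1 j) (mul_mem hγ' (mem_sheaf.1 (hle hx).1 j))
      convert! h1 using 1
      ring
    obtain ⟨w, hw⟩ := (span_singles_le_iff s _).1 (hns _ hγx)
    have h2 : ∑ j, ((w j : F) - γ * y j) • s j = 0 := by
      simp only [sub_smul, Finset.sum_sub_distrib, mul_smul, ← Finset.smul_sum]
      rw [hw, hy]
      change (n : F) • γ • x - γ • (n : F) • x = 0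
      rw [smul_comm, sub_self]
    have h3 := sub_eq_zero.1 (Fintype.linearIndependent_iff.1 hs _ h2 i)
    rw [memI]
    have h4 : b * e (y i) = e (w i) - (e γ - b) * e (y i) := by
      rw [h3, map_mul]
      ring
    rw [h4]
    exact sub_mem (coe_mem_finInt _) (mul_mem hγ' (coe_mem_finInt _))
  -- an integer divisible by `a` and close to `1`
  obtain ⟨q, hq, hqb⟩ := exists_den b
  have hq' : (q : F) ≠ 0 := by exact_mod_cast hq
  obtain ⟨α, hα⟩ := exists_approx a (mul_ne_zero hn hq)
  set u := e ((n * q : 𝓞 F) : F)⁻¹ * (e α - a) with hu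
  have hαa : e α = a + e n * (e q * u) := by
    have h1 : e ((n * q : 𝓞 F) : F) * e ((n * q : 𝓞 F) : F)⁻¹ = 1 :=
      algebraMap_mul_inv (by rw [coe_integer_mul]; exact mul_ne_zero hn' hq')
    have h2 : e ((n * q : 𝓞 F) : F) = e n * e q := by rw [coe_integer_mul, map_mul]
    rw [← mul_assoc, ← h2, hu, ← mul_assoc, h1]
    ring
  -- The extra precision q, a denominator of b, keeps bα integral: bα = 1 + n(qb)u.
  have hbα : b * e α ∈ finInt F := by
    have h1 : b * e α = 1 + e n * ((e q * b) * u) := by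
      rw [hαa]
      linear_combination hab
    rw [h1]
    exact add_mem (one_mem _) (mul_mem (coe_mem_finInt _) (mul_mem hqb hα))
  obtain ⟨β, hβ⟩ : ∃ β : 𝓞 F, (1 : F) = α + n * β := by
    have h1 : e ((n : F)⁻¹ * (1 - α)) ∈ finInt F := by
      rw [map_mul, map_sub, map_one, hαa]
      have h2 : e (n : F)⁻¹ * (1 - (a + e n * (e q * u))) =
          e (n : F)⁻¹ * (1 - a) - e q * u := by
        linear_combination -(e q * u) * hnn
      rw [h2]
      exact sub_mem han (mul_mem (coe_mem_finInt _) hα)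
    obtain ⟨β, hβ⟩ := algebraMap_mem_finInt.1 h1
    refine ⟨β, ?_⟩
    have h3 : (β : F) = (n : F)⁻¹ * (1 - α) := hβ
    rw [h3, mul_inv_cancel_left₀ hn']
    ring
  let f : (Fin k → 𝓞 F) →+ (Fin r → F) :=
    (Fintype.linearCombination (𝓞 F) s).toAddMonoidHom
  have hf : ∀ y, f y = ∑ i, (y i : F) • s i := fun y => rfl
  have hrange : AddSubgroup.map f ⊤ = (Submodule.span (𝓞 F) (Set.range s)).toAddSubgroup := by
    ext x
    rw [AddSubgroup.mem_map]
    constructor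
    · rintro ⟨y, -, rfl⟩
      exact (span_singles_le_iff s _).2 ⟨y, rfl⟩
    · intro hx
      obtain ⟨y, hy⟩ := (span_singles_le_iff s _).1 hx
      exact ⟨y, trivial, hy⟩
  have hcomap : AddSubgroup.comap f (latt g' W).toAddSubgroup =
      AddSubgroup.pi Set.univ fun _ => I := by
    ext y
    rw [AddSubgroup.mem_comap, AddSubgroup.mem_pi]
    constructor
    · intro hy i _
      have h1 : f y ∈ latt g' W := hy
      have h2 := hNI _ h1 (fun i => n * y i) (by
        rw [hf]
        change _ = (n : F) • ∑ j, (y j : F) • s j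
        rw [Finset.smul_sum]
        exact Finset.sum_congr rfl fun j _ => by rw [coe_integer_mul, mul_smul]) i
      rw [memI, coe_integer_mul, map_mul] at h2
      -- Here the congruence a ≡ 1 modulo n enters: by ab = 1, the element by equals y plus (1 -
      -- a)/n times b(ny).
      have h3 : b * e (y i) = e (y i) +
          (e (n : F)⁻¹ * (1 - a)) * (b * (e n * e (y i))) := by
        linear_combination (e (y i)) * hab - (1 - a) * b * e (y i) * hnn
      rw [memI, h3]
      exact add_mem (coe_mem_finInt _) (mul_mem han h2)
    · intro hy
      change f y ∈ latt g' W
      rw [hf]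
      refine sum_mem fun i _ => ?_
      rw [hmem']
      refine ⟨fun j => ?_, W.smul_mem _ (hsL i).2⟩
      rw [hfc, ← mul_assoc]
      exact mul_mem (hy i trivial) (mem_sheaf.1 (hsL i).1 j)
  -- Since 1 = α + nβ, every x in L is αx + β(nx), with αx in L' and nx in N.
  have hsup : (latt g' W).toAddSubgroup ⊔ (Submodule.span (𝓞 F) (Set.range s)).toAddSubgroup =
      (latt g W).toAddSubgroup := by
    refine le_antisymm (sup_le hle ?_) fun x hx => ?_
    · change Submodule.span (𝓞 F) (Set.range s) ≤ latt g W
      rw [Submodule.span_le]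
      rintro _ ⟨i, rfl⟩
      exact hsL i
    · have hx' : x ∈ latt g W := hx
      rw [AddSubgroup.mem_sup]
      refine ⟨α • x, ?_, β • n • x, Submodule.smul_mem _ β (hns x hx'), ?_⟩
      · change α • x ∈ latt g' W
        rw [hmem']
        refine ⟨fun i => ?_, W.smul_mem _ hx'.2⟩
        rw [hfc, ← mul_assoc]
        exact mul_mem hbα (mem_sheaf.1 hx'.1 i)
      · change α • x + (β : F) • (n : F) • x = x
        rw [smul_smul, ← add_smul, mul_comm (β : F), ← hβ, one_smul]
  -- Second isomorphism theorem: [L : L'] = [N : N ∩ L'], and in the coordinates of N the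
  -- intersection is I^k.
  rw [← hsup, AddSubgroup.relIndex_sup_left, ← hrange, ← AddSubgroup.relIndex_comap, hcomap,
    AddSubgroup.relIndex_top_right, AddSubgroup.index_pi, Finset.prod_const, Finset.card_univ,
    Fintype.card_fin]

end Scaling

end GeoTrunc

namespace GeoTrunc

/-! ### Degrees under multiplication by the centre -/

section CentralScaling

variable {F : Type*} [Field F] [NumberField F] {r : ℕ}

theorem metricMatrix_scale {g g' : GA F r} {v : InfinitePlace F} {t : ℂ}
    (h : ∀ x, infCoord g' v x = t • infCoord g v x) {κ : Type*} [Fintype κ] [DecidableEq κ]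
    (s : κ → Fin r → F) :
    ‖(metricMatrix g' s v).det‖ = (‖t‖ ^ 2) ^ Fintype.card κ * ‖(metricMatrix g s v).det‖ := by
  have h1 : metricMatrix g' s v = (star t * t) • metricMatrix g s v := by
    ext i j
    change metric g' v _ _ = (star t * t) * metric g v _ _
    rw [metric_eq, metric_eq, Finset.mul_sum]
    refine Finset.sum_congr rfl fun l _ => ?_
    rw [h, h, Pi.smul_apply, Pi.smul_apply, smul_eq_mul, smul_eq_mul, star_mul']
    ring
  rw [h1, Matrix.det_smul, norm_mul, norm_pow, norm_mul, norm_star, sq]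

theorem arakelovDegree_scale {L : Submodule (𝓞 F) (Fin r → F)} (hL : L.FG) {g g' : GA F r}
    {t : InfinitePlace F → ℂ} (ht : ∀ v, t v ≠ 0)
    (h : ∀ v x, infCoord g' v x = t v • infCoord g v x) :
    arakelovDegree L (metric g') = arakelovDegree L (metric g) -
      Module.finrank F (Submodule.span F (L : Set (Fin r → F))) *
        ∑ v : InfinitePlace F, (v.mult : ℝ) * Real.log ‖t v‖ := by
  obtain ⟨h1, h2, h3⟩ := maxFamily_spec L
  rw [(arakelovDegree_eq_family hL g' h3 h1 h2).2, (arakelovDegree_eq_family hL g h3 h1 h2).2,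
    sub_sub, Finset.mul_sum, ← Finset.sum_add_distrib]
  congr 1
  refine Finset.sum_congr rfl fun v _ => ?_
  have h4 := norm_ne_zero_iff.2 (det_metricMatrix_ne_zero g v h3)
  have h5 : ‖t v‖ ≠ 0 := norm_ne_zero_iff.2 (ht v)
  rw [metricMatrix_scale (h v), Real.log_mul (by positivity) h4, Real.log_pow, Real.log_pow,
    Fintype.card_fin]
  push_cast
  ring

theorem arakelovDegree_sublattice {L L' : Submodule (𝓞 F) (Fin r → F)} (hL : L.FG)
    (hL' : L'.FG) (hle : L' ≤ L)
    (hspan : Submodule.span F (L' : Set (Fin r → F)) = Submodule.span F (L : Set (Fin r → F)))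
    (g : GA F r) :
    arakelovDegree L' (metric g) = arakelovDegree L (metric g) -
      Real.log (L'.toAddSubgroup.relIndex L.toAddSubgroup) := by
  obtain ⟨β, hβ⟩ := exists_isIntBasis hL (ι := Fin (Module.finrank ℚ
    (Submodule.span F (L : Set (Fin r → F))))) (by simp)
  obtain ⟨β', hβ'⟩ := exists_isIntBasis hL' (ι := Fin (Module.finrank ℚ
    (Submodule.span F (L : Set (Fin r → F))))) (by rw [hspan, Fintype.card_fin])
  obtain ⟨h1, h2⟩ := arakelovDegree_eq_covolume g hβ
  obtain ⟨h1', h2'⟩ := arakelovDegree_eq_covolume g hβ'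
  have h3 := gramDet_eq_relIndex_sq_mul (euclid g) hβ.1 hβ'.1
    (by rw [hβ.2, hβ'.2]; exact hle)
  rw [relIndex_eq_of_span hβ.2 hβ'.2] at h3
  have h4 : ((L'.toAddSubgroup.relIndex L.toAddSubgroup : ℕ) : ℝ) ≠ 0 := by
    intro h0
    rw [h0] at h3
    simp [h3] at h1'
  rw [h2, h2', hspan, h3, Real.log_mul (pow_ne_zero 2 h4) h1.ne', Real.log_pow]
  push_cast
  ring

/-- The finite index of a free sublattice kills the quotient. -/
theorem exists_exponent (g : GA F r) (W : Submodule F (Fin r → F)) :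
    ∃ s : Fin (Module.finrank F W) → Fin r → F, LinearIndependent F s ∧ (∀ i, s i ∈ latt g W) ∧
      ∃ n : 𝓞 F, n ≠ 0 ∧ ∀ x ∈ latt g W, n • x ∈ Submodule.span (𝓞 F) (Set.range s) := by
  have h := maxFamily_spec (latt g W)
  obtain ⟨s, h1, h2, h3⟩ : ∃ s : Fin (Module.finrank F W) → Fin r → F,
      (∀ i, s i ∈ latt g W) ∧ Submodule.span F (Set.range s) =
        Submodule.span F (latt g W : Set (Fin r → F)) ∧ LinearIndependent F s := by
    have h0 : Module.finrank F (Submodule.span F (latt g W : Set (Fin r → F))) =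
      Module.finrank F W := by rw [span_latt]
    rw [← h0]
    exact ⟨_, h⟩
  refine ⟨s, h3, h1, ?_⟩
  have h4 := (arakelovDegree_eq_family (latt_fg g W) g h3 h1 h2).1
  set H := (Submodule.span (𝓞 F) (Set.range s)).toAddSubgroup
  refine ⟨((H.relIndex (latt g W).toAddSubgroup : ℕ) : 𝓞 F), by exact_mod_cast h4, fun x hx => ?_⟩
  have h5 := AddSubgroup.nsmul_index_mem (H.addSubgroupOf (latt g W).toAddSubgroup) ⟨x, hx⟩
  rw [AddSubgroup.mem_addSubgroupOf] at h5
  rw [Nat.cast_smul_eq_nsmul]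
  exact h5

/-- A pair of adelic matrices that differ by a scalar idele, with the components of the inverse of
this idele. -/
structure IsScaling (g g' : GA F r) (b : FinAdele F) (t : InfinitePlace F → ℂ) : Prop where
  fin : ∀ x, finCoord g' x = b • finCoord g x
  inf : ∀ v x, infCoord g' v x = t v • infCoord g v x

/-- The index is the (dim W)-th power of an index in 𝓞_F determined by the idele alone. The change
of degree is thus dim W times a constant common to all g and W whose quotient is killed by n. -/
theorem subDegree_scale_of_congr {a b : FinAdele F} (hab : a * b = 1) (ha : a ∈ finInt F)
    {n : 𝓞 F} (hn : n ≠ 0) (han : algebraMap F (FinAdele F) (n : F)⁻¹ * (1 - a) ∈ finInt F)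
    {t : InfinitePlace F → ℂ} (ht : ∀ v, t v ≠ 0) :
    ∃ C : ℝ, ∀ (g g' : GA F r), IsScaling g g' b t → ∀ (W : Submodule F (Fin r → F))
      (s : Fin (Module.finrank F W) → Fin r → F), LinearIndependent F s →
      (∀ i, s i ∈ latt g W) →
      (∀ x ∈ latt g W, n • x ∈ Submodule.span (𝓞 F) (Set.range s)) →
      subDegree g' W = subDegree g W + Module.finrank F W * C := by
  refine ⟨-Real.log ((AddSubgroup.comap (algebraMap F (FinAdele F)).toAddMonoidHom
        ((finInt F).toAddSubgroup.comap (AddMonoidHom.mulLeft b)) |>.comap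
        (algebraMap (𝓞 F) F).toAddMonoidHom).index : ℝ) -
        ∑ v : InfinitePlace F, (v.mult : ℝ) * Real.log ‖t v‖,
    fun g g' hgg W s hs hsL hns => ?_⟩
  obtain ⟨h1, h2⟩ := relIndex_latt_scale hab ha hgg.fin hn han hs hsL hns
  rw [subDegree_eq_latt, subDegree_eq_latt, arakelovDegree_scale (latt_fg g' W) ht hgg.inf,
    arakelovDegree_sublattice (latt_fg g W) (latt_fg g' W) h1 (by rw [span_latt, span_latt]),
    h2, span_latt]
  push_cast
  rw [Real.log_pow]
  ring

/-- If c in F is sufficiently close to b = a⁻¹, then ca is congruent to 1. The precision mn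
compensates for the denominator m of a. -/
theorem exists_congr_one {a b : FinAdele F} (hab : a * b = 1) {n : 𝓞 F} (hn : n ≠ 0) :
    ∃ c : F, c ≠ 0 ∧ algebraMap F (FinAdele F) c * a ∈ finInt F ∧
      algebraMap F (FinAdele F) (n : F)⁻¹ * (1 - algebraMap F (FinAdele F) c * a) ∈ finInt F := by
  have hn' : (n : F) ≠ 0 := by exact_mod_cast hn
  have hnn := algebraMap_mul_inv hn'
  obtain ⟨m, hm, hma⟩ := exists_den a
  have hm' : (m : F) ≠ 0 := by exact_mod_cast hm
  have hmm := algebraMap_mul_inv hm'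
  set e := algebraMap F (FinAdele F)
  obtain ⟨c, hc⟩ := exists_approx b (mul_ne_zero hm hn)
  have h1 : e (n : F)⁻¹ * (1 - e c * a) ∈ finInt F := by
    have h2 := neg_mem (mul_mem hma hc)
    convert! h2 using 1
    rw [coe_integer_mul, mul_inv, map_mul]
    linear_combination (a * (e c - b) * e (n : F)⁻¹) * hmm - e (n : F)⁻¹ * hab
  have h2 : e c * a ∈ finInt F := by
    have h3 := sub_mem (one_mem (finInt F)) (mul_mem (coe_mem_finInt n) h1)
    convert! h3 using 1
    linear_combination (1 - e c * a) * hnn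
  -- The value c = 0 can occur only if n⁻¹ is integral. Then the congruence is no condition beyond
  -- integrality, and the denominator m serves as c.
  rcases eq_or_ne c 0 with rfl | hc0
  · rw [map_zero, zero_mul, sub_zero, mul_one] at h1
    exact ⟨m, hm', hma, mul_mem h1 (sub_mem (one_mem _) hma)⟩
  · exact ⟨c, hc0, h2, h1⟩

/-- The scalar matrix `c` in `GL_r(F)`. -/
noncomputable def scalarRat (r : ℕ) {c : F} (hc : c ≠ 0) : Matrix.GeneralLinearGroup (Fin r) F :=
  Units.map (Matrix.scalar (Fin r)).toMonoidHom (Units.mk0 c hc)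

omit [NumberField F] in
theorem linAut_scalarRat {c : F} (hc : c ≠ 0) (x : Fin r → F) :
    linAut (scalarRat r hc) x = c • x := by
  rw [linAut_apply]
  change (Matrix.scalar (Fin r) c).mulVec x = _
  rw [Matrix.scalar_apply, ← Matrix.smul_one_eq_diagonal, Matrix.smul_mulVec, Matrix.one_mulVec]

omit [NumberField F] in
theorem map_linAut_scalarRat {c : F} (hc : c ≠ 0) (W : Submodule F (Fin r → F)) :
    W.map (linAut (scalarRat r hc)).toLinearMap = W := by
  refine le_antisymm ?_ fun x hx => ?_
  · rintro _ ⟨x, hx, rfl⟩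
    change linAut (scalarRat r hc) x ∈ W
    rw [linAut_scalarRat]
    exact W.smul_mem c hx
  · refine ⟨c⁻¹ • x, W.smul_mem _ hx, ?_⟩
    change linAut (scalarRat r hc) _ = x
    rw [linAut_scalarRat, smul_inv_smul₀ hc]

theorem isScaling_scalarRat {c : F} (hc : c ≠ 0) (g : GA F r) :
    IsScaling g (diag F r (scalarRat r hc) * g) (algebraMap F (FinAdele F) c⁻¹)
      fun v => v.embedding c⁻¹ := by
  have h : ∀ x : Fin r → F,
      x = (scalarRat r hc : Matrix (Fin r) (Fin r) F).mulVec (c⁻¹ • x) := fun x => by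
    rw [← linAut_apply, linAut_scalarRat, smul_inv_smul₀ hc]
  constructor
  · intro x
    conv_lhs => rw [h x]
    rw [finCoord_diag_mul, finCoord_smul]
  · intro v x
    conv_lhs => rw [h x]
    rw [infCoord_diag_mul, infCoord_smul]

theorem IsScaling.trans {g g' g'' : GA F r} {b b' : FinAdele F} {t t' : InfinitePlace F → ℂ}
    (h : IsScaling g g' b t) (h' : IsScaling g' g'' b' t') :
    IsScaling g g'' (b' * b) fun v => t' v * t v :=
  ⟨fun x => by rw [h'.fin, h.fin, smul_smul], fun v x => by rw [h'.inf, h.inf, smul_smul]⟩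

/-- Scaling by a fixed idele changes the degree of all sublattices proportionally to the rank. -/
theorem exists_subDegree_scale {a b : FinAdele F} (hab : a * b = 1)
    {t : InfinitePlace F → ℂ} (ht : ∀ v, t v ≠ 0) {n : 𝓞 F} (hn : n ≠ 0) :
    ∃ C : ℝ, ∀ (g g' : GA F r), IsScaling g g' b t → ∀ (W : Submodule F (Fin r → F))
      (s : Fin (Module.finrank F W) → Fin r → F), LinearIndependent F s →
      (∀ i, s i ∈ latt g W) →
      (∀ x ∈ latt g W, n • x ∈ Submodule.span (𝓞 F) (Set.range s)) →
      subDegree g' W = subDegree g W + Module.finrank F W * C := by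
  -- A rational scalar preserves every W and every degree, so a may be replaced by ca, which is
  -- integral and congruent to 1 modulo n.
  obtain ⟨c, hc, hca, hcn⟩ := exists_congr_one hab hn
  have hcc := algebraMap_mul_inv hc
  obtain ⟨C, hC⟩ := subDegree_scale_of_congr (r := r)
    (b := algebraMap F (FinAdele F) c⁻¹ * b) (by linear_combination hab + a * b * hcc) hca hn hcn
    (t := fun v => v.embedding c⁻¹ * t v)
    (fun v => mul_ne_zero ((map_ne_zero _).2 (inv_ne_zero hc)) (ht v))
  refine ⟨C, fun g g' hgg W s hs hsL hns => ?_⟩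
  have h1 := hC g _ (hgg.trans (isScaling_scalarRat hc g')) W s hs hsL hns
  have h2 := subDegree_diag_mul (scalarRat r hc) g' W
  rw [map_linAut_scalarRat] at h2
  rw [← h2, h1]

theorem isScaling_of_mem_center {z : GA F r} (hz : z ∈ Subgroup.center (GA F r)) (hr : 0 < r) :
    ∃ (a b : FinAdele F) (t : InfinitePlace F → ℂ), a * b = 1 ∧ (∀ v, t v ≠ 0) ∧
      ∀ g, IsScaling g (z * g) b t := by
  obtain ⟨α, hα⟩ := Matrix.GeneralLinearGroup.mem_center_iff_val_mem_range_scalar.1 hz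
  obtain ⟨β, hβ⟩ := Matrix.GeneralLinearGroup.mem_center_iff_val_mem_range_scalar.1 (inv_mem hz)
  have hαβ : α * β = 1 := by
    have h1 : Matrix.scalar (Fin r) (α * β) = 1 := by
      rw [map_mul, hα, hβ, ← Units.val_mul, mul_inv_cancel, Units.val_one]
    have h2 := congrFun (congrFun h1 ⟨0, hr⟩) ⟨0, hr⟩
    simpa using h2
  refine ⟨toFinite F α, toFinite F β, fun v => toInfinite v β, by rw [← map_mul, hαβ, map_one],
    fun v h0 => ?_, fun g => ?_⟩
  · have := congrArg (toInfinite v) hαβ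
    have h0 : toInfinite v β = 0 := h0
    rw [map_mul, h0, mul_zero, map_one] at this
    exact zero_ne_one this
  have hcomm : z * g = g * z := (Subgroup.mem_center_iff.1 hz g).symm
  rw [hcomm]
  constructor
  · intro x
    have h1 : (((finPart z)⁻¹ : Matrix.GeneralLinearGroup (Fin r) (FinAdele F)) :
        Matrix (Fin r) (Fin r) (FinAdele F)) = toFinite F β • 1 := by
      ext i j
      rw [finPart_inv_apply, ← hβ, Matrix.smul_apply, Matrix.scalar_apply, Matrix.diagonal_apply,
        Matrix.one_apply]
      split_ifs <;> simp
    rw [finCoord_mul, h1, Matrix.smul_mulVec, Matrix.one_mulVec]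
  · intro v x
    have h1 : (((infPart z v)⁻¹ : Matrix.GeneralLinearGroup (Fin r) ℂ) :
        Matrix (Fin r) (Fin r) ℂ) = toInfinite v β • 1 := by
      ext i j
      rw [infPart_inv_apply, ← hβ, Matrix.smul_apply, Matrix.scalar_apply, Matrix.diagonal_apply,
        Matrix.one_apply]
      split_ifs <;> simp
    rw [infCoord_mul, h1, Matrix.smul_mulVec, Matrix.one_mulVec]

theorem degree_one : degree (1 : GA F r) = 0 := by
  have hL : sheaf (1 : GA F r) =
      Submodule.span (𝓞 F) (Set.range fun i : Fin r => (Pi.single i 1 : Fin r → F)) := by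
    ext x
    have h1 : finCoord (1 : GA F r) x = fun j => algebraMap F (FinAdele F) (x j) := by
      have h2 : finPart (1 : GA F r) = 1 := map_one _
      rw [finCoord, h2, inv_one, Units.val_one, Matrix.one_mulVec]
    rw [mem_sheaf, h1, span_singles_le_iff]
    simp only [algebraMap_mem_finInt]
    constructor
    · intro h
      choose y hy using h
      refine ⟨y, ?_⟩
      ext i
      simp only [Finset.sum_apply, Pi.smul_apply, Pi.single_apply, smul_eq_mul]
      simp [hy]
    · rintro ⟨y, rfl⟩ i
      refine ⟨y i, ?_⟩
      simp only [Finset.sum_apply, Pi.smul_apply, Pi.single_apply, smul_eq_mul]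
      simp
  have hspan : Submodule.span F (Set.range fun i : Fin r => (Pi.single i 1 : Fin r → F)) = ⊤ := by
    have := (Pi.basisFun F (Fin r)).span_eq
    convert! this using 3
    ext1 i
    simp
  have hLI : LinearIndependent F fun i : Fin r => (Pi.single i 1 : Fin r → F) := by
    have := (Pi.basisFun F (Fin r)).linearIndependent
    convert! this using 1
    ext1 i
    simp
  rw [degree, (arakelovDegree_eq_family (sheaf_fg 1) 1 hLI ?_ ?_).2, ← hL,
    AddSubgroup.relIndex_self, Nat.cast_one, Real.log_one, zero_sub, neg_eq_zero]
  · refine Finset.sum_eq_zero fun v _ => ?_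
    have h1 : metricMatrix (1 : GA F r) (fun i : Fin r => (Pi.single i 1 : Fin r → F)) v = 1 := by
      have h3 : ∀ x : Fin r → F, infCoord (1 : GA F r) v x = fun j => v.embedding (x j) := by
        intro x
        have h2 : infPart (1 : GA F r) v = 1 := map_one _
        rw [infCoord, h2, inv_one, Units.val_one, Matrix.one_mulVec]
      ext i j
      change metric _ v _ _ = _
      rw [metric_eq, h3, h3, Matrix.one_apply]
      simp only [Pi.single_apply, apply_ite v.embedding, map_one, map_zero]
      simp [eq_comm]
    rw [h1]
    simp
  · intro i
    rw [hL]
    exact Submodule.subset_span ⟨i, rfl⟩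
  · rw [hspan]
    have h1 := span_latt (1 : GA F r) ⊤
    rw [latt, Submodule.restrictScalars_top, inf_top_eq] at h1
    exact h1.symm

/-- One exponent nn' kills the quotients for both (g, W) and (1, F^r), so both changes of degree
involve the same constant. The second case, where the initial degree is 0, identifies this constant
as deg z / r. -/
theorem subDegree_center_mul {z : GA F r} (hz : z ∈ Subgroup.center (GA F r)) (hr : 0 < r)
    (g : GA F r) (W : Submodule F (Fin r → F)) :
    subDegree (z * g) W = subDegree g W + Module.finrank F W * (degree z / r) := by
  obtain ⟨a, b, t, hab, ht, hscal⟩ := isScaling_of_mem_center hz hr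
  obtain ⟨s, hs, hsL, n, hn, hns⟩ := exists_exponent g W
  obtain ⟨s', hs', hsL', n', hn', hns'⟩ := exists_exponent (1 : GA F r) ⊤
  obtain ⟨C, hC⟩ := exists_subDegree_scale (r := r) hab ht (mul_ne_zero hn hn')
  have h1 := hC g _ (hscal g) W s hs hsL fun x hx => by
    rw [mul_comm, mul_smul]
    exact Submodule.smul_mem _ _ (hns x hx)
  have h2 := hC 1 _ (hscal 1) ⊤ s' hs' hsL' fun x hx => by
    rw [mul_smul]
    exact Submodule.smul_mem _ _ (hns' x hx)
  rw [mul_one, subDegree_top, subDegree_top, degree_one, finrank_top, Module.finrank_fin_fun,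
    zero_add] at h2
  have hr' : (r : ℝ) ≠ 0 := by exact_mod_cast hr.ne'
  rw [h1, h2, mul_div_cancel_left₀ _ hr']

theorem degree_center_mul {z : GA F r} (hz : z ∈ Subgroup.center (GA F r)) (hr : 0 < r)
    (g : GA F r) : degree (z * g) = degree g + degree z := by
  have h := subDegree_center_mul hz hr g ⊤
  have hr' : (r : ℝ) ≠ 0 := by exact_mod_cast hr.ne'
  rwa [subDegree_top, subDegree_top, finrank_top, Module.finrank_fin_fun,
    mul_div_cancel₀ _ hr'] at h

end CentralScaling

end GeoTrunc

namespace GeoTrunc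

/-! ### The split component of the centre -/

section SplitCenter

variable {F : Type*} [Field F] [NumberField F] {r : ℕ}

omit [NumberField F] in
theorem exists_extensionEmbedding_eq (v : InfinitePlace F) (t : ℝ) :
    ∃ x : v.Completion, InfinitePlace.Completion.extensionEmbedding v x = t := by
  rcases v.isReal_or_isComplex with hv | hv
  · obtain ⟨x, hx⟩ := (InfinitePlace.Completion.ringEquivRealOfIsReal hv).surjective t
    refine ⟨x, ?_⟩
    rw [← InfinitePlace.Completion.extensionEmbeddingOfIsReal_apply hv]
    exact congrArg Complex.ofReal hx
  · exact (InfinitePlace.Completion.ringEquivComplexOfIsComplex hv).surjective (t : ℂ)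

/-- The adele with component `1` at all finite places and `t` at all infinite places. -/
noncomputable def realAdele (F : Type*) [Field F] [NumberField F] (t : ℝ) : Adele F :=
  (fun v => (exists_extensionEmbedding_eq v t).choose, 1)

theorem toInfinite_realAdele (v : InfinitePlace F) (t : ℝ) :
    toInfinite v (realAdele F t) = t := (exists_extensionEmbedding_eq v t).choose_spec

theorem toFinite_realAdele (t : ℝ) : toFinite F (realAdele F t) = 1 := rfl

theorem adele_ext {a b : Adele F} (h : ∀ v, toInfinite v a = toInfinite v b)
    (h' : toFinite F a = toFinite F b) : a = b :=
  Prod.ext (funext fun v => (InfinitePlace.Completion.extensionEmbedding v).injective (h v)) h'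

theorem realAdele_mul (s t : ℝ) : realAdele F s * realAdele F t = realAdele F (s * t) := by
  refine adele_ext (fun v => ?_) ?_
  · rw [map_mul, toInfinite_realAdele, toInfinite_realAdele, toInfinite_realAdele,
      Complex.ofReal_mul]
  · rw [map_mul, toFinite_realAdele, toFinite_realAdele, toFinite_realAdele, one_mul]

theorem realAdele_one : realAdele F 1 = 1 := by
  refine adele_ext (fun v => ?_) ?_
  · rw [toInfinite_realAdele, map_one, Complex.ofReal_one]
  · rw [toFinite_realAdele, map_one]

theorem continuous_realAdele : Continuous (realAdele F) := by
  refine Continuous.prodMk (continuous_pi fun v => ?_) continuous_const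
  rw [(InfinitePlace.Completion.isometry_extensionEmbedding v).isEmbedding.continuous_iff]
  have : (InfinitePlace.Completion.extensionEmbedding v ∘
      fun t : ℝ => (realAdele F t).1 v) = Complex.ofReal := by
    ext1 t
    exact toInfinite_realAdele v t
  exact (congrArg Continuous this).mpr Complex.continuous_ofReal

/-- The element of the split component of the centre with parameter `exp t`. -/
noncomputable def splitElt (F : Type*) [Field F] [NumberField F] (r : ℕ) (t : ℝ) : GA F r where
  val := Matrix.scalar (Fin r) (realAdele F (Real.exp t))
  inv := Matrix.scalar (Fin r) (realAdele F (Real.exp (-t)))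
  val_inv := by
    rw [← map_mul, realAdele_mul, ← Real.exp_add, add_neg_cancel, Real.exp_zero, realAdele_one,
      map_one]
  inv_val := by
    rw [← map_mul, realAdele_mul, ← Real.exp_add, neg_add_cancel, Real.exp_zero, realAdele_one,
      map_one]

theorem continuous_splitElt : Continuous (splitElt F r) := by
  rw [Units.continuous_iff]
  have h : Continuous fun a : Adele F => Matrix.scalar (Fin r) a := by
    refine continuous_matrix fun i j => ?_
    simp only [Matrix.scalar_apply, Matrix.diagonal_apply]
    split_ifs
    · exact continuous_id
    · exact continuous_const
  exact ⟨h.comp (continuous_realAdele.comp Real.continuous_exp),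
    h.comp (continuous_realAdele.comp (Real.continuous_exp.comp continuous_neg))⟩

theorem splitElt_mem_center (t : ℝ) : splitElt F r t ∈ Subgroup.center (GA F r) :=
  Matrix.GeneralLinearGroup.mem_center_iff_val_mem_range_scalar.2 ⟨_, rfl⟩

theorem finPart_splitElt (t : ℝ) : finPart (splitElt F r t) = 1 := by
  refine Units.ext (Matrix.ext fun i j => ?_)
  change toFinite F (Matrix.scalar (Fin r) (realAdele F (Real.exp t)) i j) =
    (1 : Matrix (Fin r) (Fin r) (FinAdele F)) i j
  rw [Matrix.scalar_apply, Matrix.diagonal_apply, Matrix.one_apply, apply_ite (toFinite F),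
    toFinite_realAdele, map_zero]

theorem infPart_splitElt (t : ℝ) (v : InfinitePlace F) :
    (infPart (splitElt F r t) v : Matrix (Fin r) (Fin r) ℂ) = (Real.exp t : ℂ) • 1 := by
  ext i j
  change toInfinite v (Matrix.scalar (Fin r) (realAdele F (Real.exp t)) i j) = _
  rw [Matrix.scalar_apply, Matrix.diagonal_apply, Matrix.smul_apply, Matrix.one_apply,
    apply_ite (toInfinite v), toInfinite_realAdele, map_zero]
  simp

theorem splitElt_mem (t : ℝ) : splitElt F r t ∈ splitCenter F r :=
  ⟨finPart_splitElt t, Real.exp t, Real.exp_pos t, fun v => infPart_splitElt t v⟩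

theorem GA_ext {g h : GA F r} (h1 : finPart g = finPart h) (h2 : ∀ v, infPart g v = infPart h v) :
    g = h := by
  refine Units.ext (Matrix.ext fun i j => adele_ext (fun v => ?_) ?_)
  · exact congrArg (fun u : Matrix.GeneralLinearGroup (Fin r) ℂ =>
      (u : Matrix (Fin r) (Fin r) ℂ) i j) (h2 v)
  · exact congrArg (fun u : Matrix.GeneralLinearGroup (Fin r) (FinAdele F) =>
      (u : Matrix (Fin r) (Fin r) (FinAdele F)) i j) h1

theorem exists_splitElt {a : GA F r} (ha : a ∈ splitCenter F r) : ∃ t, a = splitElt F r t := by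
  obtain ⟨h1, t, ht, h2⟩ := ha
  refine ⟨Real.log t, GA_ext (h1.trans (finPart_splitElt _).symm) fun v => Units.ext ?_⟩
  rw [h2, infPart_splitElt, Real.exp_log ht]

theorem splitCenter_le_center : splitCenter F r ≤ Subgroup.center (GA F r) := by
  intro a ha
  obtain ⟨t, rfl⟩ := exists_splitElt ha
  exact splitElt_mem_center t

theorem isScaling_splitElt (t : ℝ) (g : GA F r) :
    IsScaling g (splitElt F r t * g) 1 fun _ => (Real.exp (-t) : ℂ) := by
  have hcomm : splitElt F r t * g = g * splitElt F r t :=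
    (Subgroup.mem_center_iff.1 (splitElt_mem_center t) g).symm
  rw [hcomm]
  constructor
  · intro x
    rw [finCoord_mul, finPart_splitElt, inv_one, Units.val_one, Matrix.one_mulVec, one_smul]
  · intro v x
    have h1 : (((infPart (splitElt F r t) v)⁻¹ : Matrix.GeneralLinearGroup (Fin r) ℂ) :
        Matrix (Fin r) (Fin r) ℂ) = (Real.exp (-t) : ℂ) • 1 := by
      refine Units.inv_eq_of_mul_eq_one_right ?_
      rw [infPart_splitElt, smul_mul_smul_comm, one_mul, ← Complex.ofReal_mul, ← Real.exp_add,
        add_neg_cancel, Real.exp_zero, Complex.ofReal_one, one_smul]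
    rw [infCoord_mul, h1, Matrix.smul_mulVec, Matrix.one_mulVec]

/-- The finite part is untouched, so the lattice stays the same. All metrics are scaled by e^(-2t),
and the multiplicities of the places add up to [F : ℚ]. -/
theorem degree_splitElt_mul (t : ℝ) (g : GA F r) :
    degree (splitElt F r t * g) = degree g + r * Module.finrank ℚ F * t := by
  have hs := isScaling_splitElt t g
  have hsheaf : sheaf (splitElt F r t * g) = sheaf g := by
    ext x
    rw [mem_sheaf, mem_sheaf, hs.fin, one_smul]
  have hspan : Submodule.span F (sheaf g : Set (Fin r → F)) = ⊤ := by
    have h1 := span_latt g ⊤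
    rwa [latt, Submodule.restrictScalars_top, inf_top_eq] at h1
  have hmult : ∑ v : InfinitePlace F, (v.mult : ℝ) = Module.finrank ℚ F := by
    exact_mod_cast InfinitePlace.sum_mult_eq
  rw [degree, hsheaf, arakelovDegree_scale (sheaf_fg g)
    (fun _ => by exact_mod_cast (Real.exp_pos (-t)).ne') hs.inf, hspan, finrank_top,
    Module.finrank_fin_fun, ← degree, ← Finset.sum_mul, hmult, Complex.norm_real,
    Real.norm_of_nonneg (Real.exp_pos _).le, Real.log_exp]
  ring

end SplitCenter

end GeoTrunc

namespace GeoTrunc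

/-! ### Piecewise affine functions and concavity -/

section PiecewiseAffine

/-- The piecewise affine function with nodes `(R i, H i)`, constant outside `[R 0, R n]`. -/
noncomputable def piecewiseAffine (n : ℕ) (R H : Fin (n + 1) → ℝ) (x : ℝ) : ℝ :=
  ∑ i : Fin n, (H i.succ - H i.castSucc) / (R i.succ - R i.castSucc) *
    max 0 (min (x - R i.castSucc) (R i.succ - R i.castSucc))

theorem sum_fin_sub (n : ℕ) (f : Fin (n + 1) → ℝ) :
    ∑ i : Fin n, (f i.succ - f i.castSucc) = f (Fin.last n) - f 0 := by
  induction n with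
  | zero => simp
  | succ n ih =>
    rw [Fin.sum_univ_castSucc]
    have := ih fun i => f i.castSucc
    simp only [Fin.succ_castSucc]
    rw [this, Fin.succ_last]
    simp

theorem sum_fin_sub_lt (n : ℕ) (f : Fin (n + 1) → ℝ) (k : Fin (n + 1)) :
    ∑ i : Fin n, (if i.castSucc < k then f i.succ - f i.castSucc else 0) = f k - f 0 := by
  have h := sum_fin_sub n fun i => f (min i k)
  rw [min_eq_right (Fin.le_last k), min_eq_left (Fin.zero_le k)] at h
  rw [← h]
  refine Finset.sum_congr rfl fun i _ => ?_
  split_ifs with hi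
  · rw [min_eq_left hi.le, min_eq_left (Fin.castSucc_lt_iff_succ_le.1 hi)]
  · rw [not_lt] at hi
    rw [min_eq_right hi, min_eq_right (hi.trans (Fin.castSucc_le_succ i)), sub_self]

variable {n : ℕ} {R H : Fin (n + 1) → ℝ}

/-- In this form the clamped lengths of consecutive intervals telescope. -/
theorem clamp_eq {a b x : ℝ} (h : a ≤ b) :
    max 0 (min (x - a) (b - a)) = min x b - min x a := by
  rcases le_total x a with h1 | h1
  · rw [min_eq_left (by linarith), max_eq_left (by linarith), min_eq_left (h1.trans h),
      min_eq_left h1, sub_self]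
  · rcases le_total x b with h2 | h2
    · rw [min_eq_left (by linarith), max_eq_right (by linarith), min_eq_left h2, min_eq_right h1]
    · rw [min_eq_right (by linarith), max_eq_right (by linarith), min_eq_right h2,
        min_eq_right h1]

theorem piecewiseAffine_eq (hR : StrictMono R) {x : ℝ} (k : Fin n) (h1 : R k.castSucc ≤ x)
    (h2 : x ≤ R k.succ) : piecewiseAffine n R H x = H k.castSucc - H 0 +
      (H k.succ - H k.castSucc) / (R k.succ - R k.castSucc) * (x - R k.castSucc) := by
  have hd : ∀ i : Fin n, 0 < R i.succ - R i.castSucc := fun i =>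
    sub_pos.2 (hR (Fin.castSucc_lt_succ))
  rw [piecewiseAffine, ← sum_fin_sub_lt n H k.castSucc,
    ← Finset.sum_erase_add _ _ (Finset.mem_univ k)]
  have h3 : ∑ i : Fin n, (if i.castSucc < k.castSucc then H i.succ - H i.castSucc else 0) =
      ∑ i ∈ Finset.univ.erase k,
        (if i.castSucc < k.castSucc then H i.succ - H i.castSucc else 0) := by
    rw [← Finset.sum_erase_add _ _ (Finset.mem_univ k), if_neg (lt_irrefl _), add_zero]
  rw [h3]
  congr 1
  · refine Finset.sum_congr rfl fun i hi => ?_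
    split_ifs with hik
    · have h4 : R i.succ ≤ x := (hR.monotone (Fin.castSucc_lt_iff_succ_le.1 hik)).trans h1
      rw [min_eq_right (by linarith), max_eq_right (hd i).le, div_mul_cancel₀ _ (hd i).ne']
    · have hki : k < i := lt_of_le_of_ne (not_lt.1 hik) (Finset.ne_of_mem_erase hi).symm
      have h4 : x ≤ R i.castSucc := h2.trans (hR.monotone (Fin.succ_le_castSucc_iff.2 hki))
      rw [max_eq_left ((min_le_left _ _).trans (by linarith)), mul_zero]
  · rw [min_eq_left (by linarith), max_eq_right (by linarith)]

theorem exists_segment {x : ℝ} (hn : 0 < n) (h1 : R 0 ≤ x) (h2 : x ≤ R (Fin.last n)) :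
    ∃ k : Fin n, R k.castSucc ≤ x ∧ x ≤ R k.succ := by
  by_contra! hcon
  have h3 : ∀ k : Fin (n + 1), R k ≤ x := by
    intro k
    induction k using Fin.induction with
    | zero => exact h1
    | succ i ih => exact (hcon i ih).le
  obtain ⟨m, rfl⟩ : ∃ m, n = m + 1 := ⟨n - 1, by omega⟩
  exact absurd h2 (not_le.2 (by
    have := hcon (Fin.last m) (h3 _)
    rwa [Fin.succ_last] at this))

theorem piecewiseAffine_node (hR : StrictMono R) (hn : 0 < n) (k : Fin (n + 1)) :
    piecewiseAffine n R H (R k) = H k - H 0 := by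
  induction k using Fin.lastCases with
  | last =>
    obtain ⟨m, rfl⟩ : ∃ m, n = m + 1 := ⟨n - 1, by omega⟩
    have hlt : R (Fin.last m).castSucc < R (Fin.last m).succ := hR Fin.castSucc_lt_succ
    rw [← Fin.succ_last, piecewiseAffine_eq hR (Fin.last m) hlt.le le_rfl,
      div_mul_cancel₀ _ (sub_pos.2 hlt).ne']
    ring
  | cast k =>
    rw [piecewiseAffine_eq hR k le_rfl (hR Fin.castSucc_lt_succ).le, sub_self, mul_zero, add_zero]

theorem piecewiseAffine_of_le (hR : StrictMono R) {x : ℝ} (h : x ≤ R 0) :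
    piecewiseAffine n R H x = 0 := by
  refine Finset.sum_eq_zero fun i _ => ?_
  have : R 0 ≤ R i.castSucc := hR.monotone (Fin.zero_le _)
  rw [max_eq_left ((min_le_left _ _).trans (by linarith)), mul_zero]

theorem piecewiseAffine_of_ge (hR : StrictMono R) {x : ℝ} (h : R (Fin.last n) ≤ x) :
    piecewiseAffine n R H x = H (Fin.last n) - H 0 := by
  rw [← sum_fin_sub]
  refine Finset.sum_congr rfl fun i _ => ?_
  have h1 : R i.succ ≤ R (Fin.last n) := hR.monotone (Fin.le_last _)
  have h2 : R i.castSucc < R i.succ := hR Fin.castSucc_lt_succ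
  rw [min_eq_right (by linarith), max_eq_right (by linarith), div_mul_cancel₀ _ (by linarith)]

/-- A concave function that dominates the nodes dominates the piecewise affine function. -/
theorem piecewiseAffine_le {q : ℝ → ℝ} (hR : StrictMono R) (hn : 0 < n) (hH : H 0 = 0)
    (hq : ConcaveOn ℝ (Set.Icc (R 0) (R (Fin.last n))) q) (h : ∀ k, H k ≤ q (R k)) {x : ℝ}
    (hx : x ∈ Set.Icc (R 0) (R (Fin.last n))) : piecewiseAffine n R H x ≤ q x := by
  obtain ⟨k, h1, h2⟩ := exists_segment hn hx.1 hx.2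
  have hd : 0 < R k.succ - R k.castSucc := sub_pos.2 (hR Fin.castSucc_lt_succ)
  rw [piecewiseAffine_eq hR k h1 h2, hH, sub_zero]
  set b := (x - R k.castSucc) / (R k.succ - R k.castSucc) with hb
  have hb0 : 0 ≤ b := div_nonneg (by linarith) hd.le
  have hb1 : b ≤ 1 := (div_le_one hd).2 (by linarith)
  have hmem : ∀ j, R j ∈ Set.Icc (R 0) (R (Fin.last n)) := fun j =>
    ⟨hR.monotone (Fin.zero_le _), hR.monotone (Fin.le_last _)⟩
  have h3 := hq.2 (hmem k.castSucc) (hmem k.succ) (sub_nonneg.2 hb1) hb0 (by ring)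
  have hbx : b * (R k.succ - R k.castSucc) = x - R k.castSucc := div_mul_cancel₀ _ hd.ne'
  have h4 : (1 - b) • R k.castSucc + b • R k.succ = x := by
    simp only [smul_eq_mul]
    linarith
  rw [h4] at h3
  refine le_trans (le_of_eq ?_) ((add_le_add (mul_le_mul_of_nonneg_left (h k.castSucc)
    (sub_nonneg.2 hb1)) (mul_le_mul_of_nonneg_left (h k.succ) hb0)).trans h3)
  rw [hb]
  field_simp
  ring

variable {μ : Fin n → ℝ}

/-- Filling the intervals from the left is optimal when slopes decrease. For i < k, replacing d i by
the full length at excess slope μ i - μ k ≥ 0 only increases the sum; for i ≥ k, replacing μ i by μ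
k does, since d i ≥ 0. -/
theorem sum_slope_le (hμ : Antitone μ) (hH : ∀ i : Fin n, H i.succ - H i.castSucc =
      μ i * (R i.succ - R i.castSucc)) (hR0 : R 0 = 0) {d : Fin n → ℝ} (hd0 : ∀ i, 0 ≤ d i)
    (hd : ∀ i, d i ≤ R i.succ - R i.castSucc) (k : Fin n) :
    ∑ i, μ i * d i ≤ H k.castSucc - H 0 + μ k * (∑ i, d i - R k.castSucc) := by
  have h1 := sum_fin_sub_lt n H k.castSucc
  have h2 := sum_fin_sub_lt n R k.castSucc
  rw [hR0, sub_zero] at h2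
  rw [← h1, ← h2, ← Finset.sum_sub_distrib, Finset.mul_sum, ← Finset.sum_add_distrib]
  refine Finset.sum_le_sum fun i _ => ?_
  split_ifs with hi
  · have h3 : μ k ≤ μ i := hμ (le_of_lt hi)
    have := mul_nonneg (sub_nonneg.2 h3) (sub_nonneg.2 (hd i))
    rw [hH]
    nlinarith
  · have h3 : μ i ≤ μ k := hμ (not_lt.1 hi)
    have := mul_nonneg (sub_nonneg.2 h3) (hd0 i)
    nlinarith

theorem slope_eq (hR : StrictMono R) (hH : ∀ i : Fin n, H i.succ - H i.castSucc =
      μ i * (R i.succ - R i.castSucc)) (i : Fin n) :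
    (H i.succ - H i.castSucc) / (R i.succ - R i.castSucc) = μ i := by
  have : 0 < R i.succ - R i.castSucc := sub_pos.2 (hR Fin.castSucc_lt_succ)
  rw [hH, mul_div_cancel_right₀ _ this.ne']

theorem sum_slope_le_piecewiseAffine (hR : StrictMono R) (hn : 0 < n) (hμ : Antitone μ)
    (hH : ∀ i : Fin n, H i.succ - H i.castSucc = μ i * (R i.succ - R i.castSucc)) (hR0 : R 0 = 0)
    {d : Fin n → ℝ} (hd0 : ∀ i, 0 ≤ d i) (hd : ∀ i, d i ≤ R i.succ - R i.castSucc) :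
    ∑ i, μ i * d i ≤ piecewiseAffine n R H (∑ i, d i) := by
  have h0 : 0 ≤ ∑ i, d i := Finset.sum_nonneg fun i _ => hd0 i
  have h1 : ∑ i, d i ≤ R (Fin.last n) := by
    have := Finset.sum_le_sum fun i (_ : i ∈ Finset.univ) => hd i
    rwa [sum_fin_sub, hR0, sub_zero] at this
  obtain ⟨k, h2, h3⟩ := exists_segment hn (hR0.trans_le h0) h1
  rw [piecewiseAffine_eq hR k h2 h3, slope_eq hR hH]
  exact sum_slope_le hμ hH hR0 hd0 hd k

/-- By `sum_slope_le`, the function lies below the line through each of its segments, so it is the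
minimum of these lines. -/
theorem concaveOn_piecewiseAffine (hR : StrictMono R) (hn : 0 < n) (hμ : Antitone μ)
    (hH : ∀ i : Fin n, H i.succ - H i.castSucc = μ i * (R i.succ - R i.castSucc))
    (hR0 : R 0 = 0) :
    ConcaveOn ℝ (Set.Icc 0 (R (Fin.last n))) (piecewiseAffine n R H) := by
  have hle : ∀ x ∈ Set.Icc 0 (R (Fin.last n)), ∀ k : Fin n,
      piecewiseAffine n R H x ≤ H k.castSucc - H 0 + μ k * (x - R k.castSucc) := by
    intro x hx k
    have hlt : ∀ i : Fin n, R i.castSucc ≤ R i.succ := fun i => (hR Fin.castSucc_lt_succ).le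
    have h1 := sum_slope_le hμ hH hR0
      (d := fun i => max 0 (min (x - R i.castSucc) (R i.succ - R i.castSucc)))
      (fun i => le_max_left _ _)
      (fun i => max_le (sub_nonneg.2 (hlt i)) (min_le_right _ _)) k
    have h2 : ∑ i : Fin n, max 0 (min (x - R i.castSucc) (R i.succ - R i.castSucc)) = x := by
      simp only [fun i : Fin n => clamp_eq (x := x) (hlt i)]
      rw [sum_fin_sub n fun i => min x (R i), min_eq_left hx.2, hR0, min_eq_right hx.1, sub_zero]
    rw [h2] at h1
    refine le_trans (le_of_eq ?_) h1
    exact Finset.sum_congr rfl fun i _ => by rw [slope_eq hR hH]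
  refine ⟨convex_Icc _ _, fun x hx y hy a b ha hb hab => ?_⟩
  have hz := convex_Icc 0 (R (Fin.last n)) hx hy ha hb hab
  obtain ⟨k, h1, h2⟩ := exists_segment hn (hR0.trans_le hz.1) hz.2
  rw [piecewiseAffine_eq hR k h1 h2, slope_eq hR hH]
  have h3 := mul_le_mul_of_nonneg_left (hle x hx k) ha
  have h4 := mul_le_mul_of_nonneg_left (hle y hy k) hb
  simp only [smul_eq_mul]
  have h5 : a = 1 - b := by linarith
  subst h5
  nlinarith

end PiecewiseAffine

/-! ### The flag of greatest slopes -/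

section Slopes

variable {K V : Type*} [Field K] [AddCommGroup V] [Module K V] [FiniteDimensional K V]

/-- A height function on the subspaces of a vector space: supermodular, with finitely many
subspaces above any bound. -/
structure IsHeight (h : Submodule K V → ℝ) : Prop where
  supermodular : ∀ X Y, h X + h Y ≤ h (X ⊓ Y) + h (X ⊔ Y)
  bot : h ⊥ = 0
  finite : ∀ c, {W | c ≤ h W}.Finite

variable {h : Submodule K V → ℝ}

/-- W' has the greatest slope over W; the maximum exists because slopes at least that of ⊤ force h
to be bounded below. The inequality is multiplied out so that X = W is allowed. Any maximiser will
do: the slopes of the flag then decrease weakly. -/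
theorem IsHeight.exists_next (hh : IsHeight h) {W : Submodule K V} (hW : W ≠ ⊤) :
    ∃ W', W < W' ∧ ∀ X, W ≤ X →
      (h X - h W) * (Module.finrank K W' - Module.finrank K W : ℝ) ≤
        (h W' - h W) * (Module.finrank K X - Module.finrank K W) := by
  let σ : Submodule K V → ℝ := fun X => (h X - h W) / (Module.finrank K X - Module.finrank K W)
  have hpos : ∀ X, W < X → (0 : ℝ) < Module.finrank K X - Module.finrank K W := fun X hX => by
    rw [sub_pos]
    exact_mod_cast Submodule.finrank_lt_finrank_of_lt hX
  have htop : W < ⊤ := lt_top_iff_ne_top.2 hW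
  have hfin : {X | W < X ∧ σ ⊤ ≤ σ X}.Finite := by
    refine (hh.finite (h W - |σ ⊤| * Module.finrank K V)).subset fun X hX => ?_
    have h1 := (le_div_iff₀ (hpos X hX.1)).1 hX.2
    have h2 : (Module.finrank K X : ℝ) - Module.finrank K W ≤ Module.finrank K V := by
      have h3 : (Module.finrank K X : ℝ) ≤ Module.finrank K V := by
        exact_mod_cast Submodule.finrank_le X
      have h4 : (0 : ℝ) ≤ Module.finrank K W := Nat.cast_nonneg _
      linarith
    have h3 := mul_le_mul (neg_abs_le (σ ⊤)) le_rfl (hpos X hX.1).le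
    have h4 := mul_le_mul_of_nonneg_left h2 (abs_nonneg (σ ⊤))
    rw [Set.mem_ofPred_eq]
    have h5 := mul_le_mul_of_nonneg_right (neg_abs_le (σ ⊤)) (hpos X hX.1).le
    linarith
  obtain ⟨W', hW', hmax⟩ := Set.exists_max_image _ σ hfin ⟨⊤, htop, le_rfl⟩
  refine ⟨W', hW'.1, fun X hX => ?_⟩
  rcases hX.eq_or_lt with rfl | hX
  · simp
  have h1 : σ X ≤ σ W' := by
    rcases le_total (σ ⊤) (σ X) with h2 | h2
    · exact hmax X ⟨hX, h2⟩
    · exact h2.trans hW'.2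
  exact (div_le_div_iff₀ (hpos X hX) (hpos W' hW'.1)).1 h1

theorem IsHeight.exists_flag (hh : IsHeight h) :
    ∃ s : LTSeries (Submodule K V), s.head = ⊥ ∧ s.last = ⊤ ∧ ∀ (i : Fin s.length) X,
      s i.castSucc ≤ X → (h X - h (s i.castSucc)) *
        (Module.finrank K (s i.succ) - Module.finrank K (s i.castSucc) : ℝ) ≤
        (h (s i.succ) - h (s i.castSucc)) *
          (Module.finrank K X - Module.finrank K (s i.castSucc)) := by
  classical
  choose! N hN hN' using fun W => hh.exists_next (W := W)
  let f : ℕ → Submodule K V := fun k => N^[k] ⊥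
  have hf : ∀ k, f (k + 1) = N (f k) := fun k => Function.iterate_succ_apply' N k ⊥
  have hex : ∃ k, f k = ⊤ := by
    by_contra! hcon
    have h1 : ∀ k, k ≤ Module.finrank K (f k) := by
      intro k
      induction k with
      | zero => exact Nat.zero_le _
      | succ k ih =>
        rw [hf]
        exact ih.trans_lt (Submodule.finrank_lt_finrank_of_lt (hN _ (hcon k)))
    have h2 := h1 (Module.finrank K V + 1)
    have h3 := Submodule.finrank_le (f (Module.finrank K V + 1))
    omega
  have hlt : ∀ i < Nat.find hex, f i ≠ ⊤ := fun i hi => Nat.find_min hex hi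
  refine ⟨⟨Nat.find hex, fun i => f i, fun i => ?_⟩, rfl, ?_, fun i X hX => ?_⟩
  · change f i < f (i + 1)
    rw [hf]
    exact hN _ (hlt i i.2)
  · exact Nat.find_spec hex
  · have := hN' (f i) (hlt i i.2) X hX
    rw [← hf] at this
    exact this

theorem antitone_fin_of_succ {n : ℕ} {μ : Fin n → ℝ}
    (hμ : ∀ i j : Fin n, (j : ℕ) = i + 1 → μ j ≤ μ i) : Antitone μ := by
  cases n with
  | zero => exact fun i => i.elim0
  | succ n => exact Fin.antitone_iff_succ_le.2 fun i => hμ _ _ (by simp)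

theorem finrank_strictMono (s : LTSeries (Submodule K V)) :
    StrictMono fun i : Fin (s.length + 1) => (Module.finrank K (s i) : ℝ) := fun i j hij => by
  have : s i < s j := s.strictMono hij
  exact Nat.cast_lt.2 (Submodule.finrank_lt_finrank_of_lt this)

/-- The flag of greatest slopes: its polygon is concave and dominates the height function. -/
theorem IsHeight.exists_flag_slopes (hh : IsHeight h) (hV : 0 < Module.finrank K V) :
    ∃ s : LTSeries (Submodule K V), s.head = ⊥ ∧ s.last = ⊤ ∧
      ConcaveOn ℝ (Set.Icc (0 : ℝ) (Module.finrank K V))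
        (piecewiseAffine s.length (fun i => Module.finrank K (s i)) fun i => h (s i)) ∧
      ∀ X, h X ≤ piecewiseAffine s.length (fun i => Module.finrank K (s i)) (fun i => h (s i))
        (Module.finrank K X) := by
  obtain ⟨s, hs0, hs1, hmax⟩ := hh.exists_flag
  have hs0' : s 0 = ⊥ := hs0
  have hs1' : s (Fin.last _) = ⊤ := hs1
  have hn : 0 < s.length := by
    rcases Nat.eq_zero_or_pos s.length with h0 | h0
    · exfalso
      have h1 : (0 : Fin (s.length + 1)) = Fin.last _ := Fin.ext h0.symm
      rw [h1, hs1'] at hs0'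
      have h2 := congrArg (fun W : Submodule K V => Module.finrank K W) hs0'
      simp only [finrank_top, finrank_bot] at h2
      omega
    · exact h0
  have hR := finrank_strictMono s
  have hd : ∀ i : Fin s.length,
      (0 : ℝ) < Module.finrank K (s i.succ) - Module.finrank K (s i.castSucc) := fun i =>
    sub_pos.2 (hR Fin.castSucc_lt_succ)
  let μ : Fin s.length → ℝ := fun i => (h (s i.succ) - h (s i.castSucc)) /
    (Module.finrank K (s i.succ) - Module.finrank K (s i.castSucc))
  have hH : ∀ i : Fin s.length, h (s i.succ) - h (s i.castSucc) =
      μ i * (Module.finrank K (s i.succ) - Module.finrank K (s i.castSucc)) := fun i =>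
    (div_mul_cancel₀ _ (hd i).ne').symm
  have hmax' : ∀ (i : Fin s.length) X, s i.castSucc ≤ X →
      h X - h (s i.castSucc) ≤ μ i * (Module.finrank K X - Module.finrank K (s i.castSucc)) := by
    intro i X hX
    have h1 := hmax i X hX
    rw [hH i, mul_right_comm] at h1
    exact le_of_mul_le_mul_right h1 (hd i)
  -- Were the next slope greater, the subspace two steps up would have a greater slope over s_i than
  -- s_{i+1} has.
  have hμ : Antitone μ := by
    refine antitone_fin_of_succ fun i j hij => ?_
    have h1 : s j.castSucc = s i.succ := congrArg s (Fin.ext hij)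
    have h2 := hmax' i (s j.succ)
      (s.strictMono (Fin.lt_def.2 (by simp [hij]) : i.castSucc < j.succ)).le
    have h3 := hH i
    have h4 := hH j
    have h5 := hd j
    rw [h1] at h4 h5
    refine le_of_mul_le_mul_right ?_ h5
    rw [← h4]
    have h6 : (Module.finrank K (s j.succ) : ℝ) - Module.finrank K (s i.castSucc) =
      (Module.finrank K (s j.succ) - Module.finrank K (s i.succ)) +
        (Module.finrank K (s i.succ) - Module.finrank K (s i.castSucc)) := by ring
    rw [h6, mul_add, ← h3] at h2
    linarith
  have hR0 : (Module.finrank K (s 0) : ℝ) = 0 := by rw [hs0', finrank_bot, Nat.cast_zero]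
  refine ⟨s, hs0, hs1, ?_, fun X => ?_⟩
  · have := concaveOn_piecewiseAffine (H := fun i => h (s i)) hR hn hμ hH hR0
    have hlast : (Module.finrank K (s (Fin.last s.length)) : ℝ) = Module.finrank K V := by
      rw [hs1', finrank_top]
    rwa [hlast] at this
  · have hdim : ∀ i : Fin s.length, (Module.finrank K (s i.castSucc ⊔ X ⊓ s i.succ : Submodule K V)
        : ℝ) - Module.finrank K (s i.castSucc) =
        Module.finrank K (X ⊓ s i.succ : Submodule K V) -
          Module.finrank K (X ⊓ s i.castSucc : Submodule K V) := by
      intro i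
      have h1 := Submodule.finrank_sup_add_finrank_inf_eq (s i.castSucc) (X ⊓ s i.succ)
      have h2 : s i.castSucc ⊓ (X ⊓ s i.succ) = X ⊓ s i.castSucc := by
        rw [inf_comm, inf_assoc, inf_eq_right.2 (s.strictMono (Fin.castSucc_lt_succ (i := i))).le]
      rw [h2] at h1
      have h3 : (Module.finrank K (s i.castSucc ⊔ X ⊓ s i.succ : Submodule K V) : ℝ) +
        Module.finrank K (X ⊓ s i.castSucc : Submodule K V) = Module.finrank K (s i.castSucc) +
          Module.finrank K (X ⊓ s i.succ : Submodule K V) := by exact_mod_cast h1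
      linarith
    -- Supermodularity compares X ∩ s_{i+1} over X ∩ s_i with s_i + (X ∩ s_{i+1}) over s_i. The
    -- dimension jump is the same, and maximality of the slope applies to the latter.
    have hstep : ∀ i : Fin s.length, h (X ⊓ s i.succ) - h (X ⊓ s i.castSucc) ≤
        μ i * (Module.finrank K (X ⊓ s i.succ : Submodule K V) -
          Module.finrank K (X ⊓ s i.castSucc : Submodule K V)) := by
      intro i
      rw [← hdim]
      refine le_trans ?_ (hmax' i _ le_sup_left)
      have h1 := hh.supermodular (s i.castSucc) (X ⊓ s i.succ)
      have h2 : s i.castSucc ⊓ (X ⊓ s i.succ) = X ⊓ s i.castSucc := by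
        rw [inf_comm, inf_assoc, inf_eq_right.2 (s.strictMono (Fin.castSucc_lt_succ (i := i))).le]
      rw [h2] at h1
      linarith
    -- The dimension jumps of X along the flag are at most those of the flag itself and add up to
    -- dim X.
    have h1 := sum_slope_le_piecewiseAffine (H := fun i => h (s i)) hR hn hμ hH hR0
      (d := fun i => (Module.finrank K (X ⊓ s i.succ : Submodule K V) : ℝ) -
          Module.finrank K (X ⊓ s i.castSucc : Submodule K V))
      (fun i => sub_nonneg.2 (by
        exact_mod_cast Submodule.finrank_mono (inf_le_inf_left X
          (s.strictMono (Fin.castSucc_lt_succ (i := i))).le)))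
      (fun i => by
        rw [← hdim]
        refine sub_le_sub_right ?_ _
        exact_mod_cast Submodule.finrank_mono (sup_le
          (s.strictMono (Fin.castSucc_lt_succ (i := i))).le inf_le_right))
    have h2 := sum_fin_sub s.length fun i => (Module.finrank K (X ⊓ s i : Submodule K V) : ℝ)
    have h3 := sum_fin_sub s.length fun i => h (X ⊓ s i)
    have h4 : X ⊓ s 0 = ⊥ := by rw [hs0', inf_bot_eq]
    have h5 : X ⊓ s (Fin.last _) = X := by rw [hs1', inf_top_eq]
    have h6 : (Module.finrank K (X ⊓ s 0 : Submodule K V) : ℝ) = 0 := by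
      rw [h4, finrank_bot, Nat.cast_zero]
    have h7 : (Module.finrank K (X ⊓ s (Fin.last _) : Submodule K V) : ℝ) =
      Module.finrank K X := by rw [h5]
    rw [h6, h7, sub_zero] at h2
    rw [h4, h5, hh.bot, sub_zero] at h3
    rw [h2] at h1
    rw [← h3]
    exact (Finset.sum_le_sum fun i _ => hstep i).trans h1

end Slopes

/-! ### The canonical polygon -/

section CanonicalPolygon

variable {F : Type*} [Field F] [NumberField F] {r : ℕ}

/-- The height `deg (E_g ∩ W) - dim W · deg g / r` of a subspace. -/
noncomputable def ht (g : GA F r) (W : Submodule F (Fin r → F)) : ℝ :=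
  subDegree g W - Module.finrank F W * (degree g / r)

theorem isHeight_ht (g : GA F r) : IsHeight (ht g) where
  supermodular X Y := by
    have h1 := subDegree_add_le g X Y
    have h2 : (Module.finrank F ↥(X ⊔ Y) : ℝ) + Module.finrank F ↥(X ⊓ Y) =
        Module.finrank F X + Module.finrank F Y := by
      exact_mod_cast Submodule.finrank_sup_add_finrank_inf_eq X Y
    have h3 := congrArg (· * (degree g / r)) h2
    simp only [add_mul] at h3
    simp only [ht]
    linarith
  bot := by rw [ht, subDegree_bot, finrank_bot, Nat.cast_zero, zero_mul, sub_zero]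
  finite c := by
    refine (finite_le_subDegree g (c - r * |degree g / r|)).subset fun W hW => ?_
    have h1 : c ≤ ht g W := hW
    rw [ht] at h1
    have h2 : (Module.finrank F W : ℝ) ≤ r := by
      have := Submodule.finrank_le W
      rw [Module.finrank_fin_fun] at this
      exact_mod_cast this
    have h3 := mul_le_mul_of_nonneg_right h2 (abs_nonneg (degree g / r))
    have h4 := mul_le_mul_of_nonneg_left (neg_abs_le (degree g / r))
      (Nat.cast_nonneg (α := ℝ) (Module.finrank F W))
    rw [Set.mem_ofPred_eq]
    linarith

theorem ht_top (g : GA F r) (hr : 0 < r) : ht g ⊤ = 0 := by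
  have hr' : (r : ℝ) ≠ 0 := by exact_mod_cast hr.ne'
  rw [ht, subDegree_top, finrank_top, Module.finrank_fin_fun, mul_div_cancel₀ _ hr', sub_self]

theorem polygon_eq (Q : Parabolic F r) (g : GA F r) :
    Q.polygon g = piecewiseAffine Q.flag.length (fun i => Module.finrank F (Q.flag i))
      fun i => ht g (Q.flag i) := rfl

omit [NumberField F] in
theorem flag_zero (Q : Parabolic F r) : Q.flag 0 = ⊥ := Q.head_eq

omit [NumberField F] in
theorem flag_last (Q : Parabolic F r) : Q.flag (Fin.last _) = ⊤ := Q.last_eq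

omit [NumberField F] in
theorem flag_length_pos (Q : Parabolic F r) (hr : 0 < r) : 0 < Q.flag.length := by
  rcases Nat.eq_zero_or_pos Q.flag.length with h0 | h0
  · exfalso
    have h1 : (0 : Fin (Q.flag.length + 1)) = Fin.last _ := Fin.ext h0.symm
    have h2 := flag_zero Q
    rw [h1, flag_last] at h2
    have h3 := congrArg (fun W : Submodule F (Fin r → F) => Module.finrank F W) h2
    simp only [finrank_top, finrank_bot, Module.finrank_fin_fun] at h3
    omega
  · exact h0

omit [NumberField F] in
theorem finrank_flag_zero (Q : Parabolic F r) : (Module.finrank F (Q.flag 0) : ℝ) = 0 := by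
  rw [flag_zero, finrank_bot, Nat.cast_zero]

omit [NumberField F] in
theorem finrank_flag_last (Q : Parabolic F r) :
    (Module.finrank F (Q.flag (Fin.last _)) : ℝ) = r := by
  rw [flag_last, finrank_top, Module.finrank_fin_fun]

theorem ht_flag_zero (Q : Parabolic F r) (g : GA F r) : ht g (Q.flag 0) = 0 := by
  rw [flag_zero, (isHeight_ht g).bot]

theorem polygon_node (Q : Parabolic F r) (g : GA F r) (hr : 0 < r)
    (i : Fin (Q.flag.length + 1)) :
    Q.polygon g (Module.finrank F (Q.flag i)) = ht g (Q.flag i) := by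
  rw [polygon_eq, piecewiseAffine_node (R := fun i => (Module.finrank F (Q.flag i) : ℝ))
    (finrank_strictMono Q.flag) (flag_length_pos Q hr), ht_flag_zero, sub_zero]

theorem polygon_le {q : ℝ → ℝ} (hq : ConcaveOn ℝ (Set.Icc (0 : ℝ) r) q) {g : GA F r}
    (hr : 0 < r) (h : ∀ W, ht g W ≤ q (Module.finrank F W)) (Q : Parabolic F r) {x : ℝ}
    (hx : x ∈ Set.Icc (0 : ℝ) r) : Q.polygon g x ≤ q x := by
  have hR := finrank_strictMono Q.flag
  rw [polygon_eq]
  refine piecewiseAffine_le hR (flag_length_pos Q hr) (ht_flag_zero Q g) ?_ (fun k => h _) ?_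
  · rwa [finrank_flag_zero, finrank_flag_last]
  · rwa [finrank_flag_zero, finrank_flag_last]

theorem polygon_eq_zero (Q : Parabolic F r) (g : GA F r) (hr : 0 < r) {x : ℝ}
    (hx : x ∉ Set.Icc (0 : ℝ) r) : Q.polygon g x = 0 := by
  have hR := finrank_strictMono Q.flag
  rw [polygon_eq]
  rcases lt_or_ge x 0 with h | h
  · refine piecewiseAffine_of_le hR ?_
    rw [finrank_flag_zero]
    exact h.le
  · have h1 : (r : ℝ) ≤ x := by
      by_contra h2
      exact hx ⟨h, (not_le.1 h2).le⟩
    refine (piecewiseAffine_of_ge hR (by rwa [finrank_flag_last])).trans ?_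
    rw [ht_flag_zero, flag_last, ht_top g hr, sub_zero]

/-- The polygon of the flag of greatest slopes is concave and lies above all points (dim W, h(W)),
in particular above the nodes of every other polygon. -/
theorem exists_greatest_polygon (g : GA F r) (hr : 0 < r) : ∃ Q : Parabolic F r,
    canonicalPolygon g = Q.polygon g ∧ (∀ (Q' : Parabolic F r) x, Q'.polygon g x ≤ Q.polygon g x) ∧
      ConcaveOn ℝ (Set.Icc (0 : ℝ) r) (Q.polygon g) ∧
      ∀ W, ht g W ≤ Q.polygon g (Module.finrank F W) := by
  obtain ⟨s, h0, h1, hconc, hle⟩ := (isHeight_ht g).exists_flag_slopes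
    (by rwa [Module.finrank_fin_fun])
  rw [Module.finrank_fin_fun] at hconc
  let Q : Parabolic F r := ⟨s, h0, h1⟩
  have hmax : ∀ (Q' : Parabolic F r) x, Q'.polygon g x ≤ Q.polygon g x := by
    intro Q' x
    -- All polygons vanish outside [0, r], so the comparison holds on the whole of ℝ, as the order
    -- on functions ℝ → ℝ requires.
    by_cases hx : x ∈ Set.Icc (0 : ℝ) r
    · exact polygon_le hconc hr hle Q' hx
    · rw [polygon_eq_zero Q' g hr hx, polygon_eq_zero Q g hr hx]
  refine ⟨Q, funext fun x => ?_, hmax, hconc, hle⟩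
  have : Nonempty (Parabolic F r) := ⟨Q⟩
  exact le_antisymm (ciSup_le fun Q' => hmax Q' x)
    (le_ciSup (f := fun Q' : Parabolic F r => Q'.polygon g x)
      ⟨Q.polygon g x, by rintro _ ⟨Q', rfl⟩; exact hmax Q' x⟩ Q)

/-- A concave p dominates a polygon as soon as it dominates its nodes. This form of the condition,
with one inequality per subspace, is the one used from here on. -/
theorem canonicalLE_iff {p : ℝ → ℝ} (hp : IsNormalizedConvex r p) (hr : 0 < r) {g : GA F r} :
    CanonicalLE p g ↔ ∀ W, ht g W ≤ p (Module.finrank F W) := by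
  obtain ⟨Q, hQ, -, -, hle⟩ := exists_greatest_polygon g hr
  constructor
  · intro h W
    refine (hle W).trans ?_
    rw [← hQ]
    refine h _ ⟨Nat.cast_nonneg _, ?_⟩
    have := Submodule.finrank_le W
    rw [Module.finrank_fin_fun] at this
    exact_mod_cast this
  · intro h x hx
    rw [hQ]
    exact polygon_le hp.concave hr h Q hx

theorem isGreatest_canonicalPolygon (g : GA F r) (hr : 0 < r) :
    IsGreatest (Set.range fun Q : Parabolic F r => Q.polygon g) (canonicalPolygon g) ∧
      ConcaveOn ℝ (Set.Icc (0 : ℝ) r) (canonicalPolygon g) := by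
  obtain ⟨Q, hQ, hmax, hconc, -⟩ := exists_greatest_polygon g hr
  rw [hQ]
  exact ⟨⟨⟨Q, rfl⟩, by rintro _ ⟨Q', rfl⟩; exact hmax Q'⟩, hconc⟩

theorem ht_diag_mul (γ : Matrix.GeneralLinearGroup (Fin r) F) (g : GA F r)
    (W : Submodule F (Fin r → F)) :
    ht (diag F r γ * g) (W.map (linAut γ).toLinearMap) = ht g W := by
  rw [ht, ht, subDegree_diag_mul, degree_diag_mul, (linAut γ).finrank_map_eq W]

theorem ht_center_mul {z : GA F r} (hz : z ∈ Subgroup.center (GA F r)) (hr : 0 < r) (g : GA F r)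
    (W : Submodule F (Fin r → F)) : ht (z * g) W = ht g W := by
  rw [ht, ht, subDegree_center_mul hz hr, degree_center_mul hz hr]
  ring

theorem canonicalLE_diag_mul {p : ℝ → ℝ} (hp : IsNormalizedConvex r p) (hr : 0 < r)
    (γ : Matrix.GeneralLinearGroup (Fin r) F) (g : GA F r) :
    CanonicalLE p (diag F r γ * g) ↔ CanonicalLE p g := by
  rw [canonicalLE_iff hp hr, canonicalLE_iff hp hr]
  constructor
  · intro h W
    have := h (W.map (linAut γ).toLinearMap)
    rwa [ht_diag_mul, (linAut γ).finrank_map_eq W] at this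
  · intro h W
    have h1 := h (W.comap (linAut γ).toLinearMap)
    have h2 : (W.comap (linAut γ).toLinearMap).map (linAut γ).toLinearMap = W :=
      Submodule.map_comap_eq_of_surjective (linAut γ).surjective W
    rw [← ht_diag_mul γ g, ← (linAut γ).finrank_map_eq, h2] at h1
    exact h1

theorem canonicalLE_center_mul {p : ℝ → ℝ} (hp : IsNormalizedConvex r p) (hr : 0 < r)
    {z : GA F r} (hz : z ∈ Subgroup.center (GA F r)) (g : GA F r) :
    CanonicalLE p (z * g) ↔ CanonicalLE p g := by
  rw [canonicalLE_iff hp hr, canonicalLE_iff hp hr]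
  simp only [ht_center_mul hz hr]

theorem canonicalLE_mul {p : ℝ → ℝ} (hp : IsNormalizedConvex r p) (hr : 0 < r)
    {h : GA F r} (hh : h ∈ Subgroup.center (GA F r) ⊔ rationalPoints F r) (g : GA F r) :
    CanonicalLE p (h * g) ↔ CanonicalLE p g := by
  obtain ⟨z, hz, -, ⟨γ, rfl⟩, rfl⟩ := Subgroup.mem_sup_of_normal_left.1 hh
  rw [mul_assoc, canonicalLE_center_mul hp hr hz, canonicalLE_diag_mul hp hr]

end CanonicalPolygon

end GeoTrunc

namespace GeoTrunc

/-! ### Alternating sums over chains -/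

section AlternatingSum

/-- The finite chains in a finite subset of a partially ordered set. -/
noncomputable def chains {α : Type*} [PartialOrder α] (S : Finset α) : Finset (Finset α) :=
  @Finset.filter _ (fun C => IsChain (· ≤ ·) (C : Set α)) (Classical.decPred _) S.powerset

theorem mem_chains {α : Type*} [PartialOrder α] {S C : Finset α} :
    C ∈ chains S ↔ C ⊆ S ∧ IsChain (· ≤ ·) (C : Set α) := by
  rw [← Finset.mem_powerset]
  exact @Finset.mem_filter _ _ (Classical.decPred _) _ _

variable {α : Type*} [Lattice α] [OrderTop α]

open Classical in
/-- The element that is toggled in the chain `C`. -/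
noncomputable def pivot (w : α) (C : Finset α) : α :=
  w ⊓ (C.filter fun x => ¬ x ≤ w).inf id

/-- The members of a chain not below w have a least element m, so the pivot is m ⊓ w. If there are
none, the empty infimum is ⊤ and the pivot is w. -/
theorem pivot_mem {S : Finset α} {w : α} (hw : w ∈ S) (hS : ∀ x ∈ S, x ⊓ w ∈ S) {C : Finset α}
    (hC : C ∈ chains S) : pivot w C ∈ S := by
  classical
  obtain ⟨hCS, hchain⟩ := mem_chains.1 hC
  rw [pivot]
  set D := C.filter fun x => ¬ x ≤ w with hD
  rcases D.eq_empty_or_nonempty with h | h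
  · rw [h, Finset.inf_empty, inf_top_eq]
    exact hw
  · obtain ⟨m, hm, hmin⟩ := D.exists_minimal h
    have hmC : m ∈ C := (Finset.mem_filter.1 hm).1
    have : D.inf id = m := by
      refine le_antisymm (Finset.inf_le (f := id) hm) (Finset.le_inf fun x hx => ?_)
      have hxC : x ∈ C := (Finset.mem_filter.1 hx).1
      rcases hchain.total hmC hxC with h1 | h1
      · exact h1
      · exact hmin hx h1
    rw [this, inf_comm]
    exact hS m (hCS hmC)

theorem pivot_comparable {w : α} {C : Finset α} (hC : IsChain (· ≤ ·) (C : Set α)) {x : α}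
    (hx : x ∈ C) : x ≤ pivot w C ∨ pivot w C ≤ x := by
  classical
  by_cases h : x ≤ w
  · refine Or.inl (le_inf h (Finset.le_inf fun y hy => ?_))
    obtain ⟨hyC, hyw⟩ := Finset.mem_filter.1 hy
    rcases hC.total hx hyC with h1 | h1
    · exact h1
    · exact absurd (h1.trans h) hyw
  · exact Or.inr (inf_le_right.trans (Finset.inf_le (f := id) (Finset.mem_filter.2 ⟨hx, h⟩)))

open Classical in
/-- Add or remove the pivot. -/
noncomputable def toggle (w : α) (C : Finset α) : Finset α :=
  if pivot w C ∈ C then C.erase (pivot w C) else insert (pivot w C) C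

/-- The pivot lies below w, whereas it is computed from the members not below w, which toggling
leaves alone. -/
theorem pivot_toggle (w : α) (C : Finset α) : pivot w (toggle w C) = pivot w C := by
  classical
  have h : pivot w C ≤ w := inf_le_left
  have : (toggle w C).filter (fun x => ¬ x ≤ w) = C.filter fun x => ¬ x ≤ w := by
    ext x
    rw [toggle]
    split_ifs
    · simp only [Finset.mem_filter, Finset.mem_erase]
      refine ⟨fun hx => ⟨hx.1.2, hx.2⟩, fun hx => ⟨⟨?_, hx.1⟩, hx.2⟩⟩
      rintro rfl
      exact hx.2 h
    · simp only [Finset.mem_filter, Finset.mem_insert]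
      refine ⟨fun hx => ⟨hx.1.resolve_left ?_, hx.2⟩, fun hx => ⟨Or.inr hx.1, hx.2⟩⟩
      rintro rfl
      exact hx.2 h
  unfold pivot at this ⊢
  rw [this]

theorem toggle_toggle (w : α) (C : Finset α) : toggle w (toggle w C) = C := by
  classical
  conv_lhs => rw [toggle, pivot_toggle]
  rw [toggle]
  by_cases h : pivot w C ∈ C
  · rw [if_pos h, if_neg (Finset.notMem_erase _ _), Finset.insert_erase h]
  · rw [if_neg h, if_pos (Finset.mem_insert_self _ _), Finset.erase_insert h]

theorem toggle_mem {S : Finset α} {w : α} (hw : w ∈ S) (hS : ∀ x ∈ S, x ⊓ w ∈ S) {C : Finset α}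
    (hC : C ∈ chains S) : toggle w C ∈ chains S := by
  classical
  obtain ⟨hCS, hchain⟩ := mem_chains.1 hC
  rw [mem_chains, toggle]
  split_ifs with h
  · exact ⟨(Finset.erase_subset _ _).trans hCS, hchain.mono (by
      rw [Finset.coe_erase]; exact Set.sdiff_subset)⟩
  · refine ⟨Finset.insert_subset (pivot_mem hw hS hC) hCS, ?_⟩
    rw [Finset.coe_insert]
    exact hchain.insert fun x hx _ => (pivot_comparable hchain hx).symm

/-- Adding or removing the pivot is an involution without fixed points that changes the sign.
Combinatorially, x ≥ x ⊓ w ≤ w contracts the order complex of S. -/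
theorem sum_chains_eq_zero {S : Finset α} {w : α} (hw : w ∈ S) (hS : ∀ x ∈ S, x ⊓ w ∈ S) :
    ∑ C ∈ chains S, (-1 : ℂ) ^ C.card = 0 := by
  classical
  refine Finset.sum_involution (fun C _ => toggle w C) (fun C _ => ?_) (fun C _ _ h => ?_)
    (fun C hC => toggle_mem hw hS hC) (fun C _ => toggle_toggle w C)
  · rw [toggle]
    split_ifs with h
    · rw [← Finset.card_erase_add_one h, pow_succ]
      ring
    · rw [Finset.card_insert_of_notMem h, pow_succ]
      ring
  · rw [toggle] at h
    split_ifs at h with h1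
    · exact Finset.erase_eq_self.1 h h1
    · exact h1 (Finset.insert_eq_self.1 h)

omit [OrderTop α] in
theorem sum_chains_empty : ∑ C ∈ chains (∅ : Finset α), (-1 : ℂ) ^ C.card = 1 := by
  have : chains (∅ : Finset α) = {∅} := by
    ext C
    rw [mem_chains, Finset.subset_empty, Finset.mem_singleton]
    refine ⟨fun h => h.1, ?_⟩
    rintro rfl
    exact ⟨rfl, by simp⟩
  rw [this]
  simp

end AlternatingSum

/-! ### Destabilizing subspaces -/

section Destabilizing

variable {F : Type*} [Field F] [NumberField F] {r : ℕ}

/-- The proper nonzero subspaces whose height exceeds the given bound. -/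
def destabilizing (p : ℝ → ℝ) (g : GA F r) : Set (Submodule F (Fin r → F)) :=
  {W | W ≠ ⊥ ∧ W ≠ ⊤ ∧ p (Module.finrank F W) < ht g W}

theorem IsNormalizedConvex.nonneg {p : ℝ → ℝ} (hp : IsNormalizedConvex r p) {x : ℝ}
    (hx : x ∈ Set.Icc (0 : ℝ) r) : 0 ≤ p x := by
  rcases Nat.eq_zero_or_pos r with rfl | hr
  · have : x = 0 := le_antisymm (by simpa using hx.2) hx.1
    rw [this, hp.map_zero]
  have hr' : (0 : ℝ) < r := by exact_mod_cast hr
  have h := hp.concave.2 (Set.left_mem_Icc.2 hr'.le) (Set.right_mem_Icc.2 hr'.le)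
    (sub_nonneg.2 ((div_le_one hr').2 hx.2)) (div_nonneg hx.1 hr'.le) (by ring)
  rw [hp.map_zero, hp.map_rank] at h
  simpa [hr'.ne'] using h

theorem finrank_mem_Icc (W : Submodule F (Fin r → F)) :
    (Module.finrank F W : ℝ) ∈ Set.Icc (0 : ℝ) r := by
  have := Submodule.finrank_le W
  rw [Module.finrank_fin_fun] at this
  exact ⟨Nat.cast_nonneg _, by exact_mod_cast this⟩

theorem finite_destabilizing {p : ℝ → ℝ} (hp : IsNormalizedConvex r p) (g : GA F r) :
    (destabilizing p g).Finite :=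
  ((isHeight_ht g).finite 0).subset fun W hW => (hp.nonneg (finrank_mem_Icc W)).trans hW.2.2.le

/-- Since a + d = b + c, the points b and c are convex combinations of a and d with the two weights
interchanged. -/
theorem concave_add_le {p : ℝ → ℝ} (hp : IsNormalizedConvex r p) {a b c d : ℝ} (ha : 0 ≤ a)
    (hd : d ≤ r) (hab : a ≤ b) (hac : a ≤ c) (h : a + d = b + c) : p a + p d ≤ p b + p c := by
  rcases eq_or_lt_of_le (show a ≤ d by linarith) with had | had
  · have h1 : b = a := by linarith
    have h2 : c = a := by linarith
    rw [h1, h2, had]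
  have hda : 0 < d - a := sub_pos.2 had
  have hma : a ∈ Set.Icc (0 : ℝ) r := ⟨ha, by linarith⟩
  have hmd : d ∈ Set.Icc (0 : ℝ) r := ⟨by linarith, hd⟩
  set s := (b - a) / (d - a) with hs
  have hs0 : 0 ≤ s := div_nonneg (by linarith) hda.le
  have hs1 : s ≤ 1 := (div_le_one hda).2 (by linarith)
  have hsd : s * (d - a) = b - a := div_mul_cancel₀ _ hda.ne'
  have h1 := hp.concave.2 hma hmd (sub_nonneg.2 hs1) hs0 (by ring)
  have h2 := hp.concave.2 hma hmd hs0 (sub_nonneg.2 hs1) (by ring)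
  simp only [smul_eq_mul] at h1 h2
  have e1 : (1 - s) * a + s * d = b := by linarith
  have e2 : s * a + (1 - s) * d = c := by linarith
  rw [e1] at h1
  rw [e2] at h2
  linarith

/-- Let f = h - p ∘ dim and let W₀ maximise f on the destabilizing subspaces. Supermodularity of f
gives f(W ∩ W₀) ≥ f(W) + f(W₀) - f(W + W₀) ≥ f(W) > 0. As f vanishes at ⊥ and ⊤, positivity of f
alone makes a subspace destabilizing; in particular W ∩ W₀ ≠ 0. -/
theorem exists_absorbing {p : ℝ → ℝ} (hp : IsNormalizedConvex r p) (hr : 0 < r) (g : GA F r)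
    (h : (destabilizing p g).Nonempty) : ∃ W₀ ∈ destabilizing p g, ∀ W ∈ destabilizing p g,
      W ⊓ W₀ ∈ destabilizing p g := by
  let f : Submodule F (Fin r → F) → ℝ := fun W => ht g W - p (Module.finrank F W)
  have hf : ∀ X Y, f X + f Y ≤ f (X ⊓ Y) + f (X ⊔ Y) := by
    intro X Y
    have h1 := (isHeight_ht g).supermodular X Y
    have h2 := Submodule.finrank_sup_add_finrank_inf_eq X Y
    have h3 := concave_add_le hp (a := Module.finrank F (X ⊓ Y : Submodule F _))
      (b := Module.finrank F X) (c := Module.finrank F Y)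
      (d := Module.finrank F (X ⊔ Y : Submodule F _)) (Nat.cast_nonneg _) (finrank_mem_Icc _).2
      (by exact_mod_cast Submodule.finrank_mono inf_le_left)
      (by exact_mod_cast Submodule.finrank_mono inf_le_right)
      (by rw [add_comm]; exact_mod_cast h2)
    simp only [f]
    linarith
  have hbot : f ⊥ = 0 := by
    simp only [f]
    rw [(isHeight_ht g).bot, finrank_bot, Nat.cast_zero, hp.map_zero, sub_zero]
  have htop : f ⊤ = 0 := by
    simp only [f]
    rw [ht_top g hr, finrank_top, Module.finrank_fin_fun, hp.map_rank, sub_zero]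
  have hmem : ∀ W, W ∈ destabilizing p g ↔ 0 < f W := by
    intro W
    refine ⟨fun hW => sub_pos.2 hW.2.2, fun hW => ⟨?_, ?_, sub_pos.1 hW⟩⟩
    · rintro rfl
      exact hW.ne' hbot
    · rintro rfl
      exact hW.ne' htop
  obtain ⟨W₀, hW₀, hmax⟩ := Set.exists_max_image _ f (finite_destabilizing hp g) h
  refine ⟨W₀, hW₀, fun W hW => (hmem _).2 ?_⟩
  have h1 := hf W W₀
  -- If the sum is not destabilizing, then f is nonpositive there, so the bound by f(W₀) holds
  -- anyway.
  have h2 : f (W ⊔ W₀) ≤ f W₀ := by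
    by_cases h3 : W ⊔ W₀ ∈ destabilizing p g
    · exact hmax _ h3
    · exact (not_lt.1 (mt (hmem _).2 h3)).trans ((hmem _).1 hW₀).le
  have h3 := (hmem W).1 hW
  linarith

theorem destabilizing_eq_empty_iff {p : ℝ → ℝ} (hp : IsNormalizedConvex r p) (hr : 0 < r)
    (g : GA F r) : destabilizing p g = ∅ ↔ CanonicalLE p g := by
  rw [canonicalLE_iff hp hr, Set.eq_empty_iff_forall_notMem]
  refine forall_congr' fun W => ?_
  constructor
  · intro h
    by_contra hlt
    rw [not_le] at hlt
    refine h ⟨?_, ?_, hlt⟩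
    · rintro rfl
      rw [(isHeight_ht g).bot, finrank_bot, Nat.cast_zero, hp.map_zero] at hlt
      exact lt_irrefl _ hlt
    · rintro rfl
      rw [ht_top g hr, finrank_top, Module.finrank_fin_fun, hp.map_rank] at hlt
      exact lt_irrefl _ hlt
  · exact fun h hW => absurd hW.2.2 (not_lt.2 h)

theorem sum_chains_destabilizing {p : ℝ → ℝ} (hp : IsNormalizedConvex r p) (hr : 0 < r)
    (g : GA F r) : ∑ C ∈ chains (finite_destabilizing hp g).toFinset, (-1 : ℂ) ^ C.card =
      {h : GA F r | CanonicalLE p h}.indicator (fun _ => (1 : ℂ)) g := by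
  by_cases h : CanonicalLE p g
  · rw [Set.indicator_of_mem (by exact h)]
    have h1 : (finite_destabilizing hp g).toFinset = ∅ := by
      rw [Set.Finite.toFinset_eq_empty, destabilizing_eq_empty_iff hp hr]
      exact h
    rw [h1, sum_chains_empty]
  · rw [Set.indicator_of_notMem (by exact h)]
    obtain ⟨W₀, hW₀, hW⟩ := exists_absorbing hp hr g
      (Set.nonempty_iff_ne_empty.2 (mt (destabilizing_eq_empty_iff hp hr g).1 h))
    exact sum_chains_eq_zero (by rwa [Set.Finite.mem_toFinset])
      (fun W h => by rw [Set.Finite.mem_toFinset] at h ⊢; exact hW W h)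

end Destabilizing

end GeoTrunc

namespace GeoTrunc

/-! ### Compositions and their partial sums -/

section Composition

variable {r : ℕ}

/-- The interior partial sums of a composition. -/
def partialSums (I : Composition r) : Finset ℕ := (Finset.Ioo 0 I.length).image I.sizeUpTo

theorem sizeUpTo_strictMonoOn (I : Composition r) :
    StrictMonoOn I.sizeUpTo (Set.Iic I.length) := by
  intro a _ b hb hab
  exact (I.sizeUpTo_strict_mono (hab.trans_le hb)).trans_le (I.monotone_sizeUpTo hab)

theorem sizeUpTo_injOn (I : Composition r) :
    Set.InjOn I.sizeUpTo (Finset.Ioo 0 I.length : Finset ℕ) :=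
  (sizeUpTo_strictMonoOn I).injOn.mono fun a ha => by
    rw [Finset.coe_Ioo] at ha
    exact ha.2.le

theorem card_partialSums (I : Composition r) : (partialSums I).card = I.length - 1 := by
  rw [partialSums, Finset.card_image_of_injOn (sizeUpTo_injOn I), Nat.card_Ioo, Nat.sub_zero]

theorem mem_boundaries_iff (I : Composition r) (k : Fin (r + 1)) :
    k ∈ I.boundaries ↔ (k : ℕ) = 0 ∨ (k : ℕ) = r ∨ (k : ℕ) ∈ partialSums I := by
  simp only [Composition.boundaries, Finset.mem_map, Finset.mem_univ, true_and, partialSums,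
    Finset.mem_image, Finset.mem_Ioo]
  constructor
  · rintro ⟨i, rfl⟩
    have hi : (I.boundary.toEmbedding i : ℕ) = I.sizeUpTo i := rfl
    rw [hi]
    rcases Nat.eq_zero_or_pos (i : ℕ) with h | h
    · rw [h, I.sizeUpTo_zero]
      exact Or.inl rfl
    · rcases (Nat.lt_succ_iff.1 i.2).lt_or_eq with h1 | h1
      · exact Or.inr (Or.inr ⟨i, ⟨h, h1⟩, rfl⟩)
      · rw [h1, I.sizeUpTo_length]
        exact Or.inr (Or.inl rfl)
  · rintro (h | h | ⟨i, ⟨-, h1⟩, h2⟩)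
    · exact ⟨0, Fin.ext (by rw [h]; exact I.sizeUpTo_zero)⟩
    · exact ⟨Fin.last _, Fin.ext (by rw [h]; exact I.sizeUpTo_length)⟩
    · exact ⟨⟨i, h1.trans (Nat.lt_succ_self _)⟩, Fin.ext h2⟩

theorem partialSums_injective : Function.Injective (partialSums (r := r)) := by
  intro I J h
  refine (compositionEquiv r).injective (CompositionAsSet.ext ?_)
  change I.boundaries = J.boundaries
  ext k
  rw [mem_boundaries_iff, mem_boundaries_iff, h]

theorem mem_partialSums_bounds {I : Composition r} {k : ℕ} (hk : k ∈ partialSums I) :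
    0 < k ∧ k < r := by
  obtain ⟨i, hi, rfl⟩ := Finset.mem_image.1 hk
  rw [Finset.mem_Ioo] at hi
  have h1 := sizeUpTo_strictMonoOn I (Set.mem_Iic.2 (Nat.zero_le _)) (Set.mem_Iic.2 hi.2.le) hi.1
  have h2 := sizeUpTo_strictMonoOn I (Set.mem_Iic.2 hi.2.le) (Set.mem_Iic.2 le_rfl) hi.2
  rw [I.sizeUpTo_zero] at h1
  rw [I.sizeUpTo_length] at h2
  exact ⟨h1, h2⟩

theorem exists_partialSums_eq {D : Finset ℕ} (hD : ∀ k ∈ D, 0 < k ∧ k < r) :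
    ∃ I : Composition r, partialSums I = D := by
  classical
  let A : CompositionAsSet r :=
    { boundaries := Finset.univ.filter fun k : Fin (r + 1) =>
        (k : ℕ) = 0 ∨ (k : ℕ) = r ∨ (k : ℕ) ∈ D
      zero_mem := by simp
      getLast_mem := by simp }
  refine ⟨A.toComposition, ?_⟩
  have key : ∀ k : Fin (r + 1), ((k : ℕ) = 0 ∨ (k : ℕ) = r ∨
      (k : ℕ) ∈ partialSums A.toComposition) ↔ ((k : ℕ) = 0 ∨ (k : ℕ) = r ∨ (k : ℕ) ∈ D) := by
    intro k
    rw [← mem_boundaries_iff, CompositionAsSet.toComposition_boundaries]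
    simp [A]
  ext k
  constructor
  · intro hk
    have hb := mem_partialSums_bounds hk
    rcases (key ⟨k, hb.2.trans (Nat.lt_succ_self _)⟩).1 (Or.inr (Or.inr hk)) with h | h | h
    · exact absurd h hb.1.ne'
    · exact absurd h hb.2.ne
    · exact h
  · intro hk
    have hb := hD k hk
    rcases (key ⟨k, hb.2.trans (Nat.lt_succ_self _)⟩).2 (Or.inr (Or.inr hk)) with h | h | h
    · exact absurd h hb.1.ne'
    · exact absurd h hb.2.ne
    · exact h

end Composition

/-! ### Bases adapted to chains of subspaces -/

section Flags

variable {F : Type*} [Field F] {r : ℕ}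

theorem finrank_coordSubspace {k : ℕ} (hk : k ≤ r) :
    Module.finrank F (coordSubspace F r k) = k := by
  let e : coordSubspace F r k ≃ₗ[F] (Fin k → F) :=
    { toFun := fun x i => x.1 (Fin.castLE hk i)
      map_add' := fun _ _ => rfl
      map_smul' := fun _ _ => rfl
      invFun := fun y => ⟨fun j => if h : (j : ℕ) < k then y ⟨j, h⟩ else 0,
        fun j hj => dif_neg (not_lt.2 hj)⟩
      left_inv := by
        rintro ⟨x, hx⟩
        ext j
        by_cases h : (j : ℕ) < k
        · simp [h]
        · simp [h, hx j (not_lt.1 h)]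
      right_inv := by
        intro y
        ext i
        simp }
  rw [e.finrank_eq, Module.finrank_fin_fun]

theorem coordSubspace_le_iff {k : ℕ} {W : Submodule F (Fin r → F)} :
    coordSubspace F r k ≤ W ↔ ∀ i : Fin r, (i : ℕ) < k → Pi.single i (1 : F) ∈ W := by
  constructor
  · intro h i hi
    refine h fun j hj => Pi.single_eq_of_ne ?_ 1
    rintro rfl
    exact absurd hi (not_lt.2 hj)
  · intro h x hx
    rw [pi_eq_sum_univ' x]
    refine Submodule.sum_mem _ fun i _ => ?_
    rcases lt_or_ge (i : ℕ) k with hi | hi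
    · refine W.smul_mem _ ?_
      convert! h i hi using 1
    · rw [hx i hi, zero_smul]
      exact W.zero_mem

/-- The vector with index k is chosen in the smallest member of C of dimension greater than k, or in
F^r if there is none, outside the span of the k vectors already chosen. -/
theorem exists_adapted_family {C : Finset (Submodule F (Fin r → F))}
    (hC : IsChain (· ≤ ·) (C : Set (Submodule F (Fin r → F)))) (k : ℕ) (hk : k ≤ r) :
    ∃ v : Fin k → (Fin r → F), LinearIndependent F v ∧
      ∀ W ∈ C, ∀ i : Fin k, (i : ℕ) < Module.finrank F W → v i ∈ W := by
  classical
  induction k with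
  | zero => exact ⟨Fin.elim0, linearIndependent_empty_type, fun _ _ i => i.elim0⟩
  | succ k ih =>
    obtain ⟨v, hv, hvC⟩ := ih (Nat.le_of_succ_le hk)
    have hmin : ∃ U : Submodule F (Fin r → F), k < Module.finrank F U ∧
        ∀ W ∈ C, k < Module.finrank F W → U ≤ W := by
      rcases (C.filter fun W : Submodule F (Fin r → F) => k < Module.finrank F W).eq_empty_or_nonempty with h | h
      · refine ⟨⊤, by rw [finrank_top, Module.finrank_fin_fun]; exact hk, fun W hW hkW => ?_⟩
        have : W ∈ C.filter fun W : Submodule F (Fin r → F) => k < Module.finrank F W := Finset.mem_filter.2 ⟨hW, hkW⟩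
        rw [h] at this
        exact absurd this (Finset.notMem_empty _)
      · obtain ⟨U, hU, hUmin⟩ := Finset.exists_minimal h
        rw [Finset.mem_filter] at hU
        refine ⟨U, hU.2, fun W hW hkW => ?_⟩
        rcases hC.total hU.1 hW with h1 | h1
        · exact h1
        · exact hUmin (Finset.mem_filter.2 ⟨hW, hkW⟩) h1
    obtain ⟨U, hkU, hUmin⟩ := hmin
    obtain ⟨u, huU, hu⟩ : ∃ u ∈ U, u ∉ Submodule.span F (Set.range v) := by
      by_contra! hcon
      have h1 := Submodule.finrank_mono (show U ≤ Submodule.span F (Set.range v) from hcon)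
      rw [finrank_span_eq_card hv, Fintype.card_fin] at h1
      exact absurd hkU (not_lt.2 h1)
    refine ⟨Fin.snoc v u, linearIndependent_finSnoc.2 ⟨hv, hu⟩, fun W hW i => ?_⟩
    refine Fin.lastCases (fun hi => ?_) (fun i hi => ?_) i
    · rw [Fin.snoc_last]
      exact hUmin W hW hi huU
    · rw [Fin.snoc_castSucc]
      exact hvC W hW i hi

end Flags

/-! ### The truncation of 1 as a sum over chains -/

section Truncation

variable {F : Type*} [Field F] [NumberField F] {r : ℕ}

omit [NumberField F] in
theorem exists_linAut (e : (Fin r → F) ≃ₗ[F] (Fin r → F)) :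
    ∃ γ : Matrix.GeneralLinearGroup (Fin r) F, linAut γ = e := by
  refine ⟨⟨LinearMap.toMatrix' e.toLinearMap, LinearMap.toMatrix' e.symm.toLinearMap, ?_, ?_⟩, ?_⟩
  · rw [← LinearMap.toMatrix'_comp, LinearEquiv.comp_symm, LinearMap.toMatrix'_id]
  · rw [← LinearMap.toMatrix'_comp, LinearEquiv.symm_comp, LinearMap.toMatrix'_id]
  · refine LinearEquiv.ext fun x => ?_
    rw [linAut_apply]
    exact LinearMap.toMatrix'_mulVec e.toLinearMap x

theorem exists_straightening {C : Finset (Submodule F (Fin r → F))}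
    (hC : IsChain (· ≤ ·) (C : Set (Submodule F (Fin r → F)))) :
    ∃ γ : Matrix.GeneralLinearGroup (Fin r) F, ∀ W ∈ C,
      W.map (linAut γ).toLinearMap = coordSubspace F r (Module.finrank F W) := by
  obtain ⟨v, hv, hvC⟩ := exists_adapted_family hC r le_rfl
  let b := basisOfLinearIndependentOfCardEqFinrank' v hv (by simp)
  obtain ⟨γ, hγ⟩ := exists_linAut b.equivFun
  refine ⟨γ, fun W hW => (Submodule.eq_of_le_of_finrank_eq ?_ ?_).symm⟩
  · rw [coordSubspace_le_iff]
    intro i hi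
    refine ⟨v i, hvC W hW i hi, ?_⟩
    have h1 : b i = v i := by simp [b]
    rw [← h1, hγ]
    change b.equivFun (b i) = _
    ext j
    rw [b.equivFun_self]
    simp [Pi.single_apply, eq_comm]
  · have h1 : Module.finrank F W ≤ r := by
      have := Submodule.finrank_le W
      rwa [Module.finrank_fin_fun] at this
    rw [finrank_coordSubspace h1, LinearEquiv.finrank_map_eq]

omit [NumberField F] in
theorem map_linAut_mul (γ δ : Matrix.GeneralLinearGroup (Fin r) F) (W : Submodule F (Fin r → F)) :
    W.map (linAut (γ * δ)).toLinearMap =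
      (W.map (linAut δ).toLinearMap).map (linAut γ).toLinearMap := by
  rw [← Submodule.map_comp]
  congr 1
  exact LinearMap.ext fun x => linAut_mul γ δ x

omit [NumberField F] in
theorem map_linAut_one (W : Submodule F (Fin r → F)) :
    W.map (linAut (1 : Matrix.GeneralLinearGroup (Fin r) F)).toLinearMap = W := by
  have : (linAut (1 : Matrix.GeneralLinearGroup (Fin r) F)).toLinearMap = LinearMap.id :=
    LinearMap.ext fun x => by
      change linAut 1 x = x
      rw [linAut_apply, Units.val_one, Matrix.one_mulVec]
  rw [this, Submodule.map_id]

omit [NumberField F] in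
theorem map_linAut_inv_eq_iff {γ : Matrix.GeneralLinearGroup (Fin r) F}
    {W W' : Submodule F (Fin r → F)} :
    W.map (linAut γ⁻¹).toLinearMap = W' ↔ W = W'.map (linAut γ).toLinearMap := by
  constructor
  · rintro rfl
    rw [← map_linAut_mul, mul_inv_cancel, map_linAut_one]
  · rintro rfl
    rw [← map_linAut_mul, inv_mul_cancel, map_linAut_one]

omit [NumberField F] in
theorem mem_parabolicPoints_of_map_le {I : Composition r}
    {q : Matrix.GeneralLinearGroup (Fin r) F}
    (h : ∀ i, 0 < i → i < I.length → (coordSubspace F r (I.sizeUpTo i)).map (linAut q).toLinearMap ≤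
      coordSubspace F r (I.sizeUpTo i)) : q ∈ parabolicPoints I F := by
  intro i j hij
  have hm : (I.index j : ℕ) + 1 < I.length := lt_of_le_of_lt hij (I.index i).2
  have h1 := h _ (Nat.succ_pos _) hm
  rw [Submodule.map_le_iff_le_comap, coordSubspace_le_iff] at h1
  have h2 := h1 j (I.lt_sizeUpTo_index_succ j) i
    ((I.monotone_sizeUpTo hij).trans (I.sizeUpTo_index_le i))
  change linAut q (Pi.single j 1) i = 0 at h2
  rw [linAut_apply, Matrix.mulVec_single_one] at h2
  exact h2

omit [NumberField F] in
theorem map_le_of_mem_parabolicPoints {I : Composition r}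
    {q : Matrix.GeneralLinearGroup (Fin r) F} (hq : q ∈ parabolicPoints I F) (m : ℕ) :
    (coordSubspace F r (I.sizeUpTo m)).map (linAut q).toLinearMap ≤
      coordSubspace F r (I.sizeUpTo m) := by
  rw [Submodule.map_le_iff_le_comap]
  intro x hx i hi
  change linAut q x i = 0
  rw [linAut_apply, Matrix.mulVec, dotProduct]
  refine Finset.sum_eq_zero fun j _ => ?_
  rcases le_or_gt (I.sizeUpTo m) j with h | h
  · rw [hx j h, mul_zero]
  · rw [hq, zero_mul]
    have h1 : (I.index j : ℕ) < m := by
      by_contra hcon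
      exact absurd h (not_lt.2 ((I.monotone_sizeUpTo (not_lt.1 hcon)).trans
        (I.sizeUpTo_index_le j)))
    have h2 : m ≤ I.index i := by
      by_contra hcon
      exact absurd (hi.trans_lt (I.lt_sizeUpTo_index_succ i))
        (not_lt.2 (I.monotone_sizeUpTo (not_le.1 hcon)))
    exact h1.trans_le h2

theorem map_eq_of_mem_parabolicPoints {I : Composition r}
    {q : Matrix.GeneralLinearGroup (Fin r) F} (hq : q ∈ parabolicPoints I F) (m : ℕ) :
    (coordSubspace F r (I.sizeUpTo m)).map (linAut q).toLinearMap =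
      coordSubspace F r (I.sizeUpTo m) :=
  Submodule.eq_of_le_of_finrank_eq (map_le_of_mem_parabolicPoints hq m)
    (LinearEquiv.finrank_map_eq _ _)

open Classical in
/-- The chain of proper subspaces whose stabiliser is `δ⁻¹ P_I δ`. -/
noncomputable def chainOf (I : Composition r) (δ : Cosets (parabolicPoints I F)) :
    Finset (Submodule F (Fin r → F)) :=
  (partialSums I).image fun k => (coordSubspace F r k).map (linAut δ.out⁻¹).toLinearMap

omit [NumberField F] in
theorem mem_chainOf {I : Composition r} {δ : Cosets (parabolicPoints I F)}
    {W : Submodule F (Fin r → F)} : W ∈ chainOf I δ ↔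
      ∃ k ∈ partialSums I, (coordSubspace F r k).map (linAut δ.out⁻¹).toLinearMap = W := by
  rw [chainOf, Finset.mem_image]

omit [NumberField F] in
theorem finrank_map_coordSubspace {I : Composition r} {k : ℕ} (hk : k ∈ partialSums I)
    (γ : Matrix.GeneralLinearGroup (Fin r) F) :
    Module.finrank F ((coordSubspace F r k).map (linAut γ).toLinearMap) = k := by
  rw [LinearEquiv.finrank_map_eq, finrank_coordSubspace (mem_partialSums_bounds hk).2.le]

omit [NumberField F] in
theorem card_chainOf (I : Composition r) (δ : Cosets (parabolicPoints I F)) :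
    (chainOf I δ).card = I.length - 1 := by
  classical
  rw [chainOf, ← card_partialSums I]
  refine Finset.card_image_of_injOn fun a ha b hb hab => ?_
  have h := finrank_map_coordSubspace ha δ.out⁻¹
  refine h.symm.trans (Eq.trans ?_ (finrank_map_coordSubspace hb δ.out⁻¹))
  exact congrArg (fun W : Submodule F (Fin r → F) => Module.finrank F W) hab

omit [NumberField F] in
theorem isChain_chainOf (I : Composition r) (δ : Cosets (parabolicPoints I F)) :
    IsChain (· ≤ ·) (chainOf I δ : Set (Submodule F (Fin r → F))) := by
  have hmono : ∀ a b : ℕ, a ≤ b → coordSubspace F r a ≤ coordSubspace F r b :=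
    fun a b h x hx j hj => hx j (h.trans hj)
  intro W hW W' hW' _
  obtain ⟨a, -, rfl⟩ := mem_chainOf.1 hW
  obtain ⟨b, -, rfl⟩ := mem_chainOf.1 hW'
  rcases le_total a b with h | h
  · exact Or.inl (Submodule.map_mono (hmono _ _ h))
  · exact Or.inr (Submodule.map_mono (hmono _ _ h))

omit [NumberField F] in
theorem image_finrank_chainOf (I : Composition r) (δ : Cosets (parabolicPoints I F)) (k : ℕ) :
    k ∈ partialSums I ↔ ∃ W ∈ chainOf I δ, Module.finrank F W = k := by
  constructor
  · exact fun hk => ⟨_, mem_chainOf.2 ⟨k, hk, rfl⟩, finrank_map_coordSubspace hk _⟩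
  · rintro ⟨W, hW, rfl⟩
    obtain ⟨k, hk, rfl⟩ := mem_chainOf.1 hW
    rwa [finrank_map_coordSubspace hk]

omit [NumberField F] in
theorem chainOf_composition_injective {I J : Composition r} {δ : Cosets (parabolicPoints I F)}
    {ε : Cosets (parabolicPoints J F)} (h : chainOf I δ = chainOf J ε) : I = J := by
  refine partialSums_injective (Finset.ext fun k => ?_)
  rw [image_finrank_chainOf I δ, image_finrank_chainOf J ε, h]

omit [NumberField F] in
-- P_I(F) is the stabiliser of its coordinate flag, so a coset is determined by the translated flag.
-- Members of the two chains are matched by dimension.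
theorem chainOf_injective (I : Composition r) :
    Function.Injective (chainOf (F := F) I) := by
  intro δ ε h
  have key : ∀ k ∈ partialSums I, (coordSubspace F r k).map (linAut δ.out⁻¹).toLinearMap =
      (coordSubspace F r k).map (linAut ε.out⁻¹).toLinearMap := by
    intro k hk
    have h1 : (coordSubspace F r k).map (linAut δ.out⁻¹).toLinearMap ∈ chainOf I ε := by
      rw [← h]
      exact mem_chainOf.2 ⟨k, hk, rfl⟩
    obtain ⟨l, hl, hlk⟩ := mem_chainOf.1 h1
    have h2 : l = k := by
      rw [← finrank_map_coordSubspace hl ε.out⁻¹, hlk, finrank_map_coordSubspace hk]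
    rw [← h2, hlk, h2]
  rw [← Quotient.out_eq δ, ← Quotient.out_eq ε]
  refine Quotient.sound (QuotientGroup.rightRel_apply.2 (mem_parabolicPoints_of_map_le ?_))
  intro i h0 h1
  have h2 := key _ (Finset.mem_image_of_mem _ (Finset.mem_Ioo.2 ⟨h0, h1⟩))
  rw [map_linAut_mul, h2, ← map_linAut_mul, mul_inv_cancel, map_linAut_one]

theorem exists_chainOf_eq {C : Finset (Submodule F (Fin r → F))}
    (hC : IsChain (· ≤ ·) (C : Set (Submodule F (Fin r → F)))) (hbot : ⊥ ∉ C) (htop : ⊤ ∉ C) :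
    ∃ (I : Composition r) (δ : Cosets (parabolicPoints I F)), chainOf I δ = C := by
  classical
  obtain ⟨γ, hγ⟩ := exists_straightening hC
  obtain ⟨I, hI⟩ : ∃ I : Composition r,
      partialSums I = C.image fun W : Submodule F (Fin r → F) => Module.finrank F W := by
    refine exists_partialSums_eq fun k hk => ?_
    obtain ⟨W, hW, rfl⟩ := Finset.mem_image.1 hk
    constructor
    · rw [Nat.pos_iff_ne_zero]
      intro h
      rw [Submodule.finrank_eq_zero] at h
      exact hbot (h ▸ hW)
    · have := Submodule.finrank_lt (s := W) (by rintro rfl; exact htop hW)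
      rwa [Module.finrank_fin_fun] at this
  refine ⟨I, cls _ γ, ?_⟩
  set δ := cls (parabolicPoints I F) γ with hδ
  have hq : γ * δ.out⁻¹ ∈ parabolicPoints I F :=
    QuotientGroup.rightRel_apply.1 (Quotient.exact (Quotient.out_eq δ))
  have key : ∀ W ∈ C, (coordSubspace F r (Module.finrank F W)).map (linAut δ.out⁻¹).toLinearMap
      = W := by
    intro W hW
    rw [map_linAut_inv_eq_iff]
    have hk : Module.finrank F W ∈ partialSums I := by
      rw [hI]
      exact Finset.mem_image_of_mem _ hW
    obtain ⟨i, -, hi⟩ := Finset.mem_image.1 hk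
    have h1 := map_eq_of_mem_parabolicPoints ((parabolicPoints I F).inv_mem hq) i
    -- The chosen representative of the coset of γ differs from γ by an element of P_I(F), which
    -- preserves the coordinate subspaces of the flag.
    rw [hi, ← hγ W hW, ← map_linAut_mul] at h1
    rw [← hγ W hW, ← h1]
    congr 3
    group
  ext W
  rw [mem_chainOf, hI]
  constructor
  · rintro ⟨k, hk, rfl⟩
    obtain ⟨W, hW, rfl⟩ := Finset.mem_image.1 hk
    rwa [key W hW]
  · exact fun hW => ⟨_, Finset.mem_image_of_mem _ hW, key W hW⟩

/-- The value of p_P^{δg} at r_i is the height, with respect to g, of the translate by δ⁻¹ of the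
i-th coordinate subspace. -/
theorem bigger_iff (p : ℝ → ℝ) (hr : 0 < r) (I : Composition r)
    (δ : Cosets (parabolicPoints I F)) (g : GA F r) :
    Bigger I ((standard F I).polygon (diag F r δ.out * g)) p ↔
      ∀ W ∈ chainOf I δ, W ∈ destabilizing p g := by
  have key : ∀ k ∈ partialSums I, (standard F I).polygon (diag F r δ.out * g) k =
      ht g ((coordSubspace F r k).map (linAut δ.out⁻¹).toLinearMap) := by
    intro k hk
    obtain ⟨i, hi, rfl⟩ := Finset.mem_image.1 hk
    rw [Finset.mem_Ioo] at hi
    have h1 := polygon_node (standard F I) (diag F r δ.out * g) hr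
      ⟨i, hi.2.trans (Nat.lt_succ_self _)⟩
    have h2 : (standard F I).flag ⟨i, hi.2.trans (Nat.lt_succ_self _)⟩ =
      coordSubspace F r (I.sizeUpTo i) := rfl
    rw [h2, finrank_coordSubspace (I.sizeUpTo_le i)] at h1
    rw [h1, ← ht_diag_mul δ.out g, ← map_linAut_mul, mul_inv_cancel, map_linAut_one]
  constructor
  · intro h W hW
    obtain ⟨k, hk, rfl⟩ := mem_chainOf.1 hW
    have hb := mem_partialSums_bounds hk
    have hf := finrank_map_coordSubspace hk δ.out⁻¹
    refine ⟨fun h0 => ?_, fun h0 => ?_, ?_⟩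
    · rw [h0, finrank_bot] at hf
      exact hb.1.ne hf
    · rw [h0, finrank_top, Module.finrank_fin_fun] at hf
      exact hb.2.ne' hf
    · rw [← key k hk, hf]
      obtain ⟨i, hi, rfl⟩ := Finset.mem_image.1 hk
      rw [Finset.mem_Ioo] at hi
      exact h i hi.1 hi.2
  · intro h i h0 h1
    have hk : I.sizeUpTo i ∈ partialSums I :=
      Finset.mem_image_of_mem _ (Finset.mem_Ioo.2 ⟨h0, h1⟩)
    have h2 := (h _ (mem_chainOf.2 ⟨_, hk, rfl⟩)).2.2
    rwa [finrank_map_coordSubspace hk, ← key _ hk] at h2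

theorem finite_bigger {p : ℝ → ℝ} (hp : IsNormalizedConvex r p) (hr : 0 < r) (g : GA F r)
    (I : Composition r) : {δ : Cosets (parabolicPoints I F) |
      Bigger I ((standard F I).polygon (diag F r δ.out * g)) p}.Finite := by
  classical
  refine Set.Finite.of_finite_image (f := chainOf I) ?_ ((chainOf_injective I).injOn)
  refine ((finite_destabilizing hp g).toFinset.powerset.finite_toSet).subset ?_
  rintro _ ⟨δ, hδ, rfl⟩
  rw [Finset.mem_coe, Finset.mem_powerset]
  intro W hW
  rw [Set.Finite.mem_toFinset]
  exact (bigger_iff p hr I δ g).1 hδ W hW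

/-- The pairs (P, δ) that contribute correspond bijectively to the chains of destabilizing
subspaces, P = G giving the empty chain. The exponent |P| - 1 is the number of members of the chain.
-/
theorem truncation_one {p : ℝ → ℝ} (hp : IsNormalizedConvex r p) (hr : 0 < r)
    (hct : ∀ (I : Composition r) (g : GA F r), constantTerm I (fun _ => 1) g = 1) (g : GA F r) :
    truncation p (fun _ => 1) g = {h : GA F r | CanonicalLE p h}.indicator (fun _ => (1 : ℂ)) g := by
  classical
  rw [← sum_chains_destabilizing hp hr g, truncation]
  have h1 : ∀ I : Composition r, (-1 : ℂ) ^ (I.length - 1) *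
      ∑ᶠ δ : Cosets (parabolicPoints I F), constantTerm I (fun _ => 1) (diag F r δ.out * g) *
        indBigger I p (diag F r δ.out * g) =
      ∑ _δ ∈ (finite_bigger hp hr g I).toFinset, (-1 : ℂ) ^ (I.length - 1) := by
    intro I
    rw [finsum_eq_sum_of_support_subset (s := (finite_bigger hp hr g I).toFinset), Finset.mul_sum]
    · refine Finset.sum_congr rfl fun δ hδ => ?_
      rw [Set.Finite.mem_toFinset] at hδ
      rw [hct, indBigger, if_pos (show Bigger _ _ _ from hδ), mul_one, mul_one]
    · intro δ hδ
      rw [Finset.mem_coe, Set.Finite.mem_toFinset]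
      by_contra hcon
      refine hδ ?_
      change _ * indBigger I p _ = 0
      rw [indBigger, if_neg (show ¬ Bigger _ _ _ from hcon), mul_zero]
  rw [Finset.sum_congr rfl fun I _ => h1 I, Finset.sum_sigma']
  refine Finset.sum_bij (fun x _ => chainOf x.1 x.2) ?_ ?_ ?_ ?_
  · rintro ⟨I, δ⟩ hx
    rw [Finset.mem_sigma, Set.Finite.mem_toFinset] at hx
    rw [mem_chains]
    refine ⟨fun W hW => ?_, isChain_chainOf I δ⟩
    rw [Set.Finite.mem_toFinset]
    exact (bigger_iff p hr I δ g).1 hx.2 W hW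
  · rintro ⟨I, δ⟩ _ ⟨J, ε⟩ _ h
    obtain rfl := chainOf_composition_injective h
    exact congrArg (Sigma.mk I) (chainOf_injective I h)
  · intro C hC
    obtain ⟨hCS, hchain⟩ := mem_chains.1 hC
    have hmem : ∀ W ∈ C, W ∈ destabilizing p g := fun W hW => by
      have := hCS hW
      rwa [Set.Finite.mem_toFinset] at this
    obtain ⟨I, δ, rfl⟩ := exists_chainOf_eq hchain (fun h => (hmem _ h).1 rfl)
      (fun h => (hmem _ h).2.1 rfl)
    refine ⟨⟨I, δ⟩, ?_, rfl⟩
    rw [Finset.mem_sigma, Set.Finite.mem_toFinset]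
    exact ⟨Finset.mem_univ _, (bigger_iff p hr I δ g).2 hmem⟩
  · rintro ⟨I, δ⟩ _
    rw [card_chainOf]

end Truncation

end GeoTrunc

namespace GeoTrunc

/-! ### Compact and discrete subsets of the adeles -/

section FinitePart

variable {F : Type*} [Field F] [NumberField F]

theorem exists_valuation_lt_one (v : HeightOneSpectrum (𝓞 F)) :
    ∃ n : 𝓞 F, n ≠ 0 ∧ v.valuation F (n : F) < 1 := by
  obtain ⟨n, hn, hn0⟩ := Submodule.exists_mem_ne_zero_of_ne_bot v.ne_bot
  exact ⟨n, hn0, (v.valuation_lt_one_iff_mem n).2 hn⟩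

open scoped Valued in
-- Local approximation shows that 𝓞_F / v maps onto the residue field.
theorem finite_residueField (v : HeightOneSpectrum (𝓞 F)) :
    Finite 𝓀[v.adicCompletion F] := by
  obtain ⟨n, hn0, hn⟩ := exists_valuation_lt_one v
  have hfin : Finite (𝓞 F ⧸ v.asIdeal) := Ideal.finiteQuotientOfFreeOfNeBot _ v.ne_bot
  let ι : 𝓞 F →+* 𝒪[v.adicCompletion F] :=
    algebraMap (𝓞 F) (v.adicCompletionIntegers F)
  let f : 𝓞 F →+* 𝓀[v.adicCompletion F] := (IsLocalRing.residue _).comp ι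
  have hval : ∀ x : 𝓞 F, Valued.v (ι x : v.adicCompletion F) = v.valuation F (x : F) :=
    fun x => HeightOneSpectrum.valuedAdicCompletion_eq_valuation' v _
  have hker : ∀ x ∈ v.asIdeal, f x = 0 := by
    intro x hx
    change IsLocalRing.residue _ (ι x) = 0
    rw [IsLocalRing.residue_eq_zero_iff, IsLocalRing.mem_maximalIdeal, mem_nonunits_iff,
      Valuation.Integers.isUnit_iff_valuation_eq_one (Valuation.integer.integers _)]
    refine ne_of_lt ?_
    change Valued.v (ι x : v.adicCompletion F) < 1
    rw [hval]
    exact (v.valuation_lt_one_iff_mem x).2 hx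
  refine Finite.of_surjective (Ideal.Quotient.lift v.asIdeal f hker) ?_
  refine Ideal.Quotient.lift_surjective_of_surjective _ _ fun y => ?_
  obtain ⟨a, rfl⟩ := IsLocalRing.residue_surjective y
  obtain ⟨x, hx⟩ := exists_local_approx v (a := a) a.2 hn0
  refine ⟨x, ?_⟩
  change IsLocalRing.residue _ (ι x) = _
  rw [← sub_eq_zero, ← map_sub, IsLocalRing.residue_eq_zero_iff, IsLocalRing.mem_maximalIdeal,
    mem_nonunits_iff, Valuation.Integers.isUnit_iff_valuation_eq_one (Valuation.integer.integers _)]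
  exact ne_of_lt (hx.trans_lt hn)

open scoped Valued in
theorem compactSpace_adicCompletionIntegers (v : HeightOneSpectrum (𝓞 F)) :
    CompactSpace (v.adicCompletionIntegers F) := by
  change CompactSpace 𝒪[v.adicCompletion F]
  rw [Valued.integer.compactSpace_iff_completeSpace_and_isDiscreteValuationRing_and_finite_residueField]
  refine ⟨?_, inferInstanceAs (IsDiscreteValuationRing (v.adicCompletionIntegers F)),
    finite_residueField v⟩
  exact (Valued.isClosed_integer (v.adicCompletion F)).completeSpace_coe

theorem isCompact_finInt : IsCompact (finInt F : Set (FinAdele F)) := by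
  have : ∀ v : HeightOneSpectrum (𝓞 F), CompactSpace (v.adicCompletionIntegers F) :=
    compactSpace_adicCompletionIntegers
  have h := isCompact_range (RestrictedProduct.isEmbedding_structureMap
    (R := fun v : HeightOneSpectrum (𝓞 F) => v.adicCompletion F)
    (A := fun v => (v.adicCompletionIntegers F : Set (v.adicCompletion F)))
    (𝓕 := Filter.cofinite)).continuous
  rw [RestrictedProduct.range_structureMap] at h
  exact h

instance : T2Space (FinAdele F) :=
  inferInstanceAs (T2Space (RestrictedProduct
    (fun v : HeightOneSpectrum (𝓞 F) => v.adicCompletion F)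
    (fun v => (v.adicCompletionIntegers F : Set (v.adicCompletion F))) Filter.cofinite))

instance : LocallyCompactSpace (FinAdele F) :=
  isCompact_finInt.locallyCompactSpace_of_mem_nhds_of_addGroup
    (isOpen_finInt.mem_nhds (zero_mem (finInt F)))

instance : T2Space (InfiniteAdeleRing F) :=
  inferInstanceAs (T2Space ((v : InfinitePlace F) → v.Completion))

instance : T2Space (Adele F) :=
  inferInstanceAs (T2Space (InfiniteAdeleRing F × FinAdele F))

instance : LocallyCompactSpace (Adele F) :=
  inferInstanceAs (LocallyCompactSpace (InfiniteAdeleRing F × FinAdele F))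

/-- The adeles with bounded archimedean components and denominator dividing `n`. -/
def adelicBox (B : ℝ) (n : 𝓞 F) : Set (Adele F) :=
  {a | (∀ v, ‖toInfinite v a‖ ≤ B) ∧
    algebraMap F (FinAdele F) (n : F) * toFinite F a ∈ finInt F}

omit [NumberField F] in
theorem isCompact_infBox (B : ℝ) :
    IsCompact {a : InfiniteAdeleRing F | ∀ v, ‖InfinitePlace.Completion.extensionEmbedding v (a v)‖
      ≤ B} := by
  have h : IsCompact (Set.univ.pi fun v : InfinitePlace F =>
      {x : v.Completion | ‖InfinitePlace.Completion.extensionEmbedding v x‖ ≤ B}) := by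
    refine isCompact_univ_pi fun v => ?_
    have h1 := (InfinitePlace.Completion.isometry_extensionEmbedding v).isClosedEmbedding
    have h2 := h1.isCompact_preimage (isCompact_closedBall (0 : ℂ) B)
    convert! h2 using 1
    ext x
    simp
  convert! h using 1
  ext a
  exact ⟨fun h v _ => h v, fun h v => h v trivial⟩

theorem isCompact_finBox {n : 𝓞 F} (hn : n ≠ 0) :
    IsCompact {a : FinAdele F | algebraMap F (FinAdele F) (n : F) * a ∈ finInt F} := by
  have hn' : (n : F) ≠ 0 := by exact_mod_cast hn
  have h := isCompact_finInt.image
    (f := fun a : FinAdele F => algebraMap F (FinAdele F) (n : F)⁻¹ * a) (by fun_prop)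
  convert! h using 1
  ext a
  constructor
  · intro ha
    refine ⟨_, ha, ?_⟩
    change algebraMap F (FinAdele F) (n : F)⁻¹ * (algebraMap F (FinAdele F) (n : F) * a) = a
    rw [← mul_assoc, mul_comm (algebraMap F (FinAdele F) (n : F)⁻¹), algebraMap_mul_inv hn', one_mul]
  · rintro ⟨b, hb, rfl⟩
    change algebraMap F (FinAdele F) (n : F) * (algebraMap F (FinAdele F) (n : F)⁻¹ * b) ∈ finInt F
    rw [← mul_assoc, algebraMap_mul_inv hn', one_mul]
    exact hb

theorem isCompact_adelicBox (B : ℝ) {n : 𝓞 F} (hn : n ≠ 0) : IsCompact (adelicBox B n) :=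
  (isCompact_infBox B).prod (isCompact_finBox hn)

/-- 𝓞_F is a full lattice in F ⊗ ℝ, and subtracting the integral part with respect to its basis
leaves a bounded remainder. -/
theorem exists_lattice_bound (F : Type*) [Field F] [NumberField F] : ∃ B : ℝ,
    ∀ a : InfiniteAdeleRing F, ∃ y : 𝓞 F,
    ∀ v, ‖InfinitePlace.Completion.extensionEmbedding v (a v) - v.embedding (y : F)‖ ≤ B := by
  classical
  let b := mixedEmbedding.latticeBasis F
  refine ⟨∑ i, ‖b i‖, fun a => ?_⟩
  set m := InfiniteAdeleRing.ringEquiv_mixedSpace F a with hm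
  have h1 : (ZSpan.floor b m : mixedEmbedding.mixedSpace F) ∈
      Submodule.span ℤ (Set.range b) := (ZSpan.floor b m).2
  rw [mixedEmbedding.mem_span_latticeBasis] at h1
  obtain ⟨y, hy⟩ := h1
  have h2 := ZSpan.norm_fract_le b m
  rw [ZSpan.fract_apply, ← hy] at h2
  refine ⟨y, fun v => ?_⟩
  refine le_trans ?_ h2
  by_cases hv : v.IsReal
  · refine le_trans ?_ (norm_fst_le _)
    refine le_trans (le_of_eq ?_) (norm_le_pi_norm _ ⟨v, hv⟩)
    have h3 : InfinitePlace.Completion.extensionEmbedding v (a v) - v.embedding (y : F) =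
        InfinitePlace.Completion.extensionEmbedding v (a v - ((y : F) : v.Completion)) := by
      rw [map_sub]
      congr 1
      exact (InfinitePlace.Completion.extensionEmbedding_coe v _).symm
    have h4 : (m - mixedEmbedding F (y : F)).1 ⟨v, hv⟩ =
        InfinitePlace.Completion.extensionEmbeddingOfIsReal hv (a v - ((y : F) : v.Completion)) := by
      rw [map_sub, InfiniteAdeleRing.mixedEmbedding_eq_algebraMap_comp]
      rfl
    rw [h3]
    refine Eq.trans ?_ (congrArg norm h4.symm)
    rw [← InfinitePlace.Completion.extensionEmbeddingOfIsReal_apply hv, Complex.norm_real]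
  · rw [InfinitePlace.not_isReal_iff_isComplex] at hv
    refine le_trans ?_ (norm_snd_le _)
    refine le_trans (le_of_eq ?_) (norm_le_pi_norm _ ⟨v, hv⟩)
    refine congrArg norm ?_
    rfl

/-- 𝔸 is the sum of F and a compact set. The element x makes the finite components integral; y,
being in 𝓞_F, then bounds the infinite components without disturbing the finite ones. -/
theorem exists_sub_mem_adelicBox (F : Type*) [Field F] [NumberField F] : ∃ B : ℝ, 0 ≤ B ∧
    ∀ a : Adele F, ∃ x : F, a + algebraMap F (Adele F) x ∈ adelicBox B (1 : 𝓞 F) := by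
  obtain ⟨B, hB⟩ := exists_lattice_bound F
  refine ⟨max B 0, le_max_right _ _, fun a => ?_⟩
  obtain ⟨x, hx⟩ := exists_approx (toFinite F a) (one_ne_zero (α := 𝓞 F))
  obtain ⟨y, hy⟩ := hB (a.1 - algebraMap F (InfiniteAdeleRing F) x)
  refine ⟨-(x + y), fun v => ?_, ?_⟩
  · refine le_trans (le_of_eq ?_) ((hy v).trans (le_max_left _ _))
    congr 1
    rw [map_add, toInfinite_algebraMap, map_neg, map_add]
    have h1 : InfinitePlace.Completion.extensionEmbedding v
        ((a.1 - algebraMap F (InfiniteAdeleRing F) x) v) = toInfinite v a - v.embedding x := by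
      rw [← toInfinite_algebraMap v x]
      exact map_sub (InfinitePlace.Completion.extensionEmbedding v) _ _
    rw [h1]
    ring
  · have h1 : ((1 : 𝓞 F) : F) = 1 := map_one _
    rw [h1, map_one, one_mul, map_add]
    rw [h1, inv_one, map_one, one_mul] at hx
    have h2 : toFinite F (algebraMap F (Adele F) (-(x + y))) =
        -(algebraMap F (FinAdele F) x) - algebraMap F (FinAdele F) y := by
      have : toFinite F (algebraMap F (Adele F) (-(x + y))) =
        algebraMap F (FinAdele F) (-(x + y)) := rfl
      rw [this, map_neg, map_add]
      ring
    rw [h2]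
    have h3 := sub_mem (neg_mem hx) (coe_mem_finInt y)
    convert! h3 using 1
    ring

/-- A neighbourhood of zero in the adeles that contains no nonzero element of `F`. -/
def adelicUnitBall (F : Type*) [Field F] [NumberField F] : Set (Adele F) :=
  {a | (∀ v, ‖toInfinite v a‖ < 1) ∧ toFinite F a ∈ finInt F}

theorem isOpen_adelicUnitBall : IsOpen (adelicUnitBall F) := by
  refine IsOpen.inter (s := {a : Adele F | ∀ v, ‖toInfinite v a‖ < 1}) ?_
    (isOpen_finInt.preimage continuous_toFinite)
  have : {a : Adele F | ∀ v, ‖toInfinite v a‖ < 1} = ⋂ v, {a | ‖toInfinite v a‖ < 1} := by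
    ext a
    simp
  rw [this]
  exact isOpen_iInter_of_finite fun v =>
    isOpen_lt (continuous_toInfinite v).norm continuous_const

/-- A nonzero algebraic integer cannot have all its archimedean absolute values below 1. -/
theorem eq_zero_of_mem_adelicUnitBall {x : F} (hx : algebraMap F (Adele F) x ∈ adelicUnitBall F) :
    x = 0 := by
  obtain ⟨y, rfl⟩ := algebraMap_mem_finInt.1 (show algebraMap F (FinAdele F) x ∈ finInt F from hx.2)
  by_contra h0
  have hy : y ≠ 0 := by
    rintro rfl
    exact h0 (map_zero _)
  obtain ⟨w⟩ : Nonempty (InfinitePlace F) := inferInstance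
  have hlt : ∀ v : InfinitePlace F, v (y : F) < 1 := by
    intro v
    have := hx.1 v
    rw [toInfinite_algebraMap] at this
    rwa [← InfinitePlace.norm_embedding_eq]
  exact absurd (hlt w) (not_lt.2 (InfinitePlace.one_le_of_lt_one hy fun z _ => hlt z))

theorem zero_mem_adelicUnitBall : (0 : Adele F) ∈ adelicUnitBall F := by
  refine ⟨fun v => ?_, ?_⟩
  · rw [map_zero, norm_zero]
    exact one_pos
  · rw [map_zero]
    exact zero_mem _

end FinitePart

/-! ### Compact subsets of GL_r(𝔸) -/

section LinearGroup

variable {F : Type*} [Field F] [NumberField F] {r : ℕ}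

/-- The unit group carries the topology induced by g ↦ (g, g⁻¹), which is a closed embedding, so the
entries of g⁻¹ must be confined as well. -/
theorem isCompact_entries {Q : Set (Adele F)} (hQ : IsCompact Q) :
    IsCompact {g : GA F r | ∀ i j, g.val i j ∈ Q ∧ (g⁻¹).val i j ∈ Q} := by
  have h1 : IsCompact {M : Matrix (Fin r) (Fin r) (Adele F) | ∀ i j, M i j ∈ Q} := by
    have h := isCompact_univ_pi fun _ : Fin r => isCompact_univ_pi fun _ : Fin r => hQ
    convert! h using 1
    ext M
    exact ⟨fun h i _ j _ => h i j, fun h i j => h i trivial j trivial⟩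
  have h2 := h1.prod (h1.image MulOpposite.continuous_op)
  have h3 := (Units.isClosedEmbedding_embedProduct
    (α := Matrix (Fin r) (Fin r) (Adele F))).isCompact_preimage h2
  convert! h3 using 1
  ext g
  constructor
  · exact fun h => ⟨fun i j => (h i j).1, _, fun i j => (h i j).2, rfl⟩
  · rintro ⟨ha, M, hM, hMg⟩ i j
    refine ⟨ha i j, ?_⟩
    have : M = (g⁻¹).val := MulOpposite.op_injective hMg
    rw [← this]
    exact hM i j

instance : LocallyCompactSpace (GA F r) :=
  have : LocallyCompactSpace (Matrix (Fin r) (Fin r) (Adele F)) :=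
    inferInstanceAs (LocallyCompactSpace (Fin r → Fin r → Adele F))
  have : LocallyCompactSpace (Matrix (Fin r) (Fin r) (Adele F))ᵐᵒᵖ :=
    MulOpposite.opHomeomorph.symm.isClosedEmbedding.locallyCompactSpace
  (Units.isClosedEmbedding_embedProduct
    (α := Matrix (Fin r) (Fin r) (Adele F))).locallyCompactSpace

end LinearGroup

end GeoTrunc

namespace GeoTrunc

/-! ### Invariant measures on quotients by discrete cocompact subgroups -/

section InvariantMeasure

variable {N : Type*} [Group N] [TopologicalSpace N] [IsTopologicalGroup N] {Γ : Subgroup N}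

theorem cls_eq_iff {G : Type*} [Group G] {H : Subgroup G} {a b : G} :
    cls H a = cls H b ↔ b * a⁻¹ ∈ H := by
  rw [← QuotientGroup.rightRel_apply]
  exact Quotient.eq

theorem cls_mul_left {G : Type*} [Group G] {H : Subgroup G} {h : G} (hh : h ∈ H) (g : G) :
    cls H (h * g) = cls H g := by
  rw [cls_eq_iff]
  simpa using hh

theorem isOpen_saturation {U : Set N} (hU : IsOpen U) : IsOpen {n : N | ∃ γ ∈ Γ, γ * n ∈ U} := by
  have : {n : N | ∃ γ ∈ Γ, γ * n ∈ U} = ⋃ γ : Γ, (fun n => (γ : N) * n) ⁻¹' U := by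
    ext n
    simp
  rw [this]
  exact isOpen_iUnion fun γ => hU.preimage (continuous_const_mul _)

/-- K is covered by finitely many open sets so small that no two distinct points of one of them are
Γ-equivalent. Removing from each the Γ-saturation of its predecessors leaves exactly one point of
each orbit. -/
theorem exists_strict_fundamentalDomain [LocallyCompactSpace N] [MeasurableSpace N] [BorelSpace N]
    {V : Set N} (hV : V ∈ 𝓝 1) (hΓ : ∀ γ ∈ Γ, γ ∈ V → γ = 1) {K : Set N} (hK : IsCompact K)
    (hΓK : ∀ n, ∃ γ ∈ Γ, γ * n ∈ K) :
    ∃ D L : Set N, MeasurableSet D ∧ IsCompact L ∧ D ⊆ L ∧ ∀ x, ∃! γ : Γ, (γ : N) * x ∈ D := by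
  obtain ⟨V', hV', hVV⟩ := exists_nhds_split_inv hV
  obtain ⟨L, hL1, hLV, hL⟩ := local_compact_nhds hV'
  let U : N → Set N := fun x => (fun n => n * x⁻¹) ⁻¹' interior L
  have hUo : ∀ x, IsOpen (U x) := fun x => isOpen_interior.preimage (continuous_mul_const _)
  have hUx : ∀ x, x ∈ U x := fun x => by
    change x * x⁻¹ ∈ interior L
    rw [mul_inv_cancel]
    exact mem_interior_iff_mem_nhds.2 hL1
  have hUL : ∀ x, U x ⊆ (fun n => n * x) '' L := fun x n hn =>
    ⟨n * x⁻¹, interior_subset hn, by simp⟩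
  have hUinj : ∀ x, ∀ a ∈ U x, ∀ b ∈ U x, a * b⁻¹ ∈ V := by
    intro x a ha b hb
    have := hVV _ (hLV (interior_subset ha)) _ (hLV (interior_subset hb))
    simpa [div_eq_mul_inv, mul_assoc] using this
  obtain ⟨t, -, ht⟩ := hK.elim_nhds_subcover U fun x _ => (hUo x).mem_nhds (hUx x)
  let e := t.equivFin
  let W : Fin t.card → Set N := fun i => U (e.symm i)
  have hcov : ∀ n, ∃ i, ∃ γ ∈ Γ, γ * n ∈ W i := by
    intro n
    obtain ⟨γ, hγ, hn⟩ := hΓK n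
    obtain ⟨x, hx, hxn⟩ := Set.mem_iUnion₂.1 (ht hn)
    refine ⟨e ⟨x, hx⟩, γ, hγ, ?_⟩
    simpa [W] using hxn
  refine ⟨⋃ i, (W i \ ⋃ j, ⋃ _ : j < i, {n | ∃ γ ∈ Γ, γ * n ∈ W j}),
    ⋃ i, (fun n => n * (e.symm i : N)) '' L, ?_, ?_, ?_, fun x => ?_⟩
  · refine MeasurableSet.iUnion fun i => (hUo _).measurableSet.diff ?_
    exact (isOpen_iUnion fun j => isOpen_iUnion fun _ => isOpen_saturation (hUo _)).measurableSet
  · exact isCompact_iUnion fun i => hL.image (continuous_mul_const _)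
  · exact Set.iUnion_mono fun i => Set.sdiff_subset.trans (hUL _)
  · obtain ⟨i, ⟨γ, hγ, hi⟩, hmin⟩ := WellFounded.has_min (wellFounded_lt (α := Fin t.card))
      {i | ∃ γ ∈ Γ, γ * x ∈ W i} (hcov x)
    refine ⟨⟨γ, hγ⟩, ?_, ?_⟩
    · refine Set.mem_iUnion.2 ⟨i, hi, fun hcon => ?_⟩
      obtain ⟨j, hj, γ', hγ', hx⟩ := Set.mem_iUnion₂.1 hcon
      exact hmin j ⟨γ' * γ, Γ.mul_mem hγ' hγ, by simpa [mul_assoc] using hx⟩ hj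
    · rintro ⟨γ', hγ'⟩ h
      obtain ⟨j, hj, hjn⟩ := Set.mem_iUnion.1 h
      have hij : i = j := by
        refine le_antisymm (not_lt.1 (hmin j ⟨γ', hγ', hj⟩)) (not_lt.1 fun hlt => hjn ?_)
        exact Set.mem_iUnion₂.2 ⟨i, hlt, γ * γ'⁻¹, Γ.mul_mem hγ (Γ.inv_mem hγ'), by
          simpa [mul_assoc] using hi⟩
      subst hij
      have h1 := hΓ (γ' * γ⁻¹) (Γ.mul_mem hγ' (Γ.inv_mem hγ)) (by
        have := hUinj _ _ hj _ hi
        simpa [mul_assoc] using this)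
      exact Subtype.ext (mul_inv_eq_one.1 h1)

/-- The measure is the image of Haar measure on a fundamental domain, normalised. Right translation
turns this domain into another fundamental domain and multiplies Haar measure by a constant. -/
theorem exists_invariant_probability [LocallyCompactSpace N] [Countable Γ]
    {V : Set N} (hV : V ∈ 𝓝 1) (hΓ : ∀ γ ∈ Γ, γ ∈ V → γ = 1) {K : Set N} (hK : IsCompact K)
    (hΓK : ∀ n, ∃ γ ∈ Γ, γ * n ∈ K) [MeasurableSpace (Cosets Γ)] [BorelSpace (Cosets Γ)] :
    ∃ μ : Measure (Cosets Γ), IsProbabilityMeasure μ ∧ ∀ (n : N) (f : Cosets Γ → Cosets Γ),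
      (∀ m, f (cls Γ m) = cls Γ (m * n)) → μ.map f = μ := by
  borelize N
  obtain ⟨D, L, hD, hL, hDL, hDΓ⟩ := exists_strict_fundamentalDomain hV hΓ hK hΓK
  let ν : Measure N := Measure.haar
  have hπ : Continuous (cls Γ) := continuous_quot_mk
  have hfund : ∀ n : N, IsFundamentalDomain Γ ((fun m => m * n⁻¹) ⁻¹' D) ν := by
    intro n
    refine IsFundamentalDomain.mk'
      ((continuous_mul_const _).measurable hD).nullMeasurableSet fun x => ?_
    obtain ⟨γ, hγ, huniq⟩ := hDΓ (x * n⁻¹)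
    refine ⟨γ, ?_, fun γ' h => huniq γ' ?_⟩
    · change (γ : N) * x * n⁻¹ ∈ D
      rwa [mul_assoc]
    · have h' : (γ' : N) * x * n⁻¹ ∈ D := h
      rwa [mul_assoc] at h'
  have hfund1 : IsFundamentalDomain Γ D ν := by
    have := hfund 1
    simpa using this
  have hνD : ν D ≠ ⊤ := ((measure_mono hDL).trans_lt hL.measure_lt_top).ne
  have hνD0 : ν D ≠ 0 := hfund1.measure_ne_zero (NeZero.ne ν)
  let μ₀ : Measure (Cosets Γ) := (ν.restrict D).map (cls Γ)
  have hμ₀ : ∀ A, MeasurableSet A → μ₀ A = ν (cls Γ ⁻¹' A ∩ D) := fun A hA => by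
    rw [Measure.map_apply hπ.measurable hA, Measure.restrict_apply (hπ.measurable hA)]
  have hμ₀u : μ₀ Set.univ = ν D := by
    rw [hμ₀ _ MeasurableSet.univ, Set.preimage_univ, Set.univ_inter]
  have hinv : ∀ (n : N) (f : Cosets Γ → Cosets Γ),
      (∀ m, f (cls Γ m) = cls Γ (m * n)) → μ₀.map f = μ₀ := by
    intro n f hf
    have hfc : Continuous f := by
      refine (isQuotientMap_quot_mk (X := N)).continuous_iff.2 ?_
      have : f ∘ cls Γ = cls Γ ∘ fun m => m * n := funext hf
      change Continuous (f ∘ cls Γ)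
      rw [this]
      exact hπ.comp (continuous_mul_const _)
    have : (ν.map (· * n)).Regular :=
      (inferInstance : Measure.Regular ν).map (Homeomorph.mulRight n)
    have hc := Measure.isMulLeftInvariant_eq_smul_of_regular (ν.map (· * n)) ν
    set c := Measure.haarScalarFactor (ν.map (· * n)) ν with hcdef
    have key : ∀ A, MeasurableSet A → μ₀ (f ⁻¹' A) = c • μ₀ A := by
      intro A hA
      have hB := hπ.measurable hA
      have hDn : MeasurableSet ((fun m => m * n⁻¹) ⁻¹' D) := (continuous_mul_const _).measurable hD
      rw [hμ₀ _ (hfc.measurable hA), hμ₀ _ hA]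
      have h1 : cls Γ ⁻¹' (f ⁻¹' A) ∩ D =
          (· * n) ⁻¹' (cls Γ ⁻¹' A ∩ (fun m => m * n⁻¹) ⁻¹' D) := by
        ext m
        simp [hf]
      rw [h1, ← Measure.map_apply (measurable_mul_const n) (hB.inter hDn), hc,
        Measure.smul_apply, (hfund n).measure_set_eq hfund1 hB]
      intro γ
      ext m
      change cls Γ ((γ : N) * m) ∈ A ↔ cls Γ m ∈ A
      rw [cls_mul_left γ.2]
    -- The total mass of the quotient is finite and nonzero and is preserved by translation, so the
    -- constant is 1.
    have hc1 : c = 1 := by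
      have h1 := key Set.univ MeasurableSet.univ
      rw [Set.preimage_univ, hμ₀u, ENNReal.smul_def, smul_eq_mul] at h1
      have h2 : (c : ENNReal) * ν D = 1 * ν D := by rw [one_mul, ← h1]
      exact_mod_cast (ENNReal.mul_left_inj hνD0 hνD).1 h2
    refine Measure.ext fun A hA => ?_
    rw [Measure.map_apply hfc.measurable hA, key A hA, hc1, one_smul]
  refine ⟨(ν D)⁻¹ • μ₀, ⟨?_⟩, fun n f hf => ?_⟩
  · rw [Measure.smul_apply, hμ₀u, smul_eq_mul, ENNReal.inv_mul_cancel hνD0 hνD]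
  · rw [Measure.map_smul, hinv n f hf]

end InvariantMeasure

/-! ### Compactness of N(F) \ N(𝔸) and constant terms -/

section Unipotent

variable {F : Type*} [Field F] [NumberField F] {r : ℕ}

theorem isClosed_unipotentPoints (I : Composition r) :
    IsClosed (unipotentPoints I (Adele F) : Set (GA F r)) := by
  have : (unipotentPoints I (Adele F) : Set (GA F r)) = ⋂ i, ⋂ j, ⋂ _ : I.index j ≤ I.index i,
      {g : GA F r | g.val i j = (1 : Matrix (Fin r) (Fin r) (Adele F)) i j} := by
    ext g
    simp only [Set.mem_iInter]
    rfl
  rw [this]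
  exact isClosed_iInter fun i => isClosed_iInter fun j => isClosed_iInter fun _ =>
    isClosed_eq (continuous_entry i j) continuous_const

instance (I : Composition r) : LocallyCompactSpace (unipotentPoints I (Adele F)) :=
  (isClosed_unipotentPoints I).isClosedEmbedding_subtypeVal.locallyCompactSpace

theorem det_of_unipotent {R : Type*} [CommRing R] (I : Composition r)
    {M : Matrix (Fin r) (Fin r) R} (hM : ∀ i j, I.index j ≤ I.index i → M i j =
      (1 : Matrix (Fin r) (Fin r) R) i j) : M.det = 1 := by
  have hmono : ∀ {i j : Fin r}, j < i → I.index j ≤ I.index i := by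
    intro i j hij
    by_contra hcon
    rw [not_le, Fin.lt_def] at hcon
    have h1 := I.lt_sizeUpTo_index_succ i
    have h2 := I.sizeUpTo_index_le j
    have h3 := I.monotone_sizeUpTo hcon
    rw [Fin.lt_def] at hij
    have h4 : I.sizeUpTo (I.index i).succ ≤ I.sizeUpTo (I.index j) := h3
    omega
  rw [Matrix.det_of_isUpperTriangular]
  · exact Finset.prod_eq_one fun i _ => by rw [hM i i le_rfl, Matrix.one_apply_eq]
  · intro i j hij
    exact (hM i j (hmono hij)).trans (Matrix.one_apply_ne (ne_of_gt hij))

/-- Row i of γ is built block by block. An entry x k in block m contributes only to column k and to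
columns of later blocks. It can thus be adjusted to bring column k of the product into Q without
spoiling the columns already treated. -/
theorem exists_row {Q : Set (Adele F)} (hQ : ∀ a : Adele F, ∃ x : F,
      a + algebraMap F (Adele F) x ∈ Q) (I : Composition r)
    {n : GA F r} (hn : n ∈ unipotentPoints I (Adele F)) (i : Fin r) (m : ℕ) :
    ∃ x : Fin r → F, (∀ j, I.index j ≤ I.index i → x j = (1 : Matrix (Fin r) (Fin r) F) i j) ∧
      ∀ j, I.index i < I.index j → (I.index j : ℕ) < m →
        ∑ k, algebraMap F (Adele F) (x k) * n.val k j ∈ Q := by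
  classical
  induction m with
  | zero => exact ⟨fun j => (1 : Matrix (Fin r) (Fin r) F) i j, fun _ _ => rfl,
      fun j _ h => absurd h (Nat.not_lt_zero _)⟩
  | succ m ih =>
    obtain ⟨x, hx1, hx2⟩ := ih
    choose y hy using fun j => hQ (∑ k ∈ Finset.univ.erase j, algebraMap F (Adele F) (x k) * n.val k j)
    refine ⟨fun j => if I.index i < I.index j ∧ (I.index j : ℕ) = m then y j else x j,
      fun j hj => ?_, fun j hij hjm => ?_⟩
    · exact (if_neg fun h => absurd h.1 (not_lt.2 hj)).trans (hx1 j hj)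
    · have hzero : ∀ k, k ≠ j → I.index j ≤ I.index k → n.val k j = 0 := fun k hk hjk => by
        rw [hn k j hjk, Matrix.one_apply_ne hk]
      have hone : n.val j j = 1 := by rw [hn j j le_rfl, Matrix.one_apply_eq]
      have hcongr : ∀ k ∈ Finset.univ.erase j, algebraMap F (Adele F)
          (if I.index i < I.index k ∧ (I.index k : ℕ) = m then y k else x k) * n.val k j =
          algebraMap F (Adele F) (x k) * n.val k j := by
        intro k hk
        split_ifs with h
        · rw [hzero k (Finset.ne_of_mem_erase hk) (by rw [Fin.le_def]; omega), mul_zero, mul_zero]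
        · rfl
      rw [← Finset.sum_erase_add _ _ (Finset.mem_univ j), Finset.sum_congr rfl hcongr, hone,
        mul_one]
      beta_reduce
      rcases Nat.lt_succ_iff_lt_or_eq.1 hjm with h | h
      · rw [if_neg fun h' => absurd h'.2 h.ne]
        have := hx2 j hij h
        rwa [← Finset.sum_erase_add _ _ (Finset.mem_univ j), hone, mul_one] at this
      · rw [if_pos ⟨hij, h⟩]
        exact hy j

theorem exists_unipotent_reduction (I : Composition r) : ∃ Q : Set (Adele F), IsCompact Q ∧
    ∀ n ∈ unipotentPoints I (Adele F), ∃ γ ∈ unipotentPoints I F,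
      ∀ i j, (diag F r γ * n).val i j ∈ Q := by
  obtain ⟨B, -, hB⟩ := exists_sub_mem_adelicBox F
  -- The points 0 and 1 accommodate the entries prescribed by unipotency.
  refine ⟨adelicBox B 1 ∪ {0, 1}, (isCompact_adelicBox B one_ne_zero).union
    (Set.toFinite _).isCompact, fun n hn => ?_⟩
  choose x hx1 hx2 using fun i => exists_row hB I hn i I.length
  let M : Matrix (Fin r) (Fin r) F := Matrix.of x
  have hdet : M.det = 1 := det_of_unipotent I fun i j h => hx1 i j h
  let γ : Matrix.GeneralLinearGroup (Fin r) F := Matrix.GeneralLinearGroup.mkOfDetNeZero M (by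
    rw [hdet]; exact one_ne_zero)
  refine ⟨γ, fun i j h => hx1 i j h, fun i j => ?_⟩
  have hent : (diag F r γ * n).val i j = ∑ k, algebraMap F (Adele F) (x i k) * n.val k j := rfl
  rcases le_or_gt (I.index j) (I.index i) with h | h
  · right
    have h1 : diag F r γ ∈ unipotentPoints I (Adele F) := by
      intro k l hkl
      change algebraMap F (Adele F) (x k l) = _
      rw [hx1 k l hkl, Matrix.one_apply, Matrix.one_apply]
      split_ifs
      · exact map_one _
      · exact map_zero _
    rw [(unipotentPoints I (Adele F)).mul_mem h1 hn i j h, Matrix.one_apply]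
    split_ifs
    · exact Or.inr rfl
    · exact Or.inl rfl
  · left
    rw [hent]
    exact hx2 i j h (I.index j).2

/-- The determinant is 1, so the inverse is the adjugate and its entries range over a compact set as
well. -/
theorem isCompact_unipotent_entries (I : Composition r) {Q : Set (Adele F)} (hQ : IsCompact Q) :
    IsCompact {n : unipotentPoints I (Adele F) | ∀ i j, (n : GA F r).val i j ∈ Q} := by
  have h1 : IsCompact {M : Matrix (Fin r) (Fin r) (Adele F) | ∀ i j, M i j ∈ Q} := by
    have h := isCompact_univ_pi fun _ : Fin r => isCompact_univ_pi fun _ : Fin r => hQ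
    convert! h using 1
    ext M
    exact ⟨fun h i _ j _ => h i j, fun h i j => h i trivial j trivial⟩
  let Q' : Set (Adele F) := Q ∪ ⋃ i : Fin r, ⋃ j : Fin r,
    (fun M : Matrix (Fin r) (Fin r) (Adele F) => M.adjugate i j) '' {M | ∀ i j, M i j ∈ Q}
  have hQ' : IsCompact Q' := hQ.union (isCompact_iUnion fun i => isCompact_iUnion fun j =>
    h1.image ((continuous_id.matrix_adjugate).matrix_elem i j))
  have h2 := (isClosed_unipotentPoints (F := F) I).isClosedEmbedding_subtypeVal.isCompact_preimage
    (isCompact_entries (r := r) hQ')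
  refine h2.of_isClosed_subset ?_ fun n hn i j => ⟨Or.inl (hn i j), Or.inr ?_⟩
  · have : {n : unipotentPoints I (Adele F) | ∀ i j, (n : GA F r).val i j ∈ Q} =
        ⋂ i, ⋂ j, {n : unipotentPoints I (Adele F) | (n : GA F r).val i j ∈ Q} := by
      ext n
      simp
    rw [this]
    exact isClosed_iInter fun i => isClosed_iInter fun j =>
      hQ.isClosed.preimage ((continuous_entry i j).comp continuous_subtype_val)
  · refine Set.mem_iUnion₂.2 ⟨i, j, (n : GA F r).val, hn, ?_⟩
    have hdet : (n : GA F r).val.det = 1 := det_of_unipotent I n.2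
    change (n : GA F r).val.adjugate i j = _
    rw [Matrix.coe_units_inv, Matrix.inv_def, hdet, Ring.inverse_one, one_smul]

theorem mem_unipotentRational {I : Composition r} {n : unipotentPoints I (Adele F)} :
    n ∈ unipotentRational F I ↔ ∃ γ ∈ unipotentPoints I F, diag F r γ = n := by
  rw [unipotentRational, Subgroup.mem_subgroupOf, Subgroup.mem_map]

instance (I : Composition r) : Countable (unipotentRational F I) := by
  have : Countable F := (Module.finBasis ℚ F).equivFun.toEquiv.countable_iff.2 inferInstance
  have : Countable (Matrix (Fin r) (Fin r) F) := inferInstanceAs (Countable (Fin r → Fin r → F))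
  have : Countable (Matrix.GeneralLinearGroup (Fin r) F) :=
    Units.val_injective.countable
  choose γ _ hγ using fun n : unipotentRational F I => mem_unipotentRational.1 n.2
  refine Function.Injective.countable (f := γ) fun a b hab => ?_
  refine Subtype.ext (Subtype.ext ?_)
  rw [← hγ a, ← hγ b, hab]

/-- N(F) is discrete because the adelic unit ball contains no nonzero element of F, and it is
cocompact by row reduction. -/
theorem exists_isNormalizedInvariant (I : Composition r) :
    ∃ μ : Measure (UnipotentQuotient F I), IsNormalizedInvariant μ := by
  obtain ⟨Q, hQ, hQN⟩ := exists_unipotent_reduction (F := F) I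
  have : BorelSpace (UnipotentQuotient F I) := ⟨rfl⟩
  let V : Set (unipotentPoints I (Adele F)) :=
    ⋂ i : Fin r, ⋂ j : Fin r, {n | (n : GA F r).val i j -
      (1 : Matrix (Fin r) (Fin r) (Adele F)) i j ∈ adelicUnitBall F}
  have hVo : IsOpen V := isOpen_iInter_of_finite fun i => isOpen_iInter_of_finite fun j =>
    isOpen_adelicUnitBall.preimage
      (((continuous_entry i j).comp continuous_subtype_val).sub continuous_const)
  have hV : V ∈ 𝓝 1 := by
    refine hVo.mem_nhds (Set.mem_iInter₂.2 fun i j => ?_)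
    change (1 : Matrix (Fin r) (Fin r) (Adele F)) i j - _ ∈ adelicUnitBall F
    rw [sub_self]
    exact zero_mem_adelicUnitBall
  have hdisc : ∀ n ∈ unipotentRational F I, n ∈ V → n = 1 := by
    intro n hn hnV
    obtain ⟨γ, -, hγ⟩ := mem_unipotentRational.1 hn
    have h1 : γ = 1 := by
      refine Units.ext (Matrix.ext fun i j => ?_)
      have h2 := Set.mem_iInter₂.1 hnV i j
      rw [← sub_eq_zero]
      refine eq_zero_of_mem_adelicUnitBall ?_
      rw [Set.mem_ofPred_eq, ← hγ] at h2
      convert! h2 using 1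
      rw [map_sub]
      congr 1
      rw [Units.val_one, Matrix.one_apply, Matrix.one_apply]
      split_ifs
      · exact map_one _
      · exact map_zero _
    refine Subtype.ext ?_
    rw [← hγ, h1, map_one]
    rfl
  have hcomp : ∀ n : unipotentPoints I (Adele F), ∃ γ ∈ unipotentRational F I,
      γ * n ∈ {n : unipotentPoints I (Adele F) | ∀ i j, (n : GA F r).val i j ∈ Q} := by
    intro n
    obtain ⟨γ, hγ, h⟩ := hQN n n.2
    have h1 : diag F r γ ∈ unipotentPoints I (Adele F) := by
      intro k l hkl
      change algebraMap F (Adele F) (γ.val k l) = _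
      rw [hγ k l hkl, Matrix.one_apply, Matrix.one_apply]
      split_ifs
      · exact map_one _
      · exact map_zero _
    exact ⟨⟨diag F r γ, h1⟩, mem_unipotentRational.2 ⟨γ, hγ, rfl⟩, h⟩
  obtain ⟨μ, hμ, hinv⟩ := exists_invariant_probability hV hdisc
    (isCompact_unipotent_entries I hQ) hcomp
  exact ⟨μ, hμ, fun n => hinv n _ fun m => rfl⟩

/-- Only the total mass of the measure matters. Existence of an invariant probability measure is
essential, because `unipotentMeasure` is 0 by default. -/
theorem constantTerm_one (I : Composition r) (g : GA F r) : constantTerm I (fun _ => 1) g = 1 := by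
  have h := exists_isNormalizedInvariant (F := F) I
  have hμ : IsNormalizedInvariant (unipotentMeasure F I) := by
    rw [unipotentMeasure, dif_pos h]
    exact h.choose_spec
  have := hμ.1
  rw [constantTerm]
  have h1 : ∀ x : UnipotentQuotient F I, Quotient.lift (fun n : unipotentPoints I (Adele F) =>
      (fun _ : Cosets (rationalPoints F r) => (1 : ℂ)) (cls (rationalPoints F r) ((n : GA F r) * g)))
      (fun _ _ _ => rfl) x = 1 := fun x => Quotient.inductionOn x fun _ => rfl
  refine (integral_congr_ae (Filter.Eventually.of_forall h1)).trans ?_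
  rw [integral_const, probReal_univ, one_smul]

end Unipotent

end GeoTrunc

namespace GeoTrunc

/-! ### Reduction theory and compactness -/

section Reduction

open scoped Matrix

variable {F : Type*} [Field F] [NumberField F] {r : ℕ}

theorem sum_mult_eq_finrank :
    ∑ v : InfinitePlace F, (v.mult : ℝ) = Module.finrank ℚ F := by
  exact_mod_cast InfinitePlace.sum_mult_eq

theorem sum_mult_mul_le {f : InfinitePlace F → ℝ} {b : ℝ} (h : ∀ v, f v ≤ b) :
    ∑ v : InfinitePlace F, (v.mult : ℝ) * f v ≤ Module.finrank ℚ F * b := by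
  rw [← sum_mult_eq_finrank, Finset.sum_mul]
  exact Finset.sum_le_sum fun v _ => mul_le_mul_of_nonneg_left (h v) (Nat.cast_nonneg _)

/-- In the degree of the line through x, the index term is nonnegative and the norm of x at each
place is at most its euclidean norm; the multiplicities sum to [F : ℚ]. -/
theorem neg_log_norm_le_subDegree (g : GA F r) {x : Fin r → F} (hx : x ∈ sheaf g) (hx0 : x ≠ 0) :
    -(Module.finrank ℚ F * Real.log ‖euclid g x‖) ≤ subDegree g (Submodule.span F {x}) := by
  have hLI : LinearIndependent F fun _ : Unit => x := linearIndependent_unique_iff.2 hx0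
  have h := (arakelovDegree_eq_family (latt_fg g (Submodule.span F {x})) g hLI
    (fun _ => ⟨hx, Submodule.mem_span_singleton_self x⟩)
    (by rw [span_latt, Set.range_const])).2
  rw [subDegree_eq_latt, h]
  have h1 : ∑ v : InfinitePlace F, (v.mult : ℝ) * (1 / 2 * Real.log
      ‖(metricMatrix g (fun _ : Unit => x) v).det‖) ≤
      Module.finrank ℚ F * Real.log ‖euclid g x‖ := by
    refine sum_mult_mul_le fun v => ?_
    have hne := det_metricMatrix_ne_zero g v hLI
    rw [Matrix.det_unique] at hne ⊢
    have h2 : ‖metricMatrix g (fun _ : Unit => x) v default default‖ ≤ ‖euclid g x‖ ^ 2 := by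
      change ‖metric g v x x‖ ≤ _
      have hnn : ∀ w : InfinitePlace F, 0 ≤ (metric g w x x).re := fun w => by
        rw [metric_self, Complex.ofReal_re]
        positivity
      have hn : ‖metric g v x x‖ = (metric g v x x).re := by
        have := hnn v
        rw [metric_self, Complex.ofReal_re] at this
        rw [metric_self, Complex.norm_real, Complex.ofReal_re, Real.norm_of_nonneg this]
      rw [hn, norm_euclid_sq]
      refine le_trans ?_ (Finset.single_le_sum (f := fun w : InfinitePlace F =>
        (w.mult : ℝ) * (metric g w x x).re)
        (fun w _ => mul_nonneg (Nat.cast_nonneg _) (hnn w)) (Finset.mem_univ v))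
      exact le_mul_of_one_le_left (hnn v) (by exact_mod_cast v.one_le_mult)
    have h3 := Real.log_le_log (norm_pos_iff.2 hne) h2
    rw [Real.log_pow] at h3
    push_cast at h3
    linarith
  have h4 := Real.log_natCast_nonneg ((Submodule.span (𝓞 F)
    (Set.range fun _ : Unit => x)).toAddSubgroup.relIndex
      (latt g (Submodule.span F {x})).toAddSubgroup)
  linarith

/-- A very short vector would span a line of height greater than p(1). -/
theorem exists_norm_lower_bound {p : ℝ → ℝ} (hp : IsNormalizedConvex r p) (hr : 0 < r) (c : ℝ) :
    ∃ b : ℝ, 0 < b ∧ ∀ g : GA F r, degree g = c → CanonicalLE p g →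
      ∀ x ∈ sheaf g, x ≠ 0 → b ≤ ‖euclid g x‖ := by
  have hn : (0 : ℝ) < Module.finrank ℚ F := by exact_mod_cast Module.finrank_pos
  refine ⟨Real.exp (-((p 1 + c / r) / Module.finrank ℚ F)), Real.exp_pos _,
    fun g hg hle x hx hx0 => ?_⟩
  have h1 := (canonicalLE_iff hp hr).1 hle (Submodule.span F {x})
  have h2 : Module.finrank F (Submodule.span F {x}) = 1 := finrank_span_singleton hx0
  rw [ht, h2, hg, Nat.cast_one, one_mul] at h1
  have h3 := neg_log_norm_le_subDegree g hx hx0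
  rw [← Real.le_log_iff_exp_le (norm_pos_iff.2 (euclid_ne_zero g hx0)), ← neg_div, div_le_iff₀ hn]
  linarith

/-- In the absence of short vectors, bounded lattice vectors span F^r; γ carries r independent ones
to the standard basis. -/
theorem exists_reduced_basis {p : ℝ → ℝ} (hp : IsNormalizedConvex r p) (hr : 0 < r) (c : ℝ) :
    ∃ B : ℝ, ∀ g : GA F r, degree g = c → CanonicalLE p g →
      ∃ γ : Matrix.GeneralLinearGroup (Fin r) F, ∀ i : Fin r,
        Pi.single i 1 ∈ sheaf (diag F r γ * g) ∧
          ‖euclid (diag F r γ * g) (Pi.single i 1)‖ ≤ B := by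
  obtain ⟨b, hb, hmin⟩ := exists_norm_lower_bound (F := F) hp hr c
  obtain ⟨B, hB⟩ := span_bounded_eq (F := F) (r := r) r hb c
  refine ⟨B, fun g hg hle => ?_⟩
  have hspan := hB g ⊤ (by rw [finrank_top, Module.finrank_fin_fun])
    (fun x hx hx0 => hmin g hg hle x hx.1 hx0) (by rw [subDegree_top, hg])
  obtain ⟨s, hs, hLI⟩ : ∃ s : Fin r → Fin r → F,
      (∀ i, s i ∈ {x | x ∈ latt g ⊤ ∧ ‖euclid g x‖ ≤ B}) ∧ LinearIndependent F s := by
    obtain ⟨s, h1, -, h3⟩ := Submodule.exists_fun_fin_finrank_span_eq F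
      {x | x ∈ latt g ⊤ ∧ ‖euclid g x‖ ≤ B}
    have h4 : Module.finrank F (Submodule.span F {x | x ∈ latt g ⊤ ∧ ‖euclid g x‖ ≤ B}) = r := by
      rw [hspan, finrank_top, Module.finrank_fin_fun]
    refine ⟨s ∘ Fin.cast h4.symm, fun i => h1 _, h3.comp _ (Fin.cast_injective _)⟩
  let e := basisOfLinearIndependentOfCardEqFinrank' s hLI (by simp)
  obtain ⟨γ, hγ⟩ := exists_linAut e.equivFun
  have hγs : ∀ i, (γ : Matrix (Fin r) (Fin r) F) *ᵥ s i = Pi.single i 1 := by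
    intro i
    have h1 : e i = s i := by simp [e]
    rw [← linAut_apply, hγ, ← h1]
    ext j
    rw [e.equivFun_self]
    simp [Pi.single_apply, eq_comm]
  refine ⟨γ, fun i => ?_⟩
  rw [← hγs i, mulVec_mem_sheaf, euclid_diag_mul]
  exact ⟨(hs i).1.1, (hs i).2⟩

theorem infCoord_single (g : GA F r) (v : InfinitePlace F) (i j : Fin r) :
    infCoord g v (Pi.single j 1) i = toInfinite v ((g⁻¹ : GA F r).val i j) := by
  have : (fun k => v.embedding ((Pi.single j 1 : Fin r → F) k)) = Pi.single j 1 := by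
    ext k
    rw [Pi.single_apply, Pi.single_apply]
    split_ifs
    · exact map_one _
    · exact map_zero _
  rw [infCoord, this, Matrix.mulVec_single_one]
  exact infPart_inv_apply g v i j

theorem finCoord_single (g : GA F r) (i j : Fin r) :
    finCoord g (Pi.single j 1) i = toFinite F ((g⁻¹ : GA F r).val i j) := by
  have : (fun k => algebraMap F (FinAdele F) ((Pi.single j 1 : Fin r → F) k)) = Pi.single j 1 := by
    ext1 k
    rw [Pi.single_apply, Pi.single_apply]
    split_ifs
    · exact map_one _
    · exact map_zero _
  rw [finCoord, this, Matrix.mulVec_single_one]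
  exact finPart_inv_apply g i j

omit [NumberField F] in
theorem linearIndependent_singles :
    LinearIndependent F fun i : Fin r => (Pi.single i 1 : Fin r → F) := by
  have := (Pi.basisFun F (Fin r)).linearIndependent
  convert! this using 1
  ext1 i
  simp

omit [NumberField F] in
theorem span_singles :
    Submodule.span F (Set.range fun i : Fin r => (Pi.single i 1 : Fin r → F)) = ⊤ := by
  have := (Pi.basisFun F (Fin r)).span_eq
  convert! this using 3
  ext1 i
  simp

theorem norm_det_metricMatrix_singles (g : GA F r) (v : InfinitePlace F) :
    ‖(metricMatrix g (fun i : Fin r => (Pi.single i 1 : Fin r → F)) v).det‖ =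
      ‖(((infPart g v)⁻¹ : Matrix.GeneralLinearGroup (Fin r) ℂ) :
        Matrix (Fin r) (Fin r) ℂ).det‖ ^ 2 := by
  set A := (((infPart g v)⁻¹ : Matrix.GeneralLinearGroup (Fin r) ℂ) :
        Matrix (Fin r) (Fin r) ℂ) with hA
  have h : metricMatrix g (fun i : Fin r => (Pi.single i 1 : Fin r → F)) v = Aᴴ * A := by
    ext i j
    change metric g v _ _ = _
    rw [metric_eq, Matrix.mul_apply]
    refine Finset.sum_congr rfl fun k _ => ?_
    rw [infCoord_single, infCoord_single, Matrix.conjTranspose_apply, hA, infPart_inv_apply,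
      infPart_inv_apply]
  rw [h, Matrix.det_mul, Matrix.det_conjTranspose, norm_mul, norm_star, sq]

theorem norm_det_le {A : Matrix (Fin r) (Fin r) ℂ} {B : ℝ} (h : ∀ i j, ‖A i j‖ ≤ B) :
    ‖A.det‖ ≤ r.factorial * B ^ r := by
  have := Matrix.det_le (abv := NormedField.toAbsoluteValue ℂ) (x := B) h
  rwa [Fintype.card_fin, nsmul_eq_mul] at this

/-- Cramer's rule. The cofactors are determinants with one row replaced by a standard vector, which
is why 1 ≤ B is required. -/
theorem norm_inv_entry_le {A : Matrix (Fin r) (Fin r) ℂ} {B : ℝ} (hB : 1 ≤ B)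
    (h : ∀ i j, ‖A i j‖ ≤ B) (i j : Fin r) :
    ‖A⁻¹ i j‖ ≤ ‖A.det‖⁻¹ * (r.factorial * B ^ r) := by
  rw [Matrix.inv_def, Matrix.smul_apply, Ring.inverse_eq_inv', smul_eq_mul, norm_mul, norm_inv]
  refine mul_le_mul_of_nonneg_left ?_ (inv_nonneg.2 (norm_nonneg _))
  rw [Matrix.adjugate_apply]
  refine norm_det_le fun k l => ?_
  rw [Matrix.updateRow_apply]
  split_ifs
  · rw [Pi.single_apply]
    split_ifs
    · rwa [norm_one]
    · rw [norm_zero]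
      linarith
  · exact h k l

/-- If `g_f⁻¹` is integral and `n` kills `E_g / 𝓞^r`, then `n` is a denominator of `g_f`. -/
theorem mul_entry_mem_finInt {g : GA F r} (hg : ∀ i, Pi.single i 1 ∈ sheaf g) {n : 𝓞 F}
    (hn : ∀ x ∈ sheaf g, ∀ i, (n : F) * x i ∈ (algebraMap (𝓞 F) F).range) (i j : Fin r) :
    algebraMap F (FinAdele F) (n : F) * toFinite F (g.val i j) ∈ finInt F := by
  -- Approximate column j of g by a rational vector x with integral error d. Then g⁻¹x = g⁻¹d + e_j
  -- is integral, so x lies in E_g and nx is integral, whence so is n times the column.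
  choose x hx using fun k => exists_approx (toFinite F (g.val k j)) (one_ne_zero (α := 𝓞 F))
  have h1 : ((1 : 𝓞 F) : F) = 1 := map_one _
  simp only [h1, inv_one, map_one, one_mul] at hx
  let d : Fin r → FinAdele F := fun k => algebraMap F (FinAdele F) (x k) - toFinite F (g.val k j)
  have hsheaf : x ∈ sheaf g := by
    rw [mem_sheaf]
    intro k
    have h2 : (fun l => algebraMap F (FinAdele F) (x l)) =
        d + (finPart g : Matrix (Fin r) (Fin r) (FinAdele F)) *ᵥ Pi.single j 1 := by
      rw [Matrix.mulVec_single_one]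
      ext1 l
      change _ = (algebraMap F (FinAdele F) (x l) - toFinite F (g.val l j)) + toFinite F (g.val l j)
      rw [sub_add_cancel]
    rw [finCoord, h2, Matrix.mulVec_add, Matrix.mulVec_mulVec, ← Units.val_mul, inv_mul_cancel,
      Units.val_one, Matrix.one_mulVec, Pi.add_apply]
    refine add_mem ?_ ?_
    · rw [Matrix.mulVec, dotProduct]
      refine sum_mem fun l _ => mul_mem ?_ (hx l)
      have := mem_sheaf.1 (hg l) k
      rw [finCoord_single] at this
      rwa [finPart_inv_apply]
    · rw [Pi.single_apply]
      split_ifs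
      · exact one_mem _
      · exact zero_mem _
  have h3 : algebraMap F (FinAdele F) (n : F) * toFinite F (g.val i j) =
      algebraMap F (FinAdele F) ((n : F) * x i) - algebraMap F (FinAdele F) (n : F) * d i := by
    rw [map_mul]
    change _ = _ - _ * (algebraMap F (FinAdele F) (x i) - toFinite F (g.val i j))
    ring
  rw [h3]
  exact sub_mem (algebraMap_mem_finInt.2 (hn x hsheaf i)) (mul_mem (coe_mem_finInt n) (hx i))

/-- The degree equals log k - ∑ mult · log |det g_v⁻¹|, where k is the index of 𝓞^r in E_g. The
determinants are bounded above by the bound on the basis vectors, so a fixed degree bounds k above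
and every determinant away from 0. The first bounds the denominators of g_f, the second the entries
of g_v. -/
theorem exists_entries_mem_adelicBox (B c : ℝ) : ∃ (B' : ℝ) (n : 𝓞 F), n ≠ 0 ∧ ∀ g : GA F r,
    degree g = c → (∀ i : Fin r, Pi.single i 1 ∈ sheaf g ∧ ‖euclid g (Pi.single i 1)‖ ≤ B) →
      ∀ i j, g.val i j ∈ adelicBox B' n ∧ (g⁻¹).val i j ∈ adelicBox B' n := by
  classical
  let B₁ := max B 1
  have hB₁ : 1 ≤ B₁ := le_max_right _ _
  let C : ℝ := r.factorial * B₁ ^ r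
  have hC : 1 ≤ C := one_le_mul_of_one_le_of_one_le
    (by exact_mod_cast Nat.one_le_iff_ne_zero.2 r.factorial_ne_zero) (one_le_pow₀ hB₁)
  -- E bounds both log k and, at each infinite place where the determinant is at most 1, minus its
  -- logarithm.
  let E : ℝ := c + Module.finrank ℚ F * Real.log C
  let M : ℕ := ⌈Real.exp E⌉₊
  -- A factorial is divisible by every possible index k ≤ M, which makes the denominator independent
  -- of g.
  let n : 𝓞 F := ((M.factorial : ℕ) : 𝓞 F)
  refine ⟨max (Real.exp (max 0 E) * C) B₁, n, Nat.cast_ne_zero.2 M.factorial_ne_zero,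
    fun g hg hred => ?_⟩
  have hspan : Submodule.span F (Set.range fun i : Fin r => (Pi.single i 1 : Fin r → F)) =
      Submodule.span F (sheaf g : Set (Fin r → F)) := by
    have h1 := span_latt g ⊤
    rw [latt, Submodule.restrictScalars_top, inf_top_eq] at h1
    rw [span_singles, h1]
  obtain ⟨hidx, hdeg⟩ := arakelovDegree_eq_family (sheaf_fg g) g linearIndependent_singles
    (fun i => (hred i).1) hspan
  set H := (Submodule.span (𝓞 F)
    (Set.range fun i : Fin r => (Pi.single i 1 : Fin r → F))).toAddSubgroup with hH
  set k := H.relIndex (sheaf g).toAddSubgroup with hk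
  let A : InfinitePlace F → Matrix (Fin r) (Fin r) ℂ := fun v =>
    ((infPart g v)⁻¹ : Matrix.GeneralLinearGroup (Fin r) ℂ)
  have hA : ∀ v i j, A v i j = toInfinite v ((g⁻¹ : GA F r).val i j) := infPart_inv_apply g
  have hAB : ∀ v i j, ‖A v i j‖ ≤ B₁ := fun v i j => by
    rw [hA, ← infCoord_single]
    exact (norm_infCoord_le g v _ i).trans ((hred j).2.trans (le_max_left _ _))
  have hdet0 : ∀ v, 0 < ‖(A v).det‖ := fun v => norm_pos_iff.2
    ((Matrix.isUnit_iff_isUnit_det _).1 (Units.isUnit ((infPart g v)⁻¹))).ne_zero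
  have hlog : ∀ v, Real.log ‖(A v).det‖ ≤ Real.log C := fun v =>
    Real.log_le_log (hdet0 v) (norm_det_le (hAB v))
  have hdeg' : c = Real.log k - ∑ v : InfinitePlace F, (v.mult : ℝ) * Real.log ‖(A v).det‖ := by
    rw [← hg, degree, hdeg]
    congr 1
    refine Finset.sum_congr rfl fun v _ => ?_
    rw [norm_det_metricMatrix_singles, Real.log_pow]
    have h : ∀ d : ℝ, (v.mult : ℝ) * (1 / 2 * (((2 : ℕ) : ℝ) * d)) = v.mult * d := by
      intro d
      push_cast
      ring
    exact h _
  have hkpos : (0 : ℝ) < k := by exact_mod_cast Nat.pos_of_ne_zero hidx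
  have hkM : k ≤ M := by
    have h1 : Real.log k ≤ E := by
      have := sum_mult_mul_le hlog
      simp only [E]
      linarith
    have h2 := (Real.log_le_iff_le_exp hkpos).1 h1
    exact_mod_cast h2.trans (Nat.le_ceil _)
  have hdet1 : ∀ v, ‖(A v).det‖⁻¹ ≤ Real.exp (max 0 E) := by
    intro v
    rw [← Real.log_le_iff_le_exp (inv_pos.2 (hdet0 v)), Real.log_inv]
    rcases le_total 0 (Real.log ‖(A v).det‖) with h | h
    · exact (neg_nonpos.2 h).trans (le_max_left _ _)
    · refine le_trans ?_ (le_max_right _ _)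
      -- To isolate the place v, its term is replaced by 0, which still satisfies the upper bound
      -- because C ≥ 1.
      have h1 : ∑ w : InfinitePlace F, (w.mult : ℝ) * (if w = v then 0 else Real.log ‖(A w).det‖) ≤
          Module.finrank ℚ F * Real.log C := by
        refine sum_mult_mul_le fun w => ?_
        split_ifs
        · exact Real.log_nonneg hC
        · exact hlog w
      have h2 : ∑ w : InfinitePlace F, (w.mult : ℝ) * Real.log ‖(A w).det‖ =
          v.mult * Real.log ‖(A v).det‖ +
          ∑ w : InfinitePlace F, (w.mult : ℝ) * (if w = v then 0 else Real.log ‖(A w).det‖) := by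
        rw [← Finset.add_sum_erase _ _ (Finset.mem_univ v),
          ← Finset.add_sum_erase _ (fun w : InfinitePlace F =>
            (w.mult : ℝ) * (if w = v then 0 else Real.log ‖(A w).det‖)) (Finset.mem_univ v),
          if_pos rfl, mul_zero, zero_add]
        congr 1
        refine Finset.sum_congr rfl fun w hw => ?_
        rw [if_neg (Finset.ne_of_mem_erase hw)]
      have h3 : (v.mult : ℝ) * Real.log ‖(A v).det‖ ≤ 1 * Real.log ‖(A v).det‖ :=
        mul_le_mul_of_nonpos_right (by exact_mod_cast v.one_le_mult) h
      have h4 := Real.log_natCast_nonneg k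
      simp only [E]
      linarith
  have hfin : ∀ x ∈ sheaf g, ∀ i, (n : F) * x i ∈ (algebraMap (𝓞 F) F).range := by
    intro x hx i
    have h5 := AddSubgroup.nsmul_index_mem (H.addSubgroupOf (sheaf g).toAddSubgroup) ⟨x, hx⟩
    rw [AddSubgroup.mem_addSubgroupOf] at h5
    have h6 : k • x ∈ Submodule.span (𝓞 F)
      (Set.range fun i : Fin r => (Pi.single i 1 : Fin r → F)) := h5
    rw [span_singles_le_iff] at h6
    obtain ⟨y, hy⟩ := h6
    obtain ⟨m, hm⟩ := Nat.dvd_factorial (Nat.pos_of_ne_zero hidx) hkM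
    have h7 : (k : F) * x i = y i := by
      have := congrFun hy i
      rw [Finset.sum_apply] at this
      simp only [Pi.smul_apply, Pi.single_apply, smul_eq_mul] at this
      simpa using this.symm
    refine ⟨(m : 𝓞 F) * y i, ?_⟩
    have h8 : (n : F) = m * k := by
      have : (n : F) = (M.factorial : F) := map_natCast (algebraMap (𝓞 F) F) _
      rw [this, hm]
      push_cast
      ring
    rw [h8, mul_assoc, h7, map_mul, map_natCast]
  intro i j
  refine ⟨⟨fun v => ?_, mul_entry_mem_finInt (fun i => (hred i).1) hfin i j⟩, fun v => ?_, ?_⟩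
  · refine le_trans ?_ (le_max_left _ _)
    have h1 : toInfinite v (g.val i j) = (A v)⁻¹ i j := by
      have h2 : (A v)⁻¹ = (infPart g v : Matrix (Fin r) (Fin r) ℂ) := by
        have h3 := Matrix.coe_units_inv ((infPart g v)⁻¹)
        rw [inv_inv] at h3
        exact h3.symm
      rw [h2]
      rfl
    rw [h1]
    exact (norm_inv_entry_le hB₁ (hAB v) i j).trans
      (mul_le_mul_of_nonneg_right (hdet1 v) (zero_le_one.trans hC))
  · refine le_trans ?_ (le_max_right _ _)
    rw [← hA]
    exact hAB v i j
  · refine mul_mem (coe_mem_finInt n) ?_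
    rw [← finCoord_single]
    exact mem_sheaf.1 (hred j).1 i

theorem exists_compact_reduction {p : ℝ → ℝ} (hp : IsNormalizedConvex r p) (hr : 0 < r) (c : ℝ) :
    ∃ K : Set (GA F r), IsCompact K ∧ ∀ g : GA F r, degree g = c → CanonicalLE p g →
      ∃ γ : Matrix.GeneralLinearGroup (Fin r) F, diag F r γ * g ∈ K := by
  obtain ⟨B, hB⟩ := exists_reduced_basis (F := F) hp hr c
  obtain ⟨B', n, hn, h⟩ := exists_entries_mem_adelicBox (F := F) (r := r) B c
  refine ⟨_, isCompact_entries (isCompact_adelicBox B' hn), fun g hg hle => ?_⟩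
  obtain ⟨γ, hγ⟩ := hB g hg hle
  exact ⟨γ, h _ (by rw [degree_diag_mul, hg]) hγ⟩

theorem isClosed_canonicalLE {p : ℝ → ℝ} (hp : IsNormalizedConvex r p) (hr : 0 < r) :
    IsClosed {g : GA F r | CanonicalLE p g} := by
  simp only [canonicalLE_iff hp hr, Set.ofPred_forall]
  exact isClosed_iInter fun W => isClosed_le ((continuous_subDegree W).sub
    (continuous_const.mul (continuous_degree.div_const _))) continuous_const

/-- The moduli space is the image of a compact set intersected with the closed conditions on degree
and heights. -/
theorem isCompact_moduliSpace {p : ℝ → ℝ} (hp : IsNormalizedConvex r p) (hr : 0 < r) (T : ℝ) :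
    IsCompact (moduliSpace F r p T) := by
  obtain ⟨K, hK, hred⟩ := exists_compact_reduction (F := F) hp hr (-Real.log T)
  have hY : IsClosed {g : GA F r | degree g = -Real.log T ∧ CanonicalLE p g} :=
    (isClosed_eq continuous_degree continuous_const).inter (isClosed_canonicalLE hp hr)
  have h := (hK.inter_right hY).image (f := cls (rationalPoints F r)) continuous_quot_mk
  convert! h using 1
  ext x
  constructor
  · rintro ⟨g, rfl, h1, h2⟩
    obtain ⟨γ, hγ⟩ := hred g h1 h2
    exact ⟨diag F r γ * g, ⟨hγ, by rw [degree_diag_mul, h1],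
      (canonicalLE_diag_mul hp hr γ g).2 h2⟩, cls_mul_left (H := rationalPoints F r) ⟨γ, rfl⟩ g⟩
  · rintro ⟨g, ⟨-, h1, h2⟩, rfl⟩
    exact ⟨g, rfl, h1, h2⟩

end Reduction

end GeoTrunc

namespace GeoTrunc

/-! ### Projections between coset spaces -/

section CosetMaps

variable {G : Type*} [Group G] {H K : Subgroup G}

/-- The projection `H \ G → K \ G` for `H ≤ K`. -/
def cosetsMap (h : H ≤ K) : Cosets H → Cosets K :=
  Quotient.map id fun _ _ hab =>
    QuotientGroup.rightRel_apply.2 (h (QuotientGroup.rightRel_apply.1 hab))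

theorem cls_center_mul_congr {z a b : G} (hz : z ∈ Subgroup.center G) (h : cls H a = cls H b) :
    cls H (z * a) = cls H (z * b) := by
  have h1 : z * b * (z * a)⁻¹ = b * a⁻¹ := by
    rw [← Subgroup.mem_center_iff.1 hz b, ← Subgroup.mem_center_iff.1 hz a, mul_inv_rev,
      mul_assoc, mul_inv_cancel_left]
  rw [cls_eq_iff, h1]
  exact cls_eq_iff.1 h

theorem cls_sup_eq_iff (hH : H ≤ Subgroup.center G) {a b : G} :
    cls (H ⊔ K) a = cls (H ⊔ K) b ↔ ∃ z ∈ H, cls K (z * a) = cls K b := by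
  have : H.Normal := ⟨fun n hn g => by
    rwa [Subgroup.mem_center_iff.1 (hH hn) g, mul_inv_cancel_right]⟩
  rw [cls_eq_iff, Subgroup.mem_sup_of_normal_left]
  constructor
  · rintro ⟨z, hz, k, hk, h⟩
    refine ⟨z, hz, cls_eq_iff.2 ?_⟩
    have h1 := Subgroup.mem_center_iff.1 (hH hz)
    have h2 : b * (z * a)⁻¹ = k := by
      rw [mul_inv_rev, ← mul_assoc, ← h, ← h1 k, mul_inv_cancel_right]
    rwa [h2]
  · rintro ⟨z, hz, h⟩
    refine ⟨z, hz, _, cls_eq_iff.1 h, ?_⟩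
    rw [← Subgroup.mem_center_iff.1 (hH hz), mul_inv_rev, ← mul_assoc, inv_mul_cancel_right]

variable [TopologicalSpace G]

theorem continuous_cosetsMap (h : H ≤ K) : Continuous (cosetsMap h) :=
  continuous_quot_lift _ continuous_quot_mk

theorem isOpenMap_cosetsMap [IsTopologicalGroup G] (h : H ≤ K) : IsOpenMap (cosetsMap h) := by
  intro U hU
  have h1 : IsOpen (cls H ⁻¹' U) := hU.preimage continuous_quot_mk
  change IsOpen (cls K ⁻¹' (cosetsMap h '' U))
  convert! isOpen_saturation (Γ := K) h1 using 1
  ext n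
  constructor
  · rintro ⟨x, hx, hxn⟩
    obtain ⟨g, rfl⟩ := Quotient.exists_rep x
    have h2 := cls_eq_iff.1 (hxn.symm : cls K n = cls K g)
    refine ⟨g * n⁻¹, h2, ?_⟩
    change cls H (g * n⁻¹ * n) ∈ U
    rwa [inv_mul_cancel_right]
  · rintro ⟨γ, hγ, hn⟩
    exact ⟨cls H (γ * n), hn, cls_mul_left hγ n⟩

end CosetMaps

/-! ### Moduli spaces and truncated domains -/

section Domains

variable {F : Type*} [Field F] [NumberField F] {r : ℕ} {p : ℝ → ℝ}

theorem truncation_eq_one_iff (hp : IsNormalizedConvex r p) (hr : 0 < r) (g : GA F r) :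
    truncation p (fun _ => 1) g = 1 ↔ CanonicalLE p g := by
  rw [truncation_one hp hr constantTerm_one]
  classical
  rw [Set.indicator_apply]
  change (if CanonicalLE p g then (1 : ℂ) else 0) = 1 ↔ _
  split_ifs with h <;> simp [h]

theorem truncation_mul (hp : IsNormalizedConvex r p) (hr : 0 < r) {h : GA F r}
    (hh : h ∈ Subgroup.center (GA F r) ⊔ rationalPoints F r) (g : GA F r) :
    truncation p (fun _ => 1) (h * g) = truncation p (fun _ => 1) g := by
  classical
  rw [truncation_one hp hr constantTerm_one, truncation_one hp hr constantTerm_one,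
    Set.indicator_apply, Set.indicator_apply]
  exact if_congr (canonicalLE_mul hp hr hh g) rfl rfl

theorem degree_eq_of_cls_eq {g h : GA F r}
    (hgh : cls (rationalPoints F r) g = cls (rationalPoints F r) h) : degree g = degree h := by
  obtain ⟨γ, hγ⟩ := cls_eq_iff.1 hgh
  rw [← degree_diag_mul γ g, hγ, inv_mul_cancel_right]

theorem cls_mem_moduliSpace (hp : IsNormalizedConvex r p) (hr : 0 < r) {T : ℝ} {g : GA F r} :
    cls (rationalPoints F r) g ∈ moduliSpace F r p T ↔
      degree g = -Real.log T ∧ CanonicalLE p g := by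
  refine ⟨?_, fun h => ⟨g, rfl, h⟩⟩
  rintro ⟨h, hgh, h1, h2⟩
  refine ⟨(degree_eq_of_cls_eq hgh).symm.trans h1, ?_⟩
  have h3 := (canonicalLE_mul hp hr ((le_sup_right : rationalPoints F r ≤
    Subgroup.center (GA F r) ⊔ _) (cls_eq_iff.1 hgh)) h).2 h2
  rwa [inv_mul_cancel_right] at h3

theorem cls_mem_truncatedDomain (hp : IsNormalizedConvex r p) (hr : 0 < r)
    {Z : Subgroup (GA F r)} (hZ : Z ≤ Subgroup.center (GA F r)) {g : GA F r} :
    cls (Z ⊔ rationalPoints F r) g ∈ truncatedDomain p Z ↔ CanonicalLE p g := by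
  refine ⟨?_, fun h => ⟨g, rfl, (truncation_eq_one_iff hp hr g).2 h⟩⟩
  rintro ⟨h, hgh, h1⟩
  have h3 := (canonicalLE_mul hp hr (sup_le_sup_right hZ _ (cls_eq_iff.1 hgh)) h).2
    ((truncation_eq_one_iff hp hr h).1 h1)
  rwa [inv_mul_cancel_right] at h3

theorem splitElt_add (s t : ℝ) : splitElt F r (s + t) = splitElt F r s * splitElt F r t := by
  refine Units.ext ?_
  change Matrix.scalar (Fin r) _ = Matrix.scalar (Fin r) _ * Matrix.scalar (Fin r) _
  rw [← map_mul, realAdele_mul, ← Real.exp_add]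

/-- The translate of `g` by the split component of the centre that has degree `c`. -/
noncomputable def normalize (c : ℝ) (g : GA F r) : GA F r :=
  splitElt F r ((c - degree g) / (r * Module.finrank ℚ F)) * g

theorem rank_ne_zero (hr : 0 < r) : (r : ℝ) * Module.finrank ℚ F ≠ 0 :=
  mul_ne_zero (Nat.cast_ne_zero.2 hr.ne') (Nat.cast_ne_zero.2 Module.finrank_pos.ne')

theorem continuous_normalize (c : ℝ) : Continuous (normalize (F := F) (r := r) c) :=
  (continuous_splitElt.comp ((continuous_const.sub continuous_degree).div_const _)).mul
    continuous_id

theorem degree_normalize (hr : 0 < r) (c : ℝ) (g : GA F r) : degree (normalize c g) = c := by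
  rw [normalize, degree_splitElt_mul, mul_div_cancel₀ _ (rank_ne_zero hr), add_sub_cancel]

theorem normalize_of_degree {c : ℝ} {g : GA F r} (hg : degree g = c) : normalize c g = g := by
  have h0 : splitElt F r 0 = 1 := by
    have h := splitElt_add (F := F) (r := r) 0 0
    rw [add_zero] at h
    exact left_eq_mul.1 h
  rw [normalize, hg, sub_self, zero_div, h0, one_mul]

theorem normalize_splitElt_mul (hr : 0 < r) (c t : ℝ) (g : GA F r) :
    normalize c (splitElt F r t * g) = normalize c g := by
  rw [normalize, normalize, degree_splitElt_mul, ← mul_assoc, ← splitElt_add]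
  congr 2
  have h := rank_ne_zero (F := F) hr
  generalize (r : ℝ) * Module.finrank ℚ F = N at h
  field_simp
  ring

theorem cls_normalize (c : ℝ) (g : GA F r) :
    cls (splitCenter F r ⊔ rationalPoints F r) (normalize c g) = cls _ g :=
  cls_mul_left ((le_sup_left : splitCenter F r ≤ _) (splitElt_mem _)) g

theorem canonicalLE_normalize (hp : IsNormalizedConvex r p) (hr : 0 < r) (c : ℝ) (g : GA F r) :
    CanonicalLE p (normalize c g) ↔ CanonicalLE p g :=
  canonicalLE_center_mul hp hr (splitElt_mem_center _) g

/-- `normalize` absorbs the split component, and the degree is invariant under G(F); so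
normalisation descends to the quotient and yields the inverse of the homeomorphism. -/
theorem cls_normalize_congr (hr : 0 < r) (c : ℝ) {g h : GA F r}
    (hgh : cls (splitCenter F r ⊔ rationalPoints F r) g = cls _ h) :
    cls (rationalPoints F r) (normalize c g) = cls (rationalPoints F r) (normalize c h) := by
  obtain ⟨z, hz, h1⟩ := (cls_sup_eq_iff splitCenter_le_center).1 hgh
  obtain ⟨t, rfl⟩ := exists_splitElt hz
  rw [← normalize_splitElt_mul hr c t g, normalize, normalize, degree_eq_of_cls_eq h1]
  exact cls_center_mul_congr (splitElt_mem_center _) h1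

theorem cosetsMap_mem_truncatedDomain (hp : IsNormalizedConvex r p) (hr : 0 < r) {T : ℝ}
    {x : Cosets (rationalPoints F r)} (hx : x ∈ moduliSpace F r p T) :
    cosetsMap le_sup_right x ∈ truncatedDomain p (splitCenter F r) := by
  obtain ⟨g, rfl, h1, h2⟩ := hx
  exact (cls_mem_truncatedDomain hp hr splitCenter_le_center).2 h2

/-- The section of `G(F) \ G(𝔸) → A G(F) \ G(𝔸)` whose values have degree `c`. -/
noncomputable def normalizeCoset (hr : 0 < r) (c : ℝ) :
    Cosets (splitCenter F r ⊔ rationalPoints F r) → Cosets (rationalPoints F r) :=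
  Quotient.lift (fun g => cls (rationalPoints F r) (normalize c g))
    fun _ _ hgh => cls_normalize_congr hr c (Quotient.sound hgh)

theorem continuous_normalizeCoset (hr : 0 < r) (c : ℝ) :
    Continuous (normalizeCoset (F := F) hr c) :=
  continuous_quot_lift _ (continuous_quot_mk.comp (continuous_normalize c))

theorem normalizeCoset_mem (hp : IsNormalizedConvex r p) (hr : 0 < r) (T : ℝ)
    {x : Cosets (splitCenter F r ⊔ rationalPoints F r)}
    (hx : x ∈ truncatedDomain p (splitCenter F r)) :
    normalizeCoset hr (-Real.log T) x ∈ moduliSpace F r p T := by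
  obtain ⟨g, rfl, h⟩ := hx
  exact (cls_mem_moduliSpace hp hr).2 ⟨degree_normalize hr _ g,
    (canonicalLE_normalize hp hr _ g).2 ((truncation_eq_one_iff hp hr g).1 h)⟩

/-- The homeomorphism between a moduli space of fixed degree and the truncated domain. -/
noncomputable def moduliHomeomorph (hp : IsNormalizedConvex r p) (hr : 0 < r) (T : ℝ) :
    moduliSpace F r p T ≃ₜ truncatedDomain p (splitCenter F r) where
  toFun x := ⟨cosetsMap le_sup_right x.1, cosetsMap_mem_truncatedDomain hp hr x.2⟩
  invFun x := ⟨normalizeCoset hr (-Real.log T) x.1, normalizeCoset_mem hp hr T x.2⟩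
  left_inv := by
    rintro ⟨_, g, rfl, h1, h2⟩
    exact Subtype.ext (congrArg (cls (rationalPoints F r)) (normalize_of_degree h1))
  right_inv := by
    rintro ⟨_, g, rfl, h⟩
    exact Subtype.ext (cls_normalize _ g)
  continuous_toFun := ((continuous_cosetsMap _).comp continuous_subtype_val).subtype_mk _
  continuous_invFun :=
    ((continuous_normalizeCoset hr _).comp continuous_subtype_val).subtype_mk _

/-- The projection between the two truncated domains. -/
noncomputable def domainMap (x : truncatedDomain (F := F) p (splitCenter F r)) :
    truncatedDomain p (Subgroup.center (GA F r)) :=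
  ⟨cosetsMap (sup_le_sup_right splitCenter_le_center _) x.1, by
    obtain ⟨_, g, rfl, h⟩ := x
    exact ⟨g, rfl, h⟩⟩

/-- The condition defining the truncated domains is central-invariant, so one domain is the full
preimage of the other. The open projection of coset spaces therefore restricts to an open
surjection. -/
theorem isQuotientMap_domainMap (hp : IsNormalizedConvex r p) (hr : 0 < r) :
    Topology.IsQuotientMap (domainMap (F := F) (r := r) (p := p)) := by
  refine IsOpenMap.isQuotientMap ?_
    (((continuous_cosetsMap _).comp continuous_subtype_val).subtype_mk _) ?_
  · intro U hU
    obtain ⟨V, hV, rfl⟩ := isOpen_induced_iff.1 hU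
    refine isOpen_induced_iff.2
      ⟨_, isOpenMap_cosetsMap (sup_le_sup_right splitCenter_le_center _) V hV, ?_⟩
    ext ⟨y, hy⟩
    constructor
    · rintro ⟨x, hx, hxy⟩
      obtain ⟨g, rfl⟩ := Quotient.exists_rep x
      have hy' : cls (Subgroup.center (GA F r) ⊔ rationalPoints F r) g ∈
          truncatedDomain p (Subgroup.center (GA F r)) := by
        change _ = y at hxy
        rw [← hxy] at hy
        exact hy
      exact ⟨⟨_, (cls_mem_truncatedDomain hp hr splitCenter_le_center).2
        ((cls_mem_truncatedDomain hp hr le_rfl).1 hy')⟩, hx, Subtype.ext hxy⟩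
    · rintro ⟨x, hx, hxy⟩
      exact ⟨x.1, hx, congrArg Subtype.val hxy⟩
  · rintro ⟨_, g, rfl, h⟩
    exact ⟨⟨_, g, rfl, h⟩, rfl⟩

theorem isCompact_truncatedDomain (hp : IsNormalizedConvex r p) (hr : 0 < r) :
    IsCompact (truncatedDomain (F := F) p (splitCenter F r)) := by
  -- The truncated domain does not involve T, so any value serves here.
  have := isCompact_iff_compactSpace.1 (isCompact_moduliSpace (F := F) hp hr 1)
  exact isCompact_iff_compactSpace.2 (moduliHomeomorph hp hr 1).compactSpace

theorem isCompact_truncatedDomain_center (hp : IsNormalizedConvex r p) (hr : 0 < r) :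
    IsCompact (truncatedDomain (F := F) p (Subgroup.center (GA F r))) := by
  have := isCompact_iff_compactSpace.1 (isCompact_truncatedDomain (F := F) hp hr)
  have h := isQuotientMap_domainMap (F := F) hp hr
  refine isCompact_iff_compactSpace.2 ⟨?_⟩
  rw [← h.surjective.range_eq]
  exact isCompact_range h.continuous

/-- Degrees add under multiplication by the centre, so a central element relating two classes of
equal degree has degree 0. -/
theorem cls_center_eq_iff (hr : 0 < r) {g h : GA F r} (hgh : degree g = degree h) :
    cls (Subgroup.center (GA F r) ⊔ rationalPoints F r) g = cls _ h ↔
      ∃ z ∈ Subgroup.center (GA F r), degree z = 0 ∧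
        cls (rationalPoints F r) (z * g) = cls (rationalPoints F r) h := by
  rw [cls_sup_eq_iff le_rfl]
  refine ⟨?_, fun ⟨z, hz, _, h1⟩ => ⟨z, hz, h1⟩⟩
  rintro ⟨z, hz, h1⟩
  have h2 := degree_eq_of_cls_eq h1
  rw [degree_center_mul hz hr, hgh] at h2
  exact ⟨z, hz, by linarith, h1⟩

end Domains

end GeoTrunc

open GeoTrunc in
theorem mainTheorem3 (F : Type*) [Field F] [NumberField F] (r : ℕ) (hr : 0 < r) (p : ℝ → ℝ)
    (hp : IsNormalizedConvex r p) :
    -- the canonical polygon exists: the largest polygon `p_Q^g` is a convex polygon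
    (∀ g : GA F r,
      IsGreatest (Set.range fun Q : Parabolic F r => Q.polygon g) (canonicalPolygon g) ∧
      ConcaveOn ℝ (Set.Icc (0 : ℝ) r) (canonicalPolygon g)) ∧
    -- the sums that define `Λ_p 𝟏` are finite
    (∀ (g : GA F r) (I : Composition r),
      {δ : Cosets (parabolicPoints I F) |
        Bigger I ((standard F I).polygon (diag F r δ.out * g)) p}.Finite) ∧
    -- `Λ_p 𝟏 = 𝟏(p̄^g ≤ p)`, and this is a function on `Z_{G(𝔸)} G(F) \ G(𝔸)`
    (∀ g : GA F r,
      truncation p (fun _ => 1) g = {h : GA F r | CanonicalLE p h}.indicator (fun _ => (1 : ℂ)) g) ∧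
    (∀ h ∈ Subgroup.center (GA F r) ⊔ rationalPoints F r, ∀ g : GA F r,
      truncation p (fun _ => 1) (h * g) = truncation p (fun _ => 1) g) ∧
    -- identification of the moduli space with the truncated domain
    (∀ T : ℝ, 0 < T →
      (∃ Φ : moduliSpace F r p T ≃ₜ truncatedDomain p (splitCenter F r),
        ∀ (g : GA F r) (hg : cls (rationalPoints F r) g ∈ moduliSpace F r p T),
          (Φ ⟨cls (rationalPoints F r) g, hg⟩ : Cosets (splitCenter F r ⊔ rationalPoints F r)) =
            cls (splitCenter F r ⊔ rationalPoints F r) g) ∧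
      (∃ Ψ : moduliSpace F r p T → truncatedDomain p (Subgroup.center (GA F r)),
        Topology.IsQuotientMap Ψ ∧
        (∀ (g : GA F r) (hg : cls (rationalPoints F r) g ∈ moduliSpace F r p T),
          (Ψ ⟨cls (rationalPoints F r) g, hg⟩ :
              Cosets (Subgroup.center (GA F r) ⊔ rationalPoints F r)) =
            cls (Subgroup.center (GA F r) ⊔ rationalPoints F r) g) ∧
        ∀ (g h : GA F r) (hg : cls (rationalPoints F r) g ∈ moduliSpace F r p T)
          (hh : cls (rationalPoints F r) h ∈ moduliSpace F r p T),
          Ψ ⟨cls (rationalPoints F r) g, hg⟩ = Ψ ⟨cls (rationalPoints F r) h, hh⟩ ↔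
            ∃ z ∈ Subgroup.center (GA F r), degree z = 0 ∧
              cls (rationalPoints F r) (z * g) = cls (rationalPoints F r) h)) ∧
    -- compactness of the truncated domain
    IsCompact (truncatedDomain p (splitCenter F r)) ∧
    IsCompact (truncatedDomain p (Subgroup.center (GA F r))) := by
  refine ⟨fun g => isGreatest_canonicalPolygon g hr, fun g I => finite_bigger hp hr g I,
    fun g => truncation_one hp hr constantTerm_one g, fun h hh g => truncation_mul hp hr hh g,
    fun T _ => ⟨⟨moduliHomeomorph hp hr T, fun _ _ => rfl⟩,
      domainMap ∘ moduliHomeomorph hp hr T,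
      (isQuotientMap_domainMap hp hr).comp (moduliHomeomorph hp hr T).isQuotientMap,
      fun _ _ => rfl, fun g h hg hh => ?_⟩,
    isCompact_truncatedDomain hp hr, isCompact_truncatedDomain_center hp hr⟩
  have h1 := ((cls_mem_moduliSpace hp hr).1 hg).1.trans ((cls_mem_moduliSpace hp hr).1 hh).1.symm
  exact Subtype.ext_iff.trans (cls_center_eq_iff hr h1)
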